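/- **Setting.** Let $d\ge 1$, $n,k\ge 0$, and for $N\in\{n,k\}$ let $V_N=(\mathbb C^N)^{\otimes d}$ with basis $e_{\mathbf i}=e_{i_1}\otimes\cdots\otimes e_{i_d}$, $\mathbf i\in[N]^d$. $\mathrm{GL}(N)^{\times d}$ acts on $V_N$, on the symmetric algebra $\bigvee V_N$ and on the exterior algebra $\bigwedge V_N$. $\mathrm{WV}_{\alpha}$ denotes the subspace of vectors of weight $\alpha$, and $\mathrm{HWV}_{\alpha}\subseteq \mathrm{WV}_\alpha$ the subspace of vectors fixed by all $d$-tuples of upper unitriangular matrices. For $\alpha=(\alpha^{(1)},\dots,\alpha^{(d)})$, with integer vectors $\alpha^{(\ell)}$, $A(\alpha)$ is the set of $d\times m$ tables of positive integers whose $\ell$-th row contains each letter $a$ exactly $\alpha^{(\ell)}_a$ times, and $B(\alpha)\subseteq A(\alpha)$ is the set of tables without repeated columns. For a table $X$ with columns $X(1),\dots,X(m)$ put $\bigvee e_X=e_{X(1)}\vee\cdots\vee e_{X(m)}$ and $\bigwedge e_X=e_{X(1)}\wedge\cdots\wedge e_{X(m)}$. Let $\|X\|$ be the number of permutations of the columns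 that fix $X$, and let $(-1)^X=\pm1$ be the parity of the total number of inversions of the rows of $X$. For words $s,w$ of length $m$, $\mathrm{sgn}_s(w)$ is the product, over the letters $a$ of $s$, of the signs of the subwords of $w$ at the positions of $a$ in $s$, where the sign of a word of length $c$ is $0$ if it is not a permutation of $[c]$; $\mathrm{sgn}_T(X)$ is the product of $\mathrm{sgn}_{t_\ell}(x_\ell)$ over the rows. Let $\lambda=(\lambda^{(1)},\dots,\lambda^{(d)})$ be a $d$-tuple of partitions of $m$, each with at most $n$ parts, all parts being at most $k$; $\lambda'$ is the tuple of conjugate partitions. For $T\in A(\lambda')$ put $$\Delta_T=\frac{(-1)^T}{\|T\|}\sum_{X\in A(\lambda)}\mathrm{sgn}_T(X)\bigvee e_X\in\bigvee V_n,\qquad \nabla_T=\frac{(-1)^T}{\|T\|}\sum_{Y\in B(\lambda)}\mathrm{sgn}_T(Y)\bigwedge e_Y\in\bigwedge V_n .$$ For $\ell\in[d]$ and letters $i\ne j$, $\alpha_{ij}^{(\ell)}\lambda'$ is $\lambda'$ with $e_i-e_j$ added to its $\ell$-th component, and $\partial^{(\ell)}_{ji}(X)$ is the set of tables obtained from $X$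 by replacing one letter $i$ of the $\ell$-th row by $j$. **Theorem.** (i) Let $d$ be odd. For all $\ell\in[d]$ and $i<j$, $$\sum_{T\in\partial^{(\ell)}_{ji}(X)}\Delta_T=0\quad (X\in B(\alpha^{(\ell)}_{ij}\lambda')),\qquad \sum_{S\in\partial^{(\ell)}_{ji}(Y)}\|S\|\,\nabla_S=0\quad (Y\in A(\alpha^{(\ell)}_{ij}\lambda')).$$ There are unique linear maps $\Delta:\mathrm{WV}_{\lambda'}\bigwedge V_k\to\mathrm{HWV}_\lambda\bigvee V_n$ with $\bigwedge e_T\mapsto\Delta_T$ and $\nabla:\mathrm{WV}_{\lambda'}\bigvee V_k\to\mathrm{HWV}_\lambda\bigwedge V_n$ with $\bigvee e_S\mapsto\nabla_S$ for all $T,S\in A(\lambda')$, and $$\ker\Delta=\mathrm{span}\Big\{\sum_{T\in\partial^{(\ell)}_{ji}(X)}\bigwedge e_T:\ \ell\in[d],\ i<j,\ X\in B(\alpha^{(\ell)}_{ij}\lambda')\Big\},$$ $$\ker\nabla=\mathrm{span}\Big\{\sum_{S\in\partial^{(\ell)}_{ji}(Y)}\|S\|\bigvee e_S:\ \ell\in[d],\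 i<j,\ Y\in A(\alpha^{(\ell)}_{ij}\lambda')\Big\}.$$ (ii) Let $d$ be even. For all $\ell\in[d]$ and $i<j$, $$\sum_{S\in\partial^{(\ell)}_{ji}(Y)}\|S\|\,\Delta_S=0\quad (Y\in A(\alpha^{(\ell)}_{ij}\lambda')),\qquad \sum_{T\in\partial^{(\ell)}_{ji}(X)}\nabla_T=0\quad (X\in B(\alpha^{(\ell)}_{ij}\lambda')).$$ There are unique linear maps $\Delta:\mathrm{WV}_{\lambda'}\bigvee V_k\to\mathrm{HWV}_\lambda\bigvee V_n$ with $\bigvee e_S\mapsto\Delta_S$ and $\nabla:\mathrm{WV}_{\lambda'}\bigwedge V_k\to\mathrm{HWV}_\lambda\bigwedge V_n$ with $\bigwedge e_T\mapsto\nabla_T$ for all $S,T\in A(\lambda')$, and $$\ker\Delta=\mathrm{span}\Big\{\sum_{S\in\partial^{(\ell)}_{ji}(Y)}\|S\|\bigvee e_S:\ \ell\in[d],\ i<j,\ Y\in A(\alpha^{(\ell)}_{ij}\lambda')\Big\},$$ $$\ker\nabla=\mathrm{span}\Big\{\sum_{T\in\partial^{(\ell)}_{ji}(X)}\bigwedge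 e_T:\ \ell\in[d],\ i<j,\ X\in B(\alpha^{(\ell)}_{ij}\lambda')\Big\}.$$ (iii) Let $T_1,\dots,T_q$ be tables with letters in $[k]$, $T_p\in A(\lambda_p')$, where $\lambda_p$ is a $d$-tuple of partitions of some $m_p$ as above, and let $\nu=\lambda_1+\cdots+\lambda_q$ (partwise sum). Call $T\in A(\nu')$ a concatenation of $T_1,\dots,T_q$ if it arises by writing $T_1,\dots,T_q$ next to each other and renaming letters in each row so that letters from different tables become different while equality and inequality of letters within each $T_p$ is preserved. A concatenation with letters in $[k]$ exists if all parts of $\nu$ are at most $k$, and for every such concatenation $T$, with $\varepsilon=(-1)^T\prod_p(-1)^{T_p}$, $$\Delta_{T_1}\vee\cdots\vee\Delta_{T_q}=\varepsilon\,\Delta_T,\qquad \nabla_{T_1}\wedge\cdots\wedge\nabla_{T_q}=\varepsilon\,\nabla_T .$$ Every algebraic relation follows from these product rules and the linear relations above: let $\sum_r c_r\,\Delta_{T_{r,1}}\vee\cdots\vee\Delta_{T_{r,q_r}}=0$ be a finite relation (the sizes, shapes and numbers of factors may vary), and let $T_r$ be a concatenation of $T_{r,1},\dots,T_{r,q_r}$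 with sign $\varepsilon_r$. Then $\sum_r c_r\varepsilon_r\bigwedge e_{T_r}$ (for odd $d$), respectively $\sum_r c_r\varepsilon_r\bigvee e_{T_r}$ (for even $d$), is a linear combination of the spanning vectors of the kernels of the maps $\Delta$ in (i), respectively (ii), taken for all $m$ and $\lambda$. Likewise, if $\sum_r c_r\,\nabla_{T_{r,1}}\wedge\cdots\wedge\nabla_{T_{r,q_r}}=0$, then $\sum_r c_r\varepsilon_r\bigvee e_{T_r}$ (odd $d$), respectively $\sum_r c_r\varepsilon_r\bigwedge e_{T_r}$ (even $d$), is a linear combination of the spanning vectors of the kernels of the maps $\nabla$. -/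

import Mathlib

open scoped BigOperators

noncomputable section

namespace HWV

/-! ### Tables and words

A `d × m` table with letters in `{0, …, n-1}` is given by its columns: `T j l` is the letter in
row `l` and column `j`.  Letters, rows, columns, and parts of partitions are numbered from `0`. -/

/-- `d × m` tables with letters in `Fin n`, as maps from columns to multi-indices. -/
abbrev Table (d m n : ℕ) : Type := Fin m → Fin d → Fin n

/-- `d`-tuples of integer vectors of length `n`. -/
abbrev Weight (d n : ℕ) : Type := Fin d → Fin n → ℤ

/-- The `l`-th row of a table, as a word. -/
def Table.row {d m n : ℕ} (T : Table d m n) (l : Fin d) : Fin m → ℕ := fun j => T j l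

/-- `A(α)`: the tables in whose row `l` the letter `a` occurs exactly `α l a` times. -/
def tables {d n : ℕ} (m : ℕ) (α : Weight d n) : Finset (Table d m n) :=
  Finset.univ.filter fun T =>
    ∀ l a, ((Finset.univ.filter fun j => T j l = a).card : ℤ) = α l a

open Classical in
/-- `B(α)`: the tables of weight `α` without repeated columns. -/
def tables01 {d n : ℕ} (m : ℕ) (α : Weight d n) : Finset (Table d m n) :=
  (tables m α).filter fun T => Function.Injective T

/-- The weight given by a `d`-tuple of partitions; part `a` of `lam l` is `(lam l).rowLen a`. -/
def shapeWeight {d : ℕ} (n : ℕ) (lam : Fin d → YoungDiagram) : Weight d n :=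
  fun l a => ((lam l).rowLen a : ℤ)

/-- The conjugate weight `λ'`. -/
def conjWeight {d : ℕ} (k : ℕ) (lam : Fin d → YoungDiagram) : Weight d k :=
  shapeWeight k fun l => (lam l).transpose

/-- `α_{ij}^{(l)}`: add `e_i - e_j` to the `l`-th component of a weight. -/
def shiftWeight {d n : ℕ} (l : Fin d) (i j : Fin n) (α : Weight d n) : Weight d n :=
  fun l' a => α l' a + (if l' = l ∧ a = i then 1 else 0) - (if l' = l ∧ a = j then 1 else 0)

/-- `∂_{ij}^{(l)}(S)`: the set of tables obtained from `S` by replacing a single letter `j` of the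
`l`-th row by the letter `i`. -/
def boundary {d m n : ℕ} (l : Fin d) (i j : Fin n) (S : Table d m n) : Finset (Table d m n) :=
  (Finset.univ.filter fun p => S p l = j).image
    fun p => Function.update S p (Function.update (S p) l i)

/-- `‖T‖`: the number of column permutations fixing `T`. -/
def stabCard {d m n : ℕ} (T : Table d m n) : ℕ :=
  (Finset.univ.filter fun π : Equiv.Perm (Fin m) => T ∘ π = T).card

/-! ### Signs -/

/-- The sign of the sequence `a` if it is a permutation of `{0, …, c-1}`, and `0` otherwise
(at most one summand is nonzero). -/
def seqSign {c : ℕ} (a : Fin c → ℕ) : ℤ :=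
  ∑ π : Equiv.Perm (Fin c), if ∀ i, a i = (π i : ℕ) then ((Equiv.Perm.sign π : ℤˣ) : ℤ) else 0

/-- The subsequence of `w` at the positions in `B`, in increasing order. -/
def subseq {m : ℕ} (w : Fin m → ℕ) (B : Finset (Fin m)) : Fin B.card → ℕ :=
  fun i => w (B.orderEmbOfFin rfl i)

/-- `sgn_s(w)`: the product over the blocks of `s` (sets of positions of a letter of `s`) of the
signs of the corresponding subsequences of `w`. -/
def wordSgn {m : ℕ} (s w : Fin m → ℕ) : ℤ :=
  ∏ a ∈ Finset.univ.image s, seqSign (subseq w (Finset.univ.filter fun j => s j = a))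

/-- `sgn_T(X)`: the product of `sgn` over all rows. -/
def tableSgn {d m k n : ℕ} (T : Table d m k) (X : Table d m n) : ℤ :=
  ∏ l, wordSgn (T.row l) (X.row l)

/-- `(-1)^w`, the parity of the number of inversions of the word `w`. -/
def invSign {m : ℕ} (w : Fin m → ℕ) : ℤ :=
  (-1) ^ (Finset.univ.filter fun p : Fin m × Fin m => p.1 < p.2 ∧ w p.2 < w p.1).card

/-- `(-1)^T`. -/
def tableSign {d m k : ℕ} (T : Table d m k) : ℤ := ∏ l, invSign (T.row l)

/-! ### Tensors, symmetric and exterior algebra -/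

/-- `V = (ℂ^n)^{⊗ d}`. -/
abbrev V (d n : ℕ) : Type := PiTensorProduct ℂ fun _ : Fin d => (Fin n → ℂ)

/-- The symmetric algebra of `V`. -/
abbrev SymAlg (d n : ℕ) : Type := SymmetricAlgebra ℂ (V d n)

/-- The exterior algebra of `V`. -/
abbrev AltAlg (d n : ℕ) : Type := ExteriorAlgebra ℂ (V d n)

/-- `e_{i_1} ⊗ ⋯ ⊗ e_{i_d}`. -/
def basisTensor {d n : ℕ} (i : Fin d → Fin n) : V d n :=
  PiTensorProduct.tprod ℂ fun l => (Pi.single (i l) 1 : Fin n → ℂ)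

/-- `⋁ e_X`, the symmetric product of the `e_{X(j)}`. -/
def vee {d m n : ℕ} (X : Table d m n) : SymAlg d n :=
  ∏ j, SymmetricAlgebra.ι ℂ (V d n) (basisTensor (X j))

/-- `⋀ e_X = e_{X(1)} ∧ ⋯ ∧ e_{X(m)}`. -/
def wedge {d m n : ℕ} (X : Table d m n) : AltAlg d n :=
  ExteriorAlgebra.ιMulti ℂ m fun j => basisTensor (X j)

/-- The action of a `d`-tuple of matrices on `V`: `v₁ ⊗ ⋯ ⊗ v_d ↦ g₁v₁ ⊗ ⋯ ⊗ g_dv_d`. -/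
def tensorAct {d n : ℕ} (g : Fin d → Matrix (Fin n) (Fin n) ℂ) : V d n →ₗ[ℂ] V d n :=
  PiTensorProduct.map fun l => Matrix.toLin' (g l)

/-- The induced action on the symmetric algebra. -/
def symAct {d n : ℕ} (g : Fin d → Matrix (Fin n) (Fin n) ℂ) : SymAlg d n →ₗ[ℂ] SymAlg d n :=
  (SymmetricAlgebra.lift (SymmetricAlgebra.ι ℂ (V d n) ∘ₗ tensorAct g)).toLinearMap

/-- The induced action on the exterior algebra. -/
def altAct {d n : ℕ} (g : Fin d → Matrix (Fin n) (Fin n) ℂ) : AltAlg d n →ₗ[ℂ] AltAlg d n :=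
  (ExteriorAlgebra.map (tensorAct g)).toLinearMap

/-! ### Weight spaces and highest weight spaces

`act` is the action of (the matrices in) `GL(n)^d` on a space `W`. -/

section Spaces

variable {d n : ℕ} {W : Type} [AddCommGroup W] [Module ℂ W]

/-- The value of the character `α` at the element `t` of the torus of `GL(n)^d`. -/
def torusChar (α : Weight d n) (t : Fin d → Fin n → ℂˣ) : ℂ :=
  ((∏ l, ∏ a, t l a ^ α l a : ℂˣ) : ℂ)

/-- `WV_α`: the vectors on which the torus of diagonal matrices acts by the character `α`. -/
def weightSpace (act : (Fin d → Matrix (Fin n) (Fin n) ℂ) → W →ₗ[ℂ] W) (α : Weight d n) :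
    Submodule ℂ W where
  carrier := {v | ∀ t : Fin d → Fin n → ℂˣ,
    act (fun l => Matrix.diagonal fun a => (t l a : ℂ)) v = torusChar α t • v}
  add_mem' := fun {v w} hv hw t => by rw [map_add, hv t, hw t, smul_add]
  zero_mem' := fun t => by rw [map_zero, smul_zero]
  smul_mem' := fun c v hv t => by rw [map_smul, hv t, smul_comm]

/-- Upper unitriangular matrices. -/
def IsUnitriangular (u : Matrix (Fin n) (Fin n) ℂ) : Prop :=
  (∀ a, u a a = 1) ∧ ∀ a b, b < a → u a b = 0

/-- `HWV_α`: the vectors of weight `α` that are fixed by all `d`-tuples of upper unitriangular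
matrices. -/
def hwSpace (act : (Fin d → Matrix (Fin n) (Fin n) ℂ) → W →ₗ[ℂ] W) (α : Weight d n) :
    Submodule ℂ W where
  carrier := {v | v ∈ weightSpace act α ∧
    ∀ u : Fin d → Matrix (Fin n) (Fin n) ℂ, (∀ l, IsUnitriangular (u l)) → act u v = v}
  add_mem' := fun {v w} hv hw =>
    ⟨Submodule.add_mem _ hv.1 hw.1, fun u hu => by rw [map_add, hv.2 u hu, hw.2 u hu]⟩
  zero_mem' := ⟨Submodule.zero_mem _, fun u _ => by rw [map_zero]⟩
  smul_mem' := fun c v hv =>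
    ⟨Submodule.smul_mem _ c hv.1, fun u hu => by rw [map_smul, hv.2 u hu]⟩

end Spaces

/-! ### The vectors `Δ_T` and `∇_T` -/

/-- `Δ_T = (-1)^T / ‖T‖ · ∑_{X ∈ A(λ)} sgn_T(X) ⋁ e_X`, an element of the symmetric algebra of
`(ℂ^n)^{⊗ d}`, for a table `T` of weight `λ'`. -/
def Delta {d m k : ℕ} (n : ℕ) (lam : Fin d → YoungDiagram) (T : Table d m k) : SymAlg d n :=
  ((tableSign T : ℂ) / (stabCard T : ℂ)) •
    ∑ X ∈ tables m (shapeWeight n lam), (tableSgn T X : ℂ) • vee X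

/-- `∇_T = (-1)^T / ‖T‖ · ∑_{Y ∈ B(λ)} sgn_T(Y) ⋀ e_Y`, an element of the exterior algebra of
`(ℂ^n)^{⊗ d}`, for a table `T` of weight `λ'`. -/
def Nabla {d m k : ℕ} (n : ℕ) (lam : Fin d → YoungDiagram) (T : Table d m k) : AltAlg d n :=
  ((tableSign T : ℂ) / (stabCard T : ℂ)) •
    ∑ Y ∈ tables01 m (shapeWeight n lam), (tableSgn T Y : ℂ) • wedge Y

/-! ### Boundary vectors -/

/-- The vectors `∑_{T ∈ ∂_{ji}(X)} ⋀ e_T` for all rows `l`, letters `i < j`, and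
`X ∈ B(α_{ij} λ')`. -/
def altBoundaries {d : ℕ} (m k : ℕ) (lam : Fin d → YoungDiagram) : Set (AltAlg d k) :=
  {w | ∃ (l : Fin d) (i j : Fin k), i < j ∧
    ∃ X ∈ tables01 m (shiftWeight l i j (conjWeight k lam)),
      w = ∑ T ∈ boundary l j i X, wedge T}

/-- The vectors `∑_{S ∈ ∂_{ji}(Y)} ‖S‖ ⋁ e_S` for all rows `l`, letters `i < j`, and
`Y ∈ A(α_{ij} λ')`. -/
def symBoundaries {d : ℕ} (m k : ℕ) (lam : Fin d → YoungDiagram) : Set (SymAlg d k) :=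
  {w | ∃ (l : Fin d) (i j : Fin k), i < j ∧
    ∃ Y ∈ tables m (shiftWeight l i j (conjWeight k lam)),
      w = ∑ S ∈ boundary l j i Y, (stabCard S : ℂ) • vee S}

/-- `lam` is a `d`-tuple of partitions of `m` with at most `n` parts, all of size at most `k`
(so that the conjugate partitions have at most `k` parts). -/
structure IsShape {d : ℕ} (m n k : ℕ) (lam : Fin d → YoungDiagram) : Prop where
  card_eq : ∀ l, (lam l).card = m
  length_le : ∀ l, (lam l).colLen 0 ≤ n
  width_le : ∀ l, (lam l).rowLen 0 ≤ k

/-- The boundary vectors in the exterior algebra for all sizes `m` and all shapes. -/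
def allAltBoundaries (d n k : ℕ) : Set (AltAlg d k) :=
  {w | ∃ (m : ℕ) (lam : Fin d → YoungDiagram), IsShape m n k lam ∧ w ∈ altBoundaries m k lam}

/-- The boundary vectors in the symmetric algebra for all sizes `m` and all shapes. -/
def allSymBoundaries (d n k : ℕ) : Set (SymAlg d k) :=
  {w | ∃ (m : ℕ) (lam : Fin d → YoungDiagram), IsShape m n k lam ∧ w ∈ symBoundaries m k lam}

/-! ### Index maps -/

section BasisVectors

theorem tensorAct_diagonal {d n : ℕ} (t : Fin d → Fin n → ℂ) (i : Fin d → Fin n) :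
    tensorAct (fun l => Matrix.diagonal (t l)) (basisTensor i)
      = (∏ l, t l (i l)) • basisTensor i := by
  unfold tensorAct basisTensor
  rw [PiTensorProduct.map_tprod, ← MultilinearMap.map_smul_univ]
  congr 1
  funext l
  rw [Matrix.toLin'_apply]
  funext a
  rw [Matrix.mulVec_diagonal]
  by_cases h : a = i l
  · subst h; simp
  · simp [h]

theorem prod_eq_torusChar {d m n : ℕ} {α : Weight d n} {X : Table d m n} (hX : X ∈ tables m α)
    (t : Fin d → Fin n → ℂˣ) :
    ∏ j, ∏ l, (t l (X j l) : ℂ) = torusChar α t := by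
  have hX' := (Finset.mem_filter.1 hX).2
  unfold torusChar
  push_cast
  rw [Finset.prod_comm]
  refine Finset.prod_congr rfl fun l _ => ?_
  rw [← Finset.prod_fiberwise Finset.univ (fun j => X j l) (fun j => (t l (X j l) : ℂ))]
  refine Finset.prod_congr rfl fun a _ => ?_
  rw [← hX' l a, zpow_natCast]
  apply Finset.prod_eq_pow_card
  intro j hj
  rw [(Finset.mem_filter.1 hj).2]

/-- `⋀ e_X` has weight `α` for `X ∈ A(α)`. -/
theorem wedge_mem {d m n : ℕ} {α : Weight d n} {X : Table d m n} (hX : X ∈ tables m α) :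
    wedge X ∈ weightSpace altAct α := by
  intro t
  unfold altAct wedge
  rw [AlgHom.toLinearMap_apply, ExteriorAlgebra.map_apply_ιMulti, ← prod_eq_torusChar hX t,
    ← AlternatingMap.map_smul_univ]
  congr 1
  funext j
  exact tensorAct_diagonal (fun l a => (t l a : ℂ)) (X j)

/-- `⋁ e_X` has weight `α` for `X ∈ A(α)`. -/
theorem vee_mem {d m n : ℕ} {α : Weight d n} {X : Table d m n} (hX : X ∈ tables m α) :
    vee X ∈ weightSpace symAct α := by
  intro t
  unfold symAct vee
  rw [AlgHom.toLinearMap_apply, map_prod, ← prod_eq_torusChar hX t, ← Finset.prod_smul]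
  refine Finset.prod_congr rfl fun j _ => ?_
  rw [SymmetricAlgebra.lift_ι_apply, LinearMap.comp_apply,
    tensorAct_diagonal (fun l a => (t l a : ℂ)) (X j), map_smul]

end BasisVectors

/-- `D` is the index map given on basis vectors by `⋀ e_T ↦ x T`, for all `T ∈ A(α)`. -/
def IsAltIndexMap {d m k : ℕ} {U : Type} [AddCommGroup U] [Module ℂ U] {α : Weight d k}
    {Q : Submodule ℂ U} (x : Table d m k → U)
    (D : weightSpace (altAct (d := d) (n := k)) α →ₗ[ℂ] Q) : Prop :=
  ∀ (T : Table d m k) (hT : T ∈ tables m α), (D ⟨wedge T, wedge_mem hT⟩ : U) = x T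

/-- `D` is the index map given on basis vectors by `⋁ e_S ↦ x S`, for all `S ∈ A(α)`. -/
def IsSymIndexMap {d m k : ℕ} {U : Type} [AddCommGroup U] [Module ℂ U] {α : Weight d k}
    {Q : Submodule ℂ U} (x : Table d m k → U)
    (D : weightSpace (symAct (d := d) (n := k)) α →ₗ[ℂ] Q) : Prop :=
  ∀ (S : Table d m k) (hS : S ∈ tables m α), (D ⟨vee S, vee_mem hS⟩ : U) = x S

/-! ### Products and concatenation -/

/-- A table `T` of weight `λ'`, indexing a factor `Δ_T` or `∇_T` of a product. -/
structure Factor (d n k : ℕ) where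
  /-- the number of columns -/
  m : ℕ
  /-- the `d`-tuple `λ` of partitions of `m` -/
  shape : Fin d → YoungDiagram
  isShape : IsShape m n k shape
  /-- the table -/
  table : Table d m k
  mem : table ∈ tables m (conjWeight k shape)

/-- The sum `λ + μ + ⋯` of partitions (adding parts). -/
def partSum {q : ℕ} (mu : Fin q → YoungDiagram) : YoungDiagram where
  cells := ((Finset.range (∑ i, (mu i).colLen 0)) ×ˢ
    (Finset.range (∑ i, (mu i).rowLen 0))).filter fun c => c.2 < ∑ i, (mu i).rowLen c.1
  isLowerSet := by
    rintro ⟨a, b⟩ ⟨a', b'⟩ ⟨h1, h2⟩ h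
    simp only [Finset.coe_filter, Finset.mem_product, Finset.mem_range, Set.mem_ofPred_eq] at h ⊢
    simp only at h1 h2
    have h3 : ∑ i, (mu i).rowLen a ≤ ∑ i, (mu i).rowLen a' :=
      Finset.sum_le_sum fun i _ => (mu i).rowLen_anti _ _ h1
    omega

theorem rowLen_partSum {q : ℕ} (mu : Fin q → YoungDiagram) (a : ℕ) :
    (partSum mu).rowLen a = ∑ i, (mu i).rowLen a := by
  have key : ∀ b, b < (partSum mu).rowLen a ↔ b < ∑ i, (mu i).rowLen a := by
    intro b
    rw [← YoungDiagram.mem_iff_lt_rowLen, ← YoungDiagram.mem_cells]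
    simp only [partSum, Finset.mem_filter, Finset.mem_product, Finset.mem_range]
    refine ⟨fun h => h.2, fun h => ⟨⟨?_, ?_⟩, h⟩⟩
    · obtain ⟨i, -, hi⟩ : ∃ i ∈ Finset.univ, 0 < (mu i).rowLen a := by
        by_contra! hc
        rw [Finset.sum_eq_zero fun i hi => Nat.le_zero.1 (hc i hi)] at h
        omega
      rw [← YoungDiagram.mem_iff_lt_rowLen, YoungDiagram.mem_iff_lt_colLen] at hi
      exact hi.trans_le
        (Finset.single_le_sum (f := fun i => (mu i).colLen 0) (fun _ _ => Nat.zero_le _)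
          (Finset.mem_univ i))
    · exact h.trans_le (Finset.sum_le_sum fun i _ => (mu i).rowLen_anti _ _ (Nat.zero_le _))
  exact le_antisymm (le_of_forall_lt fun b hb => (key b).1 hb)
    (le_of_forall_lt fun b hb => (key b).2 hb)

/-- The shape `λ₁ + ⋯ + λ_q` of a product. -/
def sumShape {d n k q : ℕ} (F : Fin q → Factor d n k) : Fin d → YoungDiagram :=
  fun l => partSum fun i => (F i).shape l

/-- `T` is a horizontal concatenation `T₁ ⊕ ⋯ ⊕ T_q`: the columns of `T₁, …, T_q` are placed next
to each other and the letters of each row are renamed so that letters from different tables are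
different, and the weight of the result is the partition `(λ₁ + ⋯ + λ_q)'`. -/
def IsConcat {d n k q : ℕ} (F : Fin q → Factor d n k) (T : Table d (∑ i, (F i).m) k) : Prop :=
  T ∈ tables (∑ i, (F i).m) (conjWeight k (sumShape F)) ∧
    ∀ (i i' : Fin q) (p : Fin (F i).m) (p' : Fin (F i').m) (l : Fin d),
      T (finSigmaFinEquiv ⟨i, p⟩) l = T (finSigmaFinEquiv ⟨i', p'⟩) l ↔
        i = i' ∧ (F i).table p l = (F i').table p' l

/-- The sign `(-1)^T (-1)^{T₁} ⋯ (-1)^{T_q}` caused by renaming letters. -/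
def concatSign {d n k q : ℕ} (F : Fin q → Factor d n k) (T : Table d (∑ i, (F i).m) k) : ℤ :=
  tableSign T * ∏ i, tableSign (F i).table

/-- `Δ_{T₁} ∨ ⋯ ∨ Δ_{T_q}`. -/
def prodDelta {d n k q : ℕ} (F : Fin q → Factor d n k) : SymAlg d n :=
  (List.ofFn fun i => Delta n (F i).shape (F i).table).prod

/-- `∇_{T₁} ∧ ⋯ ∧ ∇_{T_q}`. -/
def prodNabla {d n k q : ℕ} (F : Fin q → Factor d n k) : AltAlg d n :=
  (List.ofFn fun i => Nabla n (F i).shape (F i).table).prod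

end HWV

end

/-! For a word `s` of weight `μ`, the number `(-1)^s sgn_s(w)` is one determinant, `cellDet`: the
incidence matrix between the positions `j`, carrying the pairs `(s j, w j)`, and the cells of the
diagram listed lexicographically (`invSign_mul_wordSgn`). Thus, with `tableDet` the product of the
row determinants, `‖T‖ Δ_T` and `‖T‖ ∇_T` are both the sum over `X` of `tableDet e T X` times the
monomial of `X`.

As a function of the second word, `cellDet` is invariant under unitriangular matrices
(`sum_cellDet_mul_prod`), so the index vectors are highest weight vectors. As a function of the
first word it is killed by the raising operators (`replaceSum_cellDet`), and these are the linear
relations.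

Completeness of the relations rests on the converse: every function of words that has weight `μ` and
is killed by the raising operators is a combination of the functions `cellDet e · x`
(`hwFun_le_span_cellDet`). This goes by induction on the length, splitting off the largest final
letter; an `sl₂` norm argument (`eq_zero_of_mem_hwFun`) shows that the weight left over is still
dominant, so that the cell to be removed is a corner. Duality then finishes
(`sum_smul_mem_of_boundary`): a functional vanishing on all boundary vectors is, row by row, such a
function of the table, hence a combination of products of determinants, and coefficients pairing to
zero with these products pair to zero with the functional.

The symmetric and the exterior algebra are treated together as an `IsModel` with `ε = 0` or `1`, the
exponent of the sign by which column permutations act on monomials. Determinants contribute the sign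
to the power `d`, so source and target fit when `ε' + d + ε` is even; this is the distinction
between odd and even `d`. Averaging over column permutations passes between tables and monomials
(`sum_idx_eq_zero`, `sum_mon_mem_span`).

For products, signs and stabilizers are multiplicative under concatenation (`prod_idx`), so an
algebraic relation becomes a linear one between index vectors of possibly different shapes.
Different shapes have different weights, and weight spaces are independent, which reduces to the
kernel for one shape (`sum_mon_mem_span_of_shapes`). -/

noncomputable section

namespace HWV

section

/-! ### Enumerations of cells and the associated determinants -/

/-- `e` enumerates the cells `(a, b)`, `b < μ a`, without repetition. -/
structure IsEnum {m k n : ℕ} (e : Fin m → Fin k × Fin n) (μ : Fin k → ℕ) : Prop where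
  inj : Function.Injective e
  mem_iff : ∀ a b, (∃ c, e c = (a, b)) ↔ (b : ℕ) < μ a

/-- The determinant of the incidence matrix between the positions of a pair of words and the
enumerated cells. -/
def cellDet {m k n : ℕ} (e : Fin m → Fin k × Fin n) (s : Fin m → Fin k) (x : Fin m → Fin n) : ℂ :=
  Matrix.det (Matrix.of fun j c => if (s j, x j) = e c then (1 : ℂ) else 0)

variable {m k n : ℕ} {e : Fin m → Fin k × Fin n} {μ : Fin k → ℕ}

/-- A position off the diagram gives a zero row, and two positions on the same cell give equal rows;
otherwise the positions biject with the cells. -/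
theorem exists_perm_of_cellDet_ne_zero {s : Fin m → Fin k}
    {x : Fin m → Fin n} (h : cellDet e s x ≠ 0) :
    ∃ π : Equiv.Perm (Fin m), ∀ j, (s j, x j) = e (π j) := by
  have h1 : ∀ j, ∃ c, (s j, x j) = e c := by
    intro j
    by_contra! hj
    exact h (Matrix.det_eq_zero_of_row_eq_zero j fun c => by simp [hj c])
  choose π hπ using h1
  have hinj : Function.Injective π := by
    intro p q hpq
    by_contra hne
    refine h (Matrix.det_zero_of_row_eq hne ?_)
    ext c
    simp [hπ, hpq]
  exact ⟨Equiv.ofBijective π (Finite.injective_iff_bijective.1 hinj), hπ⟩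

theorem cellDet_of_perm (he : Function.Injective e) {s : Fin m → Fin k}
    {x : Fin m → Fin n} {π : Equiv.Perm (Fin m)} (h : ∀ j, (s j, x j) = e (π j)) :
    cellDet e s x = ((Equiv.Perm.sign π : ℤˣ) : ℤ) := by
  have : (Matrix.of fun j c => if (s j, x j) = e c then (1 : ℂ) else 0)
      = (1 : Matrix (Fin m) (Fin m) ℂ).submatrix π id := by
    ext j c
    simp only [Matrix.of_apply, Matrix.submatrix_apply, id, Matrix.one_apply, h j]
    simp only [he.eq_iff]
  rw [cellDet, this, Matrix.det_permute]
  simp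

theorem cellDet_comp_perm (e : Fin m → Fin k × Fin n) (s : Fin m → Fin k) (x : Fin m → Fin n)
    (σ : Equiv.Perm (Fin m)) :
    cellDet e (s ∘ σ) (x ∘ σ) = ((Equiv.Perm.sign σ : ℤˣ) : ℤ) * cellDet e s x := by
  have := Matrix.det_permute σ (Matrix.of fun j c => if (s j, x j) = e c then (1 : ℂ) else 0)
  rw [cellDet, cellDet, ← this]
  rfl

theorem IsEnum.card_fst (he : IsEnum e μ) (hn : ∀ a, μ a ≤ n) (a : Fin k) :
    (Finset.univ.filter fun c => (e c).1 = a).card = μ a := by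
  have : (Finset.univ.filter fun b : Fin n => (b : ℕ) < μ a).card = μ a := by
    rw [Fin.card_filter_val_lt, min_eq_right (hn a)]
  rw [← this]
  refine Finset.card_bij (fun c _ => (e c).2) ?_ ?_ ?_
  · intro c hc
    simp only [Finset.mem_filter, Finset.mem_univ, true_and] at hc ⊢
    rw [← he.mem_iff]
    exact ⟨c, by rw [← hc]⟩
  · intro c hc c' hc' h
    simp only [Finset.mem_filter, Finset.mem_univ, true_and] at hc hc'
    exact he.inj (Prod.ext (hc.trans hc'.symm) h)
  · intro b hb
    simp only [Finset.mem_filter, Finset.mem_univ, true_and] at hb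
    obtain ⟨c, hc⟩ := (he.mem_iff a b).2 hb
    exact ⟨c, by simp [hc], by simp [hc]⟩

theorem IsEnum.card_snd (he : IsEnum e μ) (b : Fin n) :
    (Finset.univ.filter fun c => (e c).2 = b).card
      = (Finset.univ.filter fun a : Fin k => (b : ℕ) < μ a).card := by
  refine Finset.card_bij (fun c _ => (e c).1) ?_ ?_ ?_
  · intro c hc
    simp only [Finset.mem_filter, Finset.mem_univ, true_and] at hc ⊢
    rw [← he.mem_iff]
    exact ⟨c, by rw [← hc]⟩
  · intro c hc c' hc' h
    simp only [Finset.mem_filter, Finset.mem_univ, true_and] at hc hc'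
    exact he.inj (Prod.ext h (hc.trans hc'.symm))
  · intro b hb
    simp only [Finset.mem_filter, Finset.mem_univ, true_and] at hb
    obtain ⟨c, hc⟩ := (he.mem_iff _ _).2 hb
    exact ⟨c, by simp [hc], by simp [hc]⟩

theorem card_filter_comp_perm {α : Type*} [DecidableEq α] (f : Fin m → α)
    (π : Equiv.Perm (Fin m)) (a : α) :
    (Finset.univ.filter fun j => f (π j) = a).card
      = (Finset.univ.filter fun j => f j = a).card := by
  refine Finset.card_bij (fun j _ => π j) ?_ ?_ ?_
  · intro j hj; simpa using hj
  · intro j _ j' _ h; exact π.injective h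
  · intro j hj; exact ⟨π.symm j, by simpa using hj, by simp⟩

theorem card_left_of_cellDet_ne_zero (he : IsEnum e μ) (hn : ∀ a, μ a ≤ n) {s : Fin m → Fin k}
    {x : Fin m → Fin n} (h : cellDet e s x ≠ 0) (a : Fin k) :
    (Finset.univ.filter fun j => s j = a).card = μ a := by
  obtain ⟨π, hπ⟩ := exists_perm_of_cellDet_ne_zero h
  rw [← he.card_fst hn a, ← card_filter_comp_perm (fun c => (e c).1) π]
  congr 1; ext j; simp [← hπ j]

theorem card_right_of_cellDet_ne_zero (he : IsEnum e μ) {s : Fin m → Fin k}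
    {x : Fin m → Fin n} (h : cellDet e s x ≠ 0) (b : Fin n) :
    (Finset.univ.filter fun j => x j = b).card
      = (Finset.univ.filter fun a : Fin k => (b : ℕ) < μ a).card := by
  obtain ⟨π, hπ⟩ := exists_perm_of_cellDet_ne_zero h
  rw [← he.card_snd b, ← card_filter_comp_perm (fun c => (e c).2) π]
  congr 1; ext j; simp [← hπ j]

/-! ### Raising operators on functions of words -/

/-- The sum of the values of `φ` at the words obtained from `y` by replacing one letter `i`
by `j`. -/
def replaceSum (i j : Fin k) (φ : (Fin m → Fin k) → ℂ) (y : Fin m → Fin k) : ℂ :=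
  ∑ p with y p = i, φ (Function.update y p j)

/-- Functions on words, supported on words of weight `μ` and annihilated by `replaceSum i j`
for `i < j`. -/
def hwFun (m : ℕ) (μ : Fin k → ℕ) : Submodule ℂ ((Fin m → Fin k) → ℂ) where
  carrier := {φ | (∀ s, φ s ≠ 0 → ∀ a, (Finset.univ.filter fun j => s j = a).card = μ a) ∧
    ∀ i j, i < j → ∀ y, replaceSum i j φ y = 0}
  add_mem' := by
    rintro φ ψ ⟨h1, h2⟩ ⟨h3, h4⟩
    refine ⟨fun s hs => ?_, fun i j hij y => ?_⟩
    · by_cases h : φ s = 0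
      · exact h3 s fun h' => hs (by simp [h, h'])
      · exact h1 s h
    · have := h2 i j hij y
      have := h4 i j hij y
      simp_all [replaceSum, Finset.sum_add_distrib]
  zero_mem' := by simp [replaceSum]
  smul_mem' := by
    rintro c φ ⟨h1, h2⟩
    refine ⟨fun s hs => h1 s fun h => hs (by simp [h]), fun i j hij y => ?_⟩
    have := h2 i j hij y
    simp only [replaceSum, Pi.smul_apply, ← Finset.smul_sum] at this ⊢
    rw [this, smul_zero]

/-- The source of all cancellations: with equal letters at `p` and `q`, the replacements at `p` and
at `q` differ by a transposition. It serves for words and for columns of tables. -/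
theorem update_update_swap {α β : Type*} [DecidableEq α] (y : α → β) {p q : α} (h : p ≠ q)
    (i j : β) (hp : y p = i) (hq : y q = i) :
    Function.update y p j ∘ Equiv.swap p q = Function.update y q j := by
  funext r
  by_cases h1 : r = p
  · subst h1; simp [Function.update_of_ne h, Function.update_of_ne h.symm, hp, hq]
  by_cases h2 : r = q
  · subst h2; simp
  · simp [Equiv.swap_apply_of_ne_of_ne h1 h2, h1, h2]

/-- If the term at `p` is nonzero, `(j, x p)` is a cell, hence so is `(i, x p)` because `μ j ≤ μ i`;
it is occupied by some `q` with `y q = i` and `x q = x p`. The terms at `p` and `q` are exchanged by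
a transposition fixing `x`, so they cancel. Any other replacement leaves `p` and `q` on the same
cell and contributes zero. -/
theorem replaceSum_cellDet (he : IsEnum e μ) {i j : Fin k} (hij : i ≠ j) (hμ : μ j ≤ μ i)
    (x : Fin m → Fin n) (y : Fin m → Fin k) :
    replaceSum i j (fun s => cellDet e s x) y = 0 := by
  unfold replaceSum
  by_contra hne
  obtain ⟨p, hp, hfp⟩ := Finset.exists_ne_zero_of_sum_ne_zero hne
  simp only [Finset.mem_filter, Finset.mem_univ, true_and] at hp
  obtain ⟨π, hπ⟩ := exists_perm_of_cellDet_ne_zero hfp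
  have hcell : (x p : ℕ) < μ i := by
    refine lt_of_lt_of_le ?_ hμ
    rw [← he.mem_iff]
    exact ⟨π p, by rw [← hπ p]; simp⟩
  obtain ⟨c, hc⟩ := (he.mem_iff _ _).2 hcell
  -- The position that fills the cell `(i, x p)` once `p` has moved to `(j, x p)`.
  set q := π.symm c with hq
  have hqc : (Function.update y p j q, x q) = (i, x p) := by rw [hπ q, hq, π.apply_symm_apply, hc]
  obtain ⟨hq1, hq2⟩ := Prod.ext_iff.1 hqc
  simp only at hq1 hq2
  have hpq : p ≠ q := by
    rintro h
    rw [← h] at hq1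
    simp at hq1
    exact hij hq1.symm
  rw [Function.update_of_ne hpq.symm] at hq1
  apply hne
  rw [Finset.sum_eq_add_of_mem p q (by simpa using hp) (by simpa using hq1) hpq]
  · have := cellDet_comp_perm e (Function.update y p j) x (Equiv.swap p q)
    rw [update_update_swap y hpq i j hp hq1, Equiv.Perm.sign_swap hpq] at this
    have hx : x ∘ Equiv.swap p q = x := by
      funext r
      by_cases h1 : r = p
      · subst h1; simp [hq2]
      by_cases h2 : r = q
      · subst h2; simp [hq2]
      · simp [Equiv.swap_apply_of_ne_of_ne h1 h2]
    rw [hx] at this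
    simp only [this]
    simp
  · rintro r - ⟨hrp, hrq⟩
    by_contra hr
    obtain ⟨π', hπ'⟩ := exists_perm_of_cellDet_ne_zero hr
    apply hpq
    apply π'.injective
    apply he.inj
    rw [← hπ', ← hπ', Function.update_of_ne (Ne.symm hrp), Function.update_of_ne (Ne.symm hrq), hp,
      hq1, hq2]

theorem cellDet_mem_hwFun (he : IsEnum e μ) (hμ : Antitone μ) (hn : ∀ a, μ a ≤ n)
    (x : Fin m → Fin n) : (fun s => cellDet e s x) ∈ hwFun m μ :=
  ⟨fun _ hs => card_left_of_cellDet_ne_zero he hn hs,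
    fun _ _ hij y => replaceSum_cellDet he hij.ne (hμ hij.le) x y⟩

/-- After `p` has turned from `i` to `j`, the second replacement either undoes this, which gives the
multiple of `φ y`, or acts on a `j` already present in `y`. -/
theorem replaceSum_comm {i j : Fin k} (hij : i ≠ j) (φ : (Fin m → Fin k) → ℂ)
    (y : Fin m → Fin k) :
    replaceSum i j (replaceSum j i φ) y
      = (Finset.univ.filter fun p => y p = i).card * φ y
        + ∑ p with y p = i, ∑ q with y q = j, φ (Function.update (Function.update y p j) q i) := by
  unfold replaceSum
  rw [← nsmul_eq_mul, ← Finset.sum_const, ← Finset.sum_add_distrib]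
  refine Finset.sum_congr rfl fun p hp => ?_
  simp only [Finset.mem_filter, Finset.mem_univ, true_and] at hp
  have : (Finset.univ.filter fun q => Function.update y p j q = j)
      = insert p (Finset.univ.filter fun q => y q = j) := by
    ext q
    by_cases h : q = p
    · simp [h]
    · simp [h]
  rw [this, Finset.sum_insert (by simp [hp, hij]), Function.update_idem, ← hp,
    Function.update_eq_self]

/-- The `sl₂` relation `[E, F] = H`: the two double sums agree because updates at different
positions commute. -/
theorem replaceSum_commutator {i j : Fin k} (hij : i ≠ j) (φ : (Fin m → Fin k) → ℂ)
    (y : Fin m → Fin k) :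
    replaceSum i j (replaceSum j i φ) y - replaceSum j i (replaceSum i j φ) y
      = ((Finset.univ.filter fun p => y p = i).card
        - (Finset.univ.filter fun p => y p = j).card) * φ y := by
  rw [replaceSum_comm hij, replaceSum_comm hij.symm,
    Finset.sum_comm (s := Finset.univ.filter fun p => y p = j)]
  have : ∑ p with y p = i, ∑ q with y q = j, φ (Function.update (Function.update y p j) q i)
      = ∑ p with y p = i, ∑ q with y q = j, φ (Function.update (Function.update y q i) p j) := by
    refine Finset.sum_congr rfl fun p hp => Finset.sum_congr rfl fun q hq => ?_
    simp only [Finset.mem_filter, Finset.mem_univ, true_and] at hp hq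
    rw [Function.update_comm]
    rintro rfl
    exact hij (hp.symm.trans hq)
  rw [this]
  ring

/-- Transposition of `E` and `F`, by reindexing words with `i` at `p` by words with `j` at `p`. -/
theorem sum_replaceSum_mul (i j : Fin k) (φ ψ : (Fin m → Fin k) → ℂ) :
    ∑ y, replaceSum i j φ y * ψ y = ∑ y, φ y * replaceSum j i ψ y := by
  unfold replaceSum
  simp only [Finset.sum_mul, Finset.mul_sum, Finset.sum_filter, ite_mul, mul_ite, zero_mul,
    mul_zero]
  rw [Finset.sum_comm, Finset.sum_comm (s := Finset.univ (α := Fin m → Fin k))]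
  refine Finset.sum_congr rfl fun p _ => ?_
  rw [← Finset.sum_filter, ← Finset.sum_filter]
  refine Finset.sum_nbij' (fun y => Function.update y p j) (fun y => Function.update y p i) ?_ ?_ ?_
    ?_ ?_
  · intro y _; simp
  · intro y _; simp
  · intro y hy
    simp only [Finset.mem_filter, Finset.mem_univ, true_and] at hy
    simp [← hy]
  · intro y hy
    simp only [Finset.mem_filter, Finset.mem_univ, true_and] at hy
    simp [← hy]
  · intro y hy
    simp only [Finset.mem_filter, Finset.mem_univ, true_and] at hy
    simp [← hy]

/-- A highest weight function whose weight is not dominant vanishes. -/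
theorem eq_zero_of_mem_hwFun {φ : (Fin m → Fin k) → ℂ} (hφ : φ ∈ hwFun m μ) {i j : Fin k}
    (hij : i < j) (hμ : μ i < μ j) : φ = 0 := by
  obtain ⟨h1, h2⟩ := hφ
  have hE : replaceSum i j φ = 0 := funext (h2 i j hij)
  -- `E φ = 0`, so the commutator alone remains. The letter counts are `μ i` and `μ j` only where `φ
  -- y ≠ 0`; elsewhere both sides vanish.
  have hEF : ∀ y, replaceSum i j (replaceSum j i φ) y = ((μ i : ℂ) - μ j) * φ y := by
    intro y
    have := replaceSum_commutator hij.ne φ y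
    rw [hE] at this
    by_cases hy : φ y = 0
    · simp only [hy, mul_zero] at this ⊢
      rw [← this]
      simp [replaceSum]
    · rw [h1 y hy, h1 y hy] at this
      rw [← this]
      simp [replaceSum]
  have hstar : ∀ y, star (replaceSum j i φ y) = replaceSum j i (fun s => star (φ s)) y := by
    intro y; simp [replaceSum]
  -- The identity `‖F φ‖² = (μ i - μ j) ‖φ‖²`, whose right side has a negative factor.
  have key : ∑ y, Complex.normSq (replaceSum j i φ y)
      = ((μ i : ℝ) - μ j) * ∑ y, Complex.normSq (φ y) := by
    have h3 : ∑ y, star (replaceSum j i φ y) * replaceSum j i φ y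
        = ((μ i : ℂ) - μ j) * ∑ y, star (φ y) * φ y := by
      simp only [hstar]
      rw [sum_replaceSum_mul, Finset.mul_sum]
      refine Finset.sum_congr rfl fun y _ => ?_
      rw [hEF]
      ring
    apply_fun ((↑) : ℝ → ℂ) using Complex.ofReal_injective
    push_cast
    simp only [Complex.normSq_eq_conj_mul_self]
    exact h3
  have h4 : 0 ≤ ∑ y, Complex.normSq (replaceSum j i φ y) :=
    Finset.sum_nonneg fun _ _ => Complex.normSq_nonneg _
  have h5 : 0 ≤ ∑ y, Complex.normSq (φ y) :=
    Finset.sum_nonneg fun _ _ => Complex.normSq_nonneg _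
  have h6 : (μ i : ℝ) - μ j < 0 := by
    have : (μ i : ℝ) < μ j := by exact_mod_cast hμ
    linarith
  have h7 : ∑ y, Complex.normSq (φ y) = 0 := by nlinarith
  rw [Finset.sum_eq_zero_iff_of_nonneg fun _ _ => Complex.normSq_nonneg _] at h7
  funext y
  simpa using h7 y (Finset.mem_univ y)

end

/-! ### Highest weight functions are spanned by determinants -/

section

variable {m k n : ℕ} {μ : Fin k → ℕ}

/-- The condition `b + 1 = μ a` says that the removed cell ends its row, so the remaining cells
again form initial segments of the rows. -/
theorem IsEnum.removeCell {e : Fin (m + 1) → Fin k × Fin n} (he : IsEnum e μ)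
    {c₀ : Fin (m + 1)} {a : Fin k} {b : Fin n} (hc : e c₀ = (a, b)) (hb : (b : ℕ) + 1 = μ a) :
    IsEnum (fun c => e (c₀.succAbove c)) (Function.update μ a (μ a - 1)) where
  inj := he.inj.comp Fin.succAbove_right_injective
  mem_iff := by
    intro a' b'
    have h1 : (∃ c, e (c₀.succAbove c) = (a', b')) ↔ (b' : ℕ) < μ a' ∧ (a', b') ≠ (a, b) := by
      rw [← he.mem_iff]
      constructor
      · rintro ⟨c, h⟩
        refine ⟨⟨_, h⟩, fun h' => ?_⟩
        rw [h', ← hc] at h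
        exact Fin.succAbove_ne _ _ (he.inj h)
      · rintro ⟨⟨c, h⟩, hne⟩
        obtain ⟨c', hc'⟩ := Fin.exists_succAbove_eq (x := c) (y := c₀) (by
          rintro rfl; exact hne (h.symm.trans hc))
        exact ⟨c', hc' ▸ h⟩
    rw [h1]
    by_cases ha : a' = a
    · subst ha
      simp only [ne_eq, Prod.mk.injEq, true_and, Function.update_self, Fin.ext_iff]
      omega
    · simp [ha]

/-- Laplace expansion along the last row, whose only nonzero entry is in column `c₀`. -/
theorem cellDet_snoc {e : Fin (m + 1) → Fin k × Fin n} (he : Function.Injective e)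
    {c₀ : Fin (m + 1)} {a : Fin k} {b : Fin n} (hc : e c₀ = (a, b))
    (s : Fin m → Fin k) (x : Fin m → Fin n) :
    cellDet e (Fin.snoc s a) (Fin.snoc x b)
      = (-1) ^ (m + (c₀ : ℕ)) * cellDet (fun c => e (c₀.succAbove c)) s x := by
  rw [cellDet, Matrix.det_succ_row _ (Fin.last m), Finset.sum_eq_single c₀]
  · simp only [Matrix.of_apply, Fin.snoc_last, hc, if_true, mul_one, Fin.val_last]
    congr 1
    rw [cellDet]
    congr 1
    ext j c
    simp [Fin.succAbove_last]
  · intro c _ hne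
    have : (a, b) ≠ e c := by rw [← hc]; exact he.ne hne.symm
    simp [this]
  · simp

theorem cellDet_snoc_eq_zero {e : Fin (m + 1) → Fin k × Fin n} (he : IsEnum e μ)
    {a : Fin k} {b : Fin n} (h : μ a ≤ b) (s : Fin m → Fin k) (x : Fin m → Fin n) :
    cellDet e (Fin.snoc s a) (Fin.snoc x b) = 0 := by
  refine Matrix.det_eq_zero_of_row_eq_zero (Fin.last m) fun c => ?_
  have : (a, b) ≠ e c := fun hc => by
    have := (he.mem_iff a b).1 ⟨c, hc.symm⟩
    omega
  simp [this]

theorem card_filter_snoc (s : Fin m → Fin k) (c a : Fin k) :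
    (Finset.univ.filter fun j => (Fin.snoc s c : Fin (m + 1) → Fin k) j = a).card
      = (Finset.univ.filter fun j => s j = a).card + if c = a then 1 else 0 := by
  simp only [Finset.card_filter, Fin.sum_univ_castSucc, Fin.snoc_castSucc, Fin.snoc_last]

theorem replaceSum_snoc (i j : Fin k) (φ : (Fin (m + 1) → Fin k) → ℂ) (y : Fin m → Fin k)
    (a : Fin k) :
    replaceSum i j φ (Fin.snoc y a)
      = replaceSum i j (fun s => φ (Fin.snoc s a)) y + if a = i then φ (Fin.snoc y j) else 0 := by
  simp only [replaceSum, Finset.sum_filter, Fin.sum_univ_castSucc, Fin.snoc_castSucc,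
    Fin.snoc_last, Fin.snoc_update, Fin.update_snoc_last]

/-- The component of a highest weight function at the largest final letter. -/
theorem snoc_mem_hwFun {φ : (Fin (m + 1) → Fin k) → ℂ} (hφ : φ ∈ hwFun (m + 1) μ) {a : Fin k}
    (ha : ∀ s c, a < c → φ (Fin.snoc s c) = 0) :
    (fun s => φ (Fin.snoc s a)) ∈ hwFun m (Function.update μ a (μ a - 1)) := by
  refine ⟨fun s hs c => ?_, fun i j hij y => ?_⟩
  · have := hφ.1 _ hs c
    rw [card_filter_snoc] at this
    by_cases h : c = a
    · subst h; simp at this ⊢; omega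
    · simp [h, Ne.symm h] at this ⊢; omega
  · have := hφ.2 i j hij (Fin.snoc y a)
    rw [replaceSum_snoc] at this
    by_cases h : a = i
    -- The extra term changes the final letter `a` to a larger `j`, where `φ` vanishes.
    · subst h; rw [ha _ _ hij] at this; simpa using this
    · simpa [h] using this

/-- Highest weight functions are spanned by the functions `cellDet e · x`. -/
theorem hwFun_le_span_cellDet (m : ℕ) : ∀ {μ : Fin k → ℕ} (_ : Antitone μ) (_ : ∀ a, μ a ≤ n)
    {e : Fin m → Fin k × Fin n} (_ : IsEnum e μ),
    hwFun m μ ≤ Submodule.span ℂ (Set.range fun x : Fin m → Fin n => fun s => cellDet e s x) := by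
  induction m with
  | zero =>
    intro μ _ _ e _ φ _
    have : φ = φ Fin.elim0 • fun s => cellDet e s Fin.elim0 := by
      funext s
      have hs : s = Fin.elim0 := Subsingleton.elim _ _
      simp [cellDet, hs]
    rw [this]
    exact Submodule.smul_mem _ _ (Submodule.subset_span ⟨_, rfl⟩)
  | succ m ih =>
    intro μ hμ hn e he
    have hsub : Submodule.span ℂ (Set.range fun x : Fin (m + 1) → Fin n => fun s => cellDet e s x)
        ≤ hwFun (m + 1) μ := by
      rw [Submodule.span_le]
      rintro _ ⟨x, rfl⟩
      exact cellDet_mem_hwFun he hμ hn x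
    -- An inner induction: `A` is a strict upper bound for the final letters of words on which `φ`
    -- is nonzero.
    suffices h : ∀ A, A ≤ k → ∀ φ ∈ hwFun (m + 1) μ,
        (∀ s (c : Fin k), A ≤ c → φ (Fin.snoc s c) = 0) →
        φ ∈ Submodule.span ℂ (Set.range fun x : Fin (m + 1) → Fin n => fun s => cellDet e s x) from
      fun φ hφ => h k le_rfl φ hφ fun s c hc => absurd c.2 (by omega)
    intro A
    induction A with
    | zero =>
      intro _ φ _ h0
      have : φ = 0 := by
        funext s
        rw [← Fin.snoc_init_self s]
        exact h0 _ _ (Nat.zero_le _)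
      rw [this]
      exact Submodule.zero_mem _
    | succ A ihA =>
      intro hA φ hφ h0
      set a : Fin k := ⟨A, hA⟩ with ha
      have h0' : ∀ s c, a < c → φ (Fin.snoc s c) = 0 := fun s c hc => h0 s c hc
      set v : (Fin m → Fin k) → ℂ := fun s => φ (Fin.snoc s a) with hv
      have hvmem := snoc_mem_hwFun hφ h0'
      by_cases hv0 : v = 0
      · refine ihA (by omega) φ hφ fun s c hc => ?_
        rcases Nat.lt_or_ge A c with h | h
        · exact h0 s c h
        · have : c = a := Fin.ext (by simp [ha]; omega)
          rw [this]
          exact congrFun hv0 s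
      obtain ⟨s₀, hs₀⟩ := Function.ne_iff.1 hv0
      have hμa : 0 < μ a := by
        rw [← hφ.1 _ hs₀ a, card_filter_snoc]
        simp
      set μ' := Function.update μ a (μ a - 1) with hμ'
      -- The component at the largest final letter is a nonzero highest weight function of weight
      -- `μ'`, so `μ'` has to be dominant.
      have hanti : Antitone μ' := by
        intro i j hij
        rcases hij.eq_or_lt with rfl | hij
        · exact le_rfl
        by_contra hlt
        exact hv0 (eq_zero_of_mem_hwFun hvmem hij (not_le.1 hlt))
      have hn' : ∀ c, μ' c ≤ n := by
        intro c
        by_cases h : c = a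
        · subst h; simp [hμ']; have := hn a; omega
        · simp [hμ', h, hn c]
      -- The last cell of row `a`; by `hanti` it is a corner of the diagram.
      let b : Fin n := ⟨μ a - 1, by have := hn a; omega⟩
      obtain ⟨c₀, hc₀⟩ := (he.mem_iff a b).2 (by simp [b]; omega)
      have he' := he.removeCell hc₀ (by simp [b]; omega)
      have hvspan := ih hanti hn' he' hvmem
      -- Lifting from length `m`: appending `b` to `x` recovers the given function at final letter
      -- `a`, up to the Laplace sign, and adds nothing at larger final letters.
      have key : ∀ w ∈ Submodule.span ℂ (Set.range fun x : Fin m → Fin n => fun s =>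
          cellDet (fun c => e (c₀.succAbove c)) s x), ∃ ψ ∈ Submodule.span ℂ
            (Set.range fun x : Fin (m + 1) → Fin n => fun s => cellDet e s x),
          (∀ s, ψ (Fin.snoc s a) = w s) ∧ ∀ s c, a < c → ψ (Fin.snoc s c) = 0 := by
        intro w hw
        induction hw using Submodule.span_induction with
        | mem w hw =>
          obtain ⟨x, rfl⟩ := hw
          refine ⟨(-1 : ℂ) ^ (m + (c₀ : ℕ)) • fun s => cellDet e s (Fin.snoc x b),
            Submodule.smul_mem _ _ (Submodule.subset_span ⟨_, rfl⟩), fun s => ?_, fun s c hc => ?_⟩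
          · simp only [Pi.smul_apply, smul_eq_mul]
            rw [cellDet_snoc he.inj hc₀, ← mul_assoc, ← mul_pow]
            simp
          · simp only [Pi.smul_apply, smul_eq_mul]
            rw [cellDet_snoc_eq_zero he, mul_zero]
            -- Dominance of `μ'` gives `μ c ≤ μ a - 1 = b`, so `(c, b)` is not a cell.
            have := hanti hc.le
            simp only [hμ', Function.update_self, Function.update_of_ne hc.ne'] at this
            exact this
        | zero => exact ⟨0, Submodule.zero_mem _, fun _ => rfl, fun _ _ _ => rfl⟩
        | add w₁ w₂ _ _ h₁ h₂ =>
          obtain ⟨ψ₁, hψ₁, h11, h12⟩ := h₁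
          obtain ⟨ψ₂, hψ₂, h21, h22⟩ := h₂
          exact ⟨ψ₁ + ψ₂, Submodule.add_mem _ hψ₁ hψ₂, fun s => by simp [h11, h21],
            fun s c hc => by simp [h12 s c hc, h22 s c hc]⟩
        | smul t w _ h =>
          obtain ⟨ψ, hψ, h1, h2⟩ := h
          exact ⟨t • ψ, Submodule.smul_mem _ _ hψ, fun s => by simp [h1],
            fun s c hc => by simp [h2 s c hc]⟩
      obtain ⟨ψ, hψ, h1, h2⟩ := key _ hvspan
      -- Subtracting the lift kills the component at `a`, which lowers the bound on final letters.
      have h3 : φ - ψ ∈ Submodule.span ℂ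
          (Set.range fun x : Fin (m + 1) → Fin n => fun s => cellDet e s x) := by
        refine ihA (by omega) _ (Submodule.sub_mem _ hφ (hsub hψ)) fun s c hc => ?_
        rcases Nat.lt_or_ge A c with h | h
        · simp [h0 s c h, h2 s c h]
        · have : c = a := Fin.ext (by simp [ha]; omega)
          rw [this]
          simp [h1 s]
      have := Submodule.add_mem _ h3 hψ
      rwa [sub_add_cancel] at this

end

/-! ### Lexicographic enumerations and unitriangular invariance -/

section

variable {m k n : ℕ} {e : Fin m → Fin k × Fin n} {μ : Fin k → ℕ}

/-- `e` lists the cells in lexicographic order. -/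
def IsLexIncreasing (e : Fin m → Fin k × Fin n) : Prop :=
  ∀ c c', c < c' → (e c).1 < (e c').1 ∨ (e c).1 = (e c').1 ∧ (e c).2 < (e c').2

theorem IsLexIncreasing.injective (he : IsLexIncreasing e) : Function.Injective e := by
  intro c c' h
  by_contra hne
  rcases lt_or_gt_of_ne hne with hlt | hlt
  · have := he _ _ hlt; simp [h] at this
  · have := he _ _ hlt; simp [h] at this

theorem exists_isEnum (μ : Fin k → ℕ) (hn : ∀ a, μ a ≤ n) (hm : ∑ a, μ a = m) :
    ∃ e : Fin m → Fin k × Fin n, IsEnum e μ ∧ IsLexIncreasing e := by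
  classical
  let C : Finset (Fin k ×ₗ Fin n) :=
    Finset.univ.filter fun c => ((ofLex c).2 : ℕ) < μ (ofLex c).1
  have hC : C.card = m := by
    rw [← hm, ← Finset.card_sigma Finset.univ (fun a => Finset.univ.filter fun b : Fin n => (b : ℕ) < μ a)
      |>.trans (Finset.sum_congr rfl fun a _ => by rw [Fin.card_filter_val_lt, min_eq_right (hn a)])]
    refine Finset.card_bij (fun c _ => ⟨(ofLex c).1, (ofLex c).2⟩) ?_ ?_ ?_
    · intro c hc; simpa [C] using hc
    · intro c _ c' _ h
      simp only [Sigma.mk.injEq, heq_eq_eq] at h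
      exact ofLex_inj.1 (Prod.ext h.1 h.2)
    · rintro ⟨a, b⟩ h
      exact ⟨toLex (a, b), by simpa [C] using h, rfl⟩
  let f := C.orderEmbOfFin hC
  have hlex : IsLexIncreasing fun c => ofLex (f c) := by
    intro c c' h
    have : f c < f c' := f.strictMono h
    rwa [Prod.Lex.lt_iff] at this
  refine ⟨fun c => ofLex (f c), ⟨hlex.injective, fun a b => ?_⟩, hlex⟩
  have h1 : toLex (a, b) ∈ Set.range f ↔ toLex (a, b) ∈ (C : Set _) := by
    rw [Finset.range_orderEmbOfFin]
  have h2 : toLex (a, b) ∈ (C : Set _) ↔ (b : ℕ) < μ a := by simp [C]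
  rw [← h2, ← h1]
  exact Iff.rfl

/-- `cellDet e s ·` is fixed by upper unitriangular matrices. -/
theorem sum_cellDet_mul_prod (he : IsEnum e μ) (hlex : IsLexIncreasing e)
    {u : Matrix (Fin n) (Fin n) ℂ} (hu : IsUnitriangular u) (s : Fin m → Fin k)
    (z : Fin m → Fin n) :
    ∑ x, cellDet e s x * ∏ j, u (z j) (x j) = cellDet e s z := by
  -- By multilinearity in the rows, the sum over `x` equals `det N`; `N` is the incidence matrix at
  -- `z` times a unitriangular matrix `U` indexed by cells.
  let N : Matrix (Fin m) (Fin m) ℂ := Matrix.of fun j c => if s j = (e c).1 then u (z j) (e c).2 else 0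
  let U : Matrix (Fin m) (Fin m) ℂ :=
    Matrix.of fun c' c => if (e c').1 = (e c).1 then u (e c').2 (e c).2 else 0
  have hN : N = (Matrix.of fun j c => if (s j, z j) = e c then (1 : ℂ) else 0) * U := by
    ext j c
    rw [Matrix.mul_apply]
    simp only [N, U, Matrix.of_apply, ite_mul, one_mul, zero_mul]
    by_cases hs : ∃ c', (s j, z j) = e c'
    · obtain ⟨c', hc'⟩ := hs
      rw [Finset.sum_eq_single c' (fun b _ hb => if_neg fun h => hb (he.inj (h.symm.trans hc')))
        (by simp), if_pos hc', ← hc']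
    · rw [Finset.sum_eq_zero fun c' _ => if_neg fun h => hs ⟨c', h⟩]
      split_ifs with h
      -- Here `(s j, z j)` is not a cell, so `z j` lies beyond every cell of its row and the entry
      -- of `u` is below the diagonal.
      · apply hu.2
        rw [Fin.lt_def]
        have h1 := (he.mem_iff (e c).1 (e c).2).1 ⟨c, rfl⟩
        have h2 : ¬ (z j : ℕ) < μ (s j) := fun hlt => hs <| by
          obtain ⟨c', hc'⟩ := (he.mem_iff _ _).2 hlt
          exact ⟨c', hc'.symm⟩
        rw [h] at h2
        omega
      · rfl
  -- The lexicographic order makes `U` upper triangular with ones on the diagonal.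
  have hU : U.det = 1 := by
    rw [Matrix.det_of_isUpperTriangular]
    · exact Finset.prod_eq_one fun c _ => by simp [U, hu.1]
    · intro c c' hcc
      simp only [U, Matrix.of_apply]
      split_ifs with h
      · apply hu.2
        rcases hlex _ _ hcc with h' | h'
        · exact absurd h h'.ne'
        · exact h'.2
      · rfl
  have hdet : N.det = cellDet e s z := by rw [hN, Matrix.det_mul, hU, mul_one]; rfl
  rw [← hdet, Matrix.det_apply']
  simp only [cellDet, Matrix.det_apply', Finset.sum_mul]
  rw [Finset.sum_comm]
  refine Finset.sum_congr rfl fun π _ => ?_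
  simp only [mul_assoc, ← Finset.mul_sum]
  congr 1
  -- For a fixed permutation the Leibniz term is a product over positions, so the sum over words
  -- factors into sums over letters.
  have h1 : ∀ x : Fin m → Fin n, (∏ j, (Matrix.of fun j c => if (s j, x j) = e c then (1 : ℂ) else 0) (π j) j)
      * ∏ j, u (z j) (x j) = ∏ j, (if (s j, x j) = e (π.symm j) then 1 else 0) * u (z j) (x j) := by
    intro x
    rw [Finset.prod_mul_distrib, ← Equiv.prod_comp π (fun j => if (s j, x j) = e (π.symm j) then (1 : ℂ) else 0)]
    simp
  simp only [h1]
  rw [← Fintype.prod_sum fun j b => (if (s j, b) = e (π.symm j) then (1 : ℂ) else 0) * u (z j) b,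
    ← Equiv.prod_comp π fun j => ∑ b, _]
  refine Finset.prod_congr rfl fun c _ => ?_
  simp only [N, Matrix.of_apply, π.symm_apply_apply, ite_mul, one_mul, zero_mul, Prod.ext_iff]
  by_cases h : s (π c) = (e c).1
  · simp [h]
  · simp [h]

end

section

/-! ### Signs of words as products over inversions -/

theorem sign_eq_prod_inversions {c : ℕ} (π : Equiv.Perm (Fin c)) :
    ((Equiv.Perm.sign π : ℤˣ) : ℤ) = ∏ p, ∏ q, if p < q ∧ π q < π p then (-1 : ℤ) else 1 := by
  rw [Equiv.Perm.sign_eq_prod_prod_Ioi]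
  push_cast
  refine Finset.prod_congr rfl fun p _ => ?_
  rw [← Finset.prod_subset (Finset.subset_univ (Finset.Ioi p))]
  · refine Finset.prod_congr rfl fun q hq => ?_
    rw [Finset.mem_Ioi] at hq
    have : π p ≠ π q := π.injective.ne hq.ne
    rcases lt_or_gt_of_ne this with h | h
    · simp [h, h.not_gt]
    · simp [h, hq, h.not_gt]
  · intro q _ hq
    rw [Finset.mem_Ioi] at hq
    simp [hq]

theorem seqSign_of_perm {c : ℕ} {a : Fin c → ℕ} {π : Equiv.Perm (Fin c)}
    (h : ∀ i, a i = (π i : ℕ)) : seqSign a = ((Equiv.Perm.sign π : ℤˣ) : ℤ) := by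
  unfold seqSign
  rw [Finset.sum_eq_single π, if_pos h]
  · intro π' _ hne
    refine if_neg fun h' => hne ?_
    ext i
    rw [← h i, h' i]
  · simp

theorem seqSign_eq_zero {c : ℕ} {a : Fin c → ℕ}
    (h : ¬ ∃ π : Equiv.Perm (Fin c), ∀ i, a i = (π i : ℕ)) : seqSign a = 0 :=
  Finset.sum_eq_zero fun π _ => if_neg fun h' => h ⟨π, h'⟩

/-- The increasing enumeration of `B` preserves inversions, so the sign can be computed on the
positions themselves, without naming the enumeration. -/
theorem seqSign_subseq {m : ℕ} (w : Fin m → ℕ) (B : Finset (Fin m)) [Decidable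
      ((∀ p ∈ B, w p < B.card) ∧ ∀ p ∈ B, ∀ q ∈ B, w p = w q → p = q)] :
    seqSign (subseq w B) = if (∀ p ∈ B, w p < B.card) ∧ ∀ p ∈ B, ∀ q ∈ B, w p = w q → p = q then
      ∏ p ∈ B, ∏ q ∈ B, if p < q ∧ w q < w p then (-1 : ℤ) else 1 else 0 := by
  set f := B.orderEmbOfFin rfl with hf
  have hB : ∀ p ∈ B, ∃ i, f i = p := by
    intro p hp
    have : p ∈ Set.range f := by rw [hf, Finset.range_orderEmbOfFin]; exact hp
    exact this
  have hfB : ∀ i, f i ∈ B := fun i => B.orderEmbOfFin_mem rfl i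
  split_ifs with h
  · have hinj : Function.Injective fun i : Fin B.card => (⟨w (f i), h.1 _ (hfB i)⟩ : Fin B.card) := by
      intro i j hij
      simp only [Fin.mk.injEq] at hij
      exact f.injective (h.2 _ (hfB i) _ (hfB j) hij)
    let π := Equiv.ofBijective _ (Finite.injective_iff_bijective.1 hinj)
    have hπ : ∀ i, subseq w B i = (π i : ℕ) := fun i => rfl
    rw [seqSign_of_perm hπ, sign_eq_prod_inversions]
    have hprod : ∀ g : Fin m → ℤ, ∏ p ∈ B, g p = ∏ i, g (f i) := by
      intro g
      refine (Finset.prod_bij (fun i _ => f i) (fun i _ => hfB i) (fun i _ j _ hij => f.injective hij)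
        (fun p hp => ?_) (fun _ _ => rfl)).symm
      obtain ⟨i, hi⟩ := hB p hp
      exact ⟨i, Finset.mem_univ _, hi⟩
    rw [hprod]
    refine Finset.prod_congr rfl fun i _ => ?_
    rw [hprod]
    refine Finset.prod_congr rfl fun j _ => ?_
    simp only [f.lt_iff_lt, Fin.lt_def, ← hπ]
    rfl
  · refine seqSign_eq_zero fun ⟨π, hπ⟩ => h ⟨fun p hp => ?_, fun p hp q hq hpq => ?_⟩
    · obtain ⟨i, rfl⟩ := hB p hp
      exact (hπ i).trans_lt (π i).2
    · obtain ⟨i, rfl⟩ := hB p hp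
      obtain ⟨j, rfl⟩ := hB q hq
      have : (π i : ℕ) = π j := by rw [← hπ, ← hπ]; exact hpq
      rw [π.injective (Fin.ext this)]

/-- Every subword of `w` at the positions of a letter of `s` is a permutation. -/
def IsBlockPerm {m : ℕ} (s w : Fin m → ℕ) : Prop :=
  (∀ p, w p < (Finset.univ.filter fun q => s q = s p).card) ∧ ∀ p q, s p = s q → w p = w q → p = q

-- Inversions inside the blocks are collected into one product over all pairs of positions, the form
-- in which they combine with the inversions of `s`.
open Classical in
theorem wordSgn_eq {m : ℕ} (s w : Fin m → ℕ) :
    wordSgn s w = if IsBlockPerm s w then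
      ∏ p, ∏ q, if p < q ∧ s p = s q ∧ w q < w p then (-1 : ℤ) else 1 else 0 := by
  unfold wordSgn
  simp only [seqSign_subseq]
  split_ifs with h
  · rw [← Finset.prod_fiberwise_of_maps_to (s := Finset.univ) (t := Finset.univ.image s) (g := s)
      (fun p _ => Finset.mem_image_of_mem s (Finset.mem_univ p))]
    refine Finset.prod_congr rfl fun a ha => ?_
    rw [if_pos]
    · refine Finset.prod_congr rfl fun p hp => ?_
      simp only [Finset.mem_filter, Finset.mem_univ, true_and] at hp
      rw [Finset.prod_filter]
      refine Finset.prod_congr rfl fun q _ => ?_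
      by_cases hq : s q = a
      · simp [hp, hq]
      · simp [hp, hq, Ne.symm hq]
    · refine ⟨fun p hp => ?_, fun p hp q hq => ?_⟩
      · simp only [Finset.mem_filter, Finset.mem_univ, true_and] at hp
        rw [← hp]
        exact h.1 p
      · simp only [Finset.mem_filter, Finset.mem_univ, true_and] at hp hq
        exact h.2 p q (hp.trans hq.symm)
  · by_contra hne
    rw [← ne_eq, Finset.prod_ne_zero_iff] at hne
    refine h ⟨fun p => ?_, fun p q hpq hw => ?_⟩
    · have := hne (s p) (Finset.mem_image_of_mem s (Finset.mem_univ p))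
      have := (ite_ne_right_iff.1 this).1.1 p (by simp)
      exact this
    · have := hne (s p) (Finset.mem_image_of_mem s (Finset.mem_univ p))
      exact (ite_ne_right_iff.1 this).1.2 p (by simp) q (by simp [hpq]) hw

theorem invSign_eq {m : ℕ} (w : Fin m → ℕ) :
    invSign w = ∏ p, ∏ q, if p < q ∧ w q < w p then (-1 : ℤ) else 1 := by
  unfold invSign
  rw [← Finset.prod_const, Finset.prod_filter, Fintype.prod_prod_type]

variable {m k n : ℕ} {e : Fin m → Fin k × Fin n} {μ : Fin k → ℕ}

/-- Positions are sent to the lexicographic indices of their cells. A pair `p < q` is inverted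
exactly when `s q < s p`, an inversion of `s`, or `s q = s p` and `x q < x p`, an inversion inside a
block. If some block is not a permutation, both sides are zero. -/
theorem invSign_mul_wordSgn (he : IsEnum e μ) (hlex : IsLexIncreasing e) {s : Fin m → Fin k}
    (hs : ∀ a, (Finset.univ.filter fun j => s j = a).card = μ a) (x : Fin m → Fin n) :
    ((invSign (fun j => (s j : ℕ)) * wordSgn (fun j => (s j : ℕ)) (fun j => (x j : ℕ)) : ℤ) : ℂ)
      = cellDet e s x := by
  classical
  have hcard : ∀ p, (Finset.univ.filter fun q => (s q : ℕ) = s p).card = μ (s p) := by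
    intro p
    rw [← hs (s p)]
    simp only [Fin.val_inj]
  rw [wordSgn_eq, invSign_eq]
  split_ifs with h
  · have h1 : ∀ j, ∃ c, e c = (s j, x j) := by
      intro j
      rw [he.mem_iff, ← hcard]
      exact h.1 j
    choose f hf using h1
    have hinj : Function.Injective f := by
      intro p q hpq
      have : (s p, x p) = (s q, x q) := by rw [← hf, ← hf, hpq]
      rw [Prod.mk.injEq] at this
      exact h.2 p q (by simp [this.1]) (by simp [this.2])
    let π := Equiv.ofBijective f (Finite.injective_iff_bijective.1 hinj)
    have hπ : ∀ j, (s j, x j) = e (π j) := fun j => (hf j).symm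
    rw [cellDet_of_perm he.inj hπ, sign_eq_prod_inversions]
    congr 1
    rw [← Finset.prod_mul_distrib]
    refine Finset.prod_congr rfl fun p _ => ?_
    rw [← Finset.prod_mul_distrib]
    refine Finset.prod_congr rfl fun q _ => ?_
    by_cases hpq : p < q
    · have h2 : π q < π p ↔ s q < s p ∨ s q = s p ∧ x q < x p := by
        have e1 := Prod.ext_iff.1 (hπ p)
        have e2 := Prod.ext_iff.1 (hπ q)
        simp only at e1 e2
        rw [e1.1, e1.2, e2.1, e2.2]
        refine ⟨hlex _ _, fun h3 => ?_⟩
        by_contra hle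
        rcases (not_lt.1 hle).eq_or_lt with h4 | h4
        · simp [h4] at h3
        · have := hlex _ _ h4
          omega
      simp only [h2, hpq, true_and, Fin.val_fin_lt, Fin.val_inj]
      rcases lt_trichotomy (s q) (s p) with h3 | h3 | h3
      · simp [h3, h3.ne']
      · simp [h3]
      · simp [h3.not_gt, h3.ne, h3.ne']
    · simp [hpq]
  · rw [mul_zero]
    by_contra hne
    obtain ⟨π, hπ⟩ := exists_perm_of_cellDet_ne_zero (Ne.symm (by simpa using hne))
    refine h ⟨fun p => ?_, fun p q hpq hw => ?_⟩
    · rw [hcard, ← he.mem_iff]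
      exact ⟨π p, (hπ p).symm⟩
    · apply π.injective
      apply he.inj
      rw [← hπ, ← hπ, Fin.val_injective hpq, Fin.val_injective hw]

end

section

/-! ### Separate expansion in several variables -/

/-- Kernels that reproduce `φ` in each variable separately can be applied one variable after
another, so their product reproduces `φ`. -/
theorem eq_sum_prod_kernel {ι : Type*} [Fintype ι] (d : ℕ) :
    ∀ (K : Fin d → ι → ι → ℂ) (φ : (Fin d → ι) → ℂ)
      (_ : ∀ l T, φ T = ∑ t, K l (T l) t * φ (Function.update T l t)) (S : Fin d → ι),
      φ S = ∑ T : Fin d → ι, (∏ l, K l (S l) (T l)) * φ T := by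
  induction d with
  | zero =>
    intro K φ _ S
    simp only [Finset.univ_unique, Finset.sum_singleton, Finset.univ_eq_empty, Finset.prod_empty,
      one_mul]
    exact congrArg φ (Subsingleton.elim _ _)
  | succ d ih =>
    intro K φ h S
    rw [← (Fin.consEquiv fun _ => ι).sum_comp, Fintype.sum_prod_type]
    have h1 : φ S = ∑ t, K 0 (S 0) t * φ (Fin.cons t (Fin.tail S)) := by
      rw [h 0 S]
      refine Finset.sum_congr rfl fun t _ => ?_
      rw [← Fin.cons_self_tail S, Fin.update_cons_zero]
      simp
    rw [h1]
    refine Finset.sum_congr rfl fun t _ => ?_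
    rw [ih (fun l => K l.succ) (fun T => φ (Fin.cons t T)) (fun l T => ?_) (Fin.tail S),
      Finset.mul_sum]
    · refine Finset.sum_congr rfl fun T _ => ?_
      rw [Fin.prod_univ_succ]
      simp [Fin.consEquiv, Fin.tail, mul_assoc]
    · rw [h l.succ]
      simp [Fin.cons_update]

/-- `G` is the matrix of a linear section of the map from coefficients to combinations, extended to
all functions. The reproducing kernel of the span thereby factors through `f`. -/
theorem exists_kernel_of_span {ι κ : Type*} [Fintype ι] [Fintype κ] (f : ι → κ → ℂ) :
    ∃ G : κ → ι → ℂ, ∀ h ∈ Submodule.span ℂ (Set.range fun x s => f s x), ∀ s,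
      h s = ∑ x, f s x * ∑ t, G x t * h t := by
  classical
  let A := Fintype.linearCombination ℂ (fun (x : κ) (s : ι) => f s x)
  obtain ⟨g, hg⟩ := A.rangeRestrict.exists_rightInverse_of_surjective A.range_rangeRestrict
  obtain ⟨G, hG⟩ := g.exists_extend
  refine ⟨fun x t => G (Pi.single t 1) x, fun h hh s => ?_⟩
  have hmem : h ∈ LinearMap.range A := by
    rwa [Fintype.range_linearCombination]
  have h1 : A (G h) = h := by
    have h2 : G h = g ⟨h, hmem⟩ := by rw [← hG]; rfl
    have h3 := LinearMap.congr_fun hg ⟨h, hmem⟩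
    rw [h2]
    exact congrArg Subtype.val h3
  have h4 : ∀ x, G h x = ∑ t, G (Pi.single t 1) x * h t := by
    intro x
    conv_lhs => rw [LinearMap.pi_apply_eq_sum_univ G h]
    simp only [Finset.sum_apply, Pi.smul_apply, smul_eq_mul]
    refine Finset.sum_congr rfl fun t _ => ?_
    rw [mul_comm]
    have : (Pi.single t 1 : ι → ℂ) = fun t' => if t = t' then 1 else 0 := by
      funext t'
      simp [Pi.single_apply, eq_comm]
    rw [this]
  conv_lhs => rw [← h1]
  simp only [A, Fintype.linearCombination_apply, Finset.sum_apply, Pi.smul_apply, smul_eq_mul, h4]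
  exact Finset.sum_congr rfl fun x _ => mul_comm _ _

/-- A function lying in the given span in each variable lies in the tensor product of the spans,
hence is a combination of products of the `f l`, each of which is annihilated by `c`. -/
theorem sum_mul_eq_zero_of_rowwise {ι κ : Type*} [Fintype ι] [Fintype κ] {d : ℕ}
    (f : Fin d → ι → κ → ℂ) {φ : (Fin d → ι) → ℂ}
    (hφ : ∀ l T, (fun s => φ (Function.update T l s)) ∈
      Submodule.span ℂ (Set.range fun x s => f l s x))
    {c : (Fin d → ι) → ℂ} (hc : ∀ X : Fin d → κ, ∑ T, c T * ∏ l, f l (T l) (X l) = 0) :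
    ∑ T, c T * φ T = 0 := by
  choose G hG using fun l => exists_kernel_of_span (f l)
  have h1 := eq_sum_prod_kernel d (fun l s t => ∑ x, f l s x * G l x t) φ (fun l T => by
    have := hG l _ (hφ l T) (T l)
    simp only [Function.update_eq_self] at this
    rw [this]
    simp only [Finset.mul_sum, Finset.sum_mul]
    rw [Finset.sum_comm]
    simp only [mul_assoc])
  have h2 : ∀ S T : Fin d → ι, ∏ l, ∑ x, f l (S l) x * G l x (T l)
      = ∑ X : Fin d → κ, (∏ l, f l (S l) (X l)) * ∏ l, G l (X l) (T l) := by
    intro S T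
    rw [Fintype.prod_sum fun l x => f l (S l) x * G l x (T l)]
    simp only [Finset.prod_mul_distrib]
  have h3 : ∀ S, c S * φ S = ∑ T, ∑ X : Fin d → κ,
      (c S * ∏ l, f l (S l) (X l)) * ((∏ l, G l (X l) (T l)) * φ T) := by
    intro S
    conv_lhs => rw [h1 S]
    rw [Finset.mul_sum]
    refine Finset.sum_congr rfl fun T _ => ?_
    rw [h2, Finset.sum_mul, Finset.mul_sum]
    exact Finset.sum_congr rfl fun X _ => by ring
  simp only [h3]
  rw [Finset.sum_comm]
  refine Finset.sum_eq_zero fun T _ => ?_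
  rw [Finset.sum_comm]
  refine Finset.sum_eq_zero fun X _ => ?_
  rw [← Finset.sum_mul, hc X, zero_mul]

/-! ### Boundaries of tables -/

section Boundary

variable {d m k : ℕ}

/-- Replace the letter in row `l` and column `p` by `i`. -/
def replaceLetter (Y : Table d m k) (p : Fin m) (l : Fin d) (i : Fin k) : Table d m k :=
  Function.update Y p (Function.update (Y p) l i)

theorem replaceLetter_apply (Y : Table d m k) (p : Fin m) (l : Fin d) (i : Fin k) (q : Fin m)
    (l' : Fin d) : replaceLetter Y p l i q l' = if q = p ∧ l' = l then i else Y q l' := by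
  unfold replaceLetter
  by_cases h : q = p
  · subst h
    by_cases h' : l' = l
    · subst h'; simp
    · simp [h']
  · simp [h]

theorem replaceLetter_row (Y : Table d m k) (p : Fin m) (l : Fin d) (i : Fin k) :
    (fun q => replaceLetter Y p l i q l) = Function.update (fun q => Y q l) p i := by
  funext q
  by_cases h : q = p <;> simp [replaceLetter_apply, h]

theorem replaceLetter_row_ne (Y : Table d m k) (p : Fin m) {l l' : Fin d} (h : l' ≠ l)
    (i : Fin k) : (fun q => replaceLetter Y p l i q l') = fun q => Y q l' := by
  funext q
  simp [replaceLetter_apply, h]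

/-- Since `i ≠ j`, different positions yield different tables, so the boundary as a set loses no
multiplicity. -/
theorem sum_boundary {M : Type*} [AddCommMonoid M] {i j : Fin k} (hij : i ≠ j) (l : Fin d)
    (Y : Table d m k) (g : Table d m k → M) :
    ∑ S ∈ boundary l j i Y, g S = ∑ p with Y p l = i, g (replaceLetter Y p l j) := by
  unfold boundary
  rw [Finset.sum_image]
  · rfl
  · intro p hp q hq h
    simp only [Finset.coe_filter, Finset.mem_univ, true_and, Set.mem_ofPred_eq] at hp hq
    by_contra hne
    have := congrFun (congrFun h p) l
    simp [Function.update_of_ne hne, hp] at this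
    exact hij this.symm

theorem card_update_word (y : Fin m → Fin k) (p : Fin m) (j a : Fin k) :
    (Finset.univ.filter fun q => Function.update y p j q = a).card + (if y p = a then 1 else 0)
      = (Finset.univ.filter fun q => y q = a).card + if j = a then 1 else 0 := by
  simp only [Finset.card_filter]
  rw [← Finset.add_sum_erase _ _ (Finset.mem_univ p),
    ← Finset.add_sum_erase _ (fun q => if y q = a then 1 else 0) (Finset.mem_univ p)]
  have : ∑ q ∈ Finset.univ.erase p, (if Function.update y p j q = a then 1 else 0)
      = ∑ q ∈ Finset.univ.erase p, if y q = a then 1 else 0 := by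
    refine Finset.sum_congr rfl fun q hq => ?_
    rw [Function.update_of_ne (Finset.ne_of_mem_erase hq)]
  rw [this, Function.update_self]
  ring

theorem mem_tables {α : Weight d k} {T : Table d m k} : T ∈ tables m α ↔
    ∀ l a, ((Finset.univ.filter fun j => T j l = a).card : ℤ) = α l a :=
  Finset.mem_filter.trans (by simp)

theorem replaceLetter_mem_tables {α : Weight d k} {l : Fin d} {i j : Fin k}
    {Y : Table d m k} {p : Fin m} (hp : Y p l = i) :
    replaceLetter Y p l j ∈ tables m α ↔ Y ∈ tables m (shiftWeight l i j α) := by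
  rw [mem_tables, mem_tables]
  simp only [shiftWeight]
  refine forall_congr' fun l' => forall_congr' fun a => ?_
  by_cases h : l' = l
  · subst h
    have h1 := card_update_word (fun q => Y q l') p j a
    rw [← replaceLetter_row] at h1
    simp only [hp] at h1
    simp only [true_and, eq_comm (a := a)]
    split_ifs at h1 ⊢ <;> omega
  · have h1 := replaceLetter_row_ne Y p h j
    have h2 : ∀ q, replaceLetter Y p l j q l' = Y q l' := fun q => congrFun h1 q
    simp [h, h2]

end Boundary

/-! ### The kernel of the determinant pairing on tables -/

section Pairing

variable {d m k n : ℕ}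

/-- The product of the determinants of the rows. -/
def tableDet (e : Fin d → Fin m → Fin k × Fin n) (T : Table d m k) (X : Table d m n) : ℂ :=
  ∏ l, cellDet (e l) (fun j => T j l) (fun j => X j l)

/-- Otherwise a functional `ψ` vanishes on `B` but not on the sum. The hypothesis on boundaries
makes `T ↦ ψ (w T)` a highest weight function in each row, hence a combination of determinants in
each row, and `hc` makes its pairing with `c` vanish. -/
theorem sum_smul_mem_of_boundary {e : Fin d → Fin m → Fin k × Fin n} {μ : Fin d → Fin k → ℕ}
    (he : ∀ l, IsEnum (e l) (μ l)) (hμ : ∀ l, Antitone (μ l)) (hn : ∀ l a, μ l a ≤ n)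
    {W : Type*} [AddCommGroup W] [Module ℂ W] (w : Table d m k → W) (B : Submodule ℂ W)
    (hB : ∀ (l : Fin d) (i j : Fin k), i < j →
      ∀ Y ∈ tables m (shiftWeight l i j fun l a => (μ l a : ℤ)),
        ∑ S ∈ boundary l j i Y, w S ∈ B)
    {c : Table d m k → ℂ} (hc : ∀ X : Table d m n, ∑ T, c T * tableDet e T X = 0) :
    ∑ T ∈ tables m (fun l a => (μ l a : ℤ)), c T • w T ∈ B := by
  classical
  by_contra hnot
  obtain ⟨ψ, hψ, hψB⟩ := Submodule.exists_dual_map_eq_bot_of_notMem hnot inferInstance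
  have hψB' : ∀ b ∈ B, ψ b = 0 := fun b hb => by
    have : ψ b ∈ B.map ψ := Submodule.mem_map_of_mem hb
    rwa [hψB, Submodule.mem_bot] at this
  apply hψ
  -- Cutting off outside the weight supplies the support condition of `hwFun`.
  let φ : Table d m k → ℂ := fun T => if T ∈ tables m (fun l a => (μ l a : ℤ)) then ψ (w T) else 0
  have h1 : ψ (∑ T ∈ tables m (fun l a => (μ l a : ℤ)), c T • w T) = ∑ T, c T * φ T := by
    simp only [map_sum, map_smul, smul_eq_mul, φ, mul_ite, mul_zero]
    rw [← Finset.sum_filter, Finset.filter_mem_eq_inter, Finset.univ_inter]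
  rw [h1]
  let E : (Fin d → Fin m → Fin k) ≃ Table d m k := Equiv.piComm _
  have hE : ∀ R p l, E R p l = R l p := fun _ _ _ => rfl
  rw [← E.sum_comp]
  refine sum_mul_eq_zero_of_rowwise (fun l s x => cellDet (e l) s x) (fun l R => ?_) (fun X => ?_)
  · refine hwFun_le_span_cellDet m (hμ l) (hn l) (he l) ⟨fun s hs a => ?_, fun i j hij y => ?_⟩
    · have hmem : E (Function.update R l s) ∈ tables m (fun l a => (μ l a : ℤ)) := by
        by_contra h
        exact hs (if_neg h)
      have := mem_tables.1 hmem l a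
      simpa [hE] using this
    · set Y := E (Function.update R l y) with hY
      have hYl : ∀ p, Y p l = y p := fun p => by simp [hY, hE]
      have h2 : ∀ p j, E (Function.update R l (Function.update y p j)) = replaceLetter Y p l j := by
        intro p j
        funext q l'
        rw [replaceLetter_apply]
        by_cases h : l' = l
        · subst h
          simp [hE, Function.update_apply, hYl]
        · simp [hE, hY, h]
      have h3 : replaceSum i j (fun s => φ (E (Function.update R l s))) y
          = ∑ p with Y p l = i, φ (replaceLetter Y p l j) := by
        simp only [replaceSum, h2, hYl]
      rw [h3]
      -- Either the sum is `ψ` of a boundary vector, or every replaced table has the wrong weight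
      -- and `φ` is zero on it.
      by_cases hmem : Y ∈ tables m (shiftWeight l i j fun l a => (μ l a : ℤ))
      · rw [← hψB' _ (hB l i j hij Y hmem), sum_boundary hij.ne, map_sum]
        refine Finset.sum_congr rfl fun p hp => ?_
        simp only [Finset.mem_filter, Finset.mem_univ, true_and] at hp
        exact if_pos ((replaceLetter_mem_tables hp).2 hmem)
      · refine Finset.sum_eq_zero fun p hp => ?_
        simp only [Finset.mem_filter, Finset.mem_univ, true_and] at hp
        exact if_neg fun h => hmem ((replaceLetter_mem_tables hp).1 h)
  · rw [← hc fun j l => X l j, ← E.sum_comp]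
    rfl

end Pairing

end

section

/-! ### Signs of permutations and matching of fibres -/

/-- The sign of a permutation as a complex number. -/
def signC {m : ℕ} (σ : Equiv.Perm (Fin m)) : ℂ := ((Equiv.Perm.sign σ : ℤˣ) : ℤ)

theorem signC_mul {m : ℕ} (σ τ : Equiv.Perm (Fin m)) : signC (σ * τ) = signC σ * signC τ := by
  simp [signC]

theorem signC_inv {m : ℕ} (σ : Equiv.Perm (Fin m)) : signC σ⁻¹ = signC σ := by
  simp [signC]

theorem signC_mul_self {m : ℕ} (σ : Equiv.Perm (Fin m)) : signC σ * signC σ = 1 := by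
  rw [← signC_inv, ← signC_mul]
  simp [signC]

theorem exists_equiv_of_card_fiber_eq {α α' β : Type*} [Fintype α] [Fintype α'] [DecidableEq β]
    (f : α → β) (g : α' → β)
    (h : ∀ y, (Finset.univ.filter fun x => f x = y).card
      = (Finset.univ.filter fun x => g x = y).card) :
    ∃ e : α ≃ α', ∀ x, g (e x) = f x := by
  have h1 : ∀ y, Fintype.card {x // f x = y} = Fintype.card {x // g x = y} := by
    intro y
    rw [Fintype.card_subtype, Fintype.card_subtype, h y]
  let e := (Equiv.sigmaFiberEquiv f).symm.trans
    ((Equiv.sigmaCongrRight fun y => Fintype.equivOfCardEq (h1 y)).trans (Equiv.sigmaFiberEquiv g))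
  exact ⟨e, fun x => (Fintype.equivOfCardEq (h1 (f x)) ⟨x, rfl⟩).2⟩

/-! ### Algebras generated by tensors -/

section Model

variable {d n : ℕ} {A : Type} [Ring A] [Algebra ℂ A]

/-- The product of the images of the basis tensors given by the columns of `X`. -/
def mon {m : ℕ} (ι : V d n →ₗ[ℂ] A) (X : Table d m n) : A :=
  (List.ofFn fun j => ι (basisTensor (X j))).prod

/-- The common properties of the symmetric (`ε = 0`) and the exterior algebra (`ε = 1`)
of `(ℂ^n)^{⊗ d}`. -/
structure IsModel (ι : V d n →ₗ[ℂ] A)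
    (act : (Fin d → Matrix (Fin n) (Fin n) ℂ) → A →ₗ[ℂ] A) (ε : ℕ) : Prop where
  act_eq : ∀ g, ∃ φ : A →ₐ[ℂ] A, act g = φ.toLinearMap ∧ ∀ v, φ (ι v) = ι (tensorAct g v)
  adjoin_eq : Algebra.adjoin ℂ (Set.range ι) = ⊤
  mon_perm : ∀ {m : ℕ} (X : Table d m n) (σ : Equiv.Perm (Fin m)),
    mon ι (X ∘ σ) = signC σ ^ ε • mon ι X
  indep : ∀ {m : ℕ} (c : Table d m n → ℂ), ∑ X, c X • mon ι X = 0 →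
    ∀ X, ∑ σ : Equiv.Perm (Fin m), signC σ ^ ε * c (X ∘ σ) = 0

end Model

variable {d n : ℕ}

/-- The basis of `(ℂ^n)^{⊗ d}` consisting of the basis tensors. -/
def tensorBasis (d n : ℕ) : Module.Basis (Fin d → Fin n) ℂ (V d n) :=
  Basis.piTensorProduct fun _ => Pi.basisFun ℂ (Fin n)

theorem tensorBasis_apply (i : Fin d → Fin n) : tensorBasis d n i = basisTensor i := by
  simp [tensorBasis, basisTensor]

theorem mon_sym {m : ℕ} (X : Table d m n) : mon (SymmetricAlgebra.ι ℂ (V d n)) X = vee X := by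
  rw [mon, List.prod_ofFn, vee]

theorem mon_alt {m : ℕ} (X : Table d m n) : mon (ExteriorAlgebra.ι ℂ (M := V d n)) X = wedge X := by
  rw [mon, wedge, ExteriorAlgebra.ιMulti_apply]

theorem equivMvPolynomial_vee {m : ℕ} (X : Table d m n) :
    SymmetricAlgebra.equivMvPolynomial (tensorBasis d n) (vee X)
      = MvPolynomial.monomial (∑ j, Finsupp.single (X j) 1) 1 := by
  rw [vee, map_prod, MvPolynomial.monomial_sum_one]
  refine Finset.prod_congr rfl fun j _ => ?_
  rw [← tensorBasis_apply, SymmetricAlgebra.equivMvPolynomial_ι_apply]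
  rfl

/-- For `indep`, read off the coefficient of the monomial of `X₀` in the polynomial ring. The tables
with this monomial are the `X₀ ∘ σ`, each attained by `stabCard X₀` permutations, so the average is
`stabCard X₀` times the coefficient. -/
theorem isModel_sym (d n : ℕ) : IsModel (SymmetricAlgebra.ι ℂ (V d n)) symAct 0 where
  act_eq g := ⟨_, rfl, fun v => by rw [SymmetricAlgebra.lift_ι_apply]; rfl⟩
  adjoin_eq := by
    rw [eq_top_iff]
    rintro x -
    induction x using SymmetricAlgebra.induction with
    | algebraMap r => exact Subalgebra.algebraMap_mem _ r
    | ι x => exact Algebra.subset_adjoin ⟨x, rfl⟩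
    | mul a b ha hb => exact Subalgebra.mul_mem _ ha hb
    | add a b ha hb => exact Subalgebra.add_mem _ ha hb
  mon_perm X σ := by
    rw [mon_sym, mon_sym, pow_zero, one_smul, vee, vee]
    exact Equiv.prod_comp σ fun j => SymmetricAlgebra.ι ℂ (V d n) (basisTensor (X j))
  indep := by
    intro m c hc X₀
    classical
    simp only [mon_sym] at hc
    have h1 := congrArg (fun v => MvPolynomial.coeff (∑ j, Finsupp.single (X₀ j) 1)
      (SymmetricAlgebra.equivMvPolynomial (tensorBasis d n) v)) hc
    simp only [map_sum, map_smul, equivMvPolynomial_vee, MvPolynomial.coeff_sum,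
      MvPolynomial.coeff_smul, MvPolynomial.coeff_monomial, map_zero, MvPolynomial.coeff_zero,
      smul_eq_mul] at h1
    have hcount : ∀ (Z : Table d m n) y, (∑ j, Finsupp.single (Z j) 1 : (Fin d → Fin n) →₀ ℕ) y
        = (Finset.univ.filter fun j => Z j = y).card := by
      intro Z y
      rw [Finsupp.finsetSum_apply, Finset.card_filter]
      simp only [Finsupp.single_apply]
    have h2 : ∀ X : Table d m n, (∑ j, Finsupp.single (X j) 1 : (Fin d → Fin n) →₀ ℕ)
        = ∑ j, Finsupp.single (X₀ j) 1 ↔ ∃ τ : Equiv.Perm (Fin m), X₀ ∘ τ = X := by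
      intro X
      constructor
      · intro h
        obtain ⟨e, he⟩ := exists_equiv_of_card_fiber_eq X X₀ fun y => by
          rw [← hcount, ← hcount, h]
        exact ⟨e, funext he⟩
      · rintro ⟨τ, rfl⟩
        exact Equiv.sum_comp τ fun j => Finsupp.single (X₀ j) 1
    have h3 : ∀ X : Table d m n, ((Finset.univ.filter fun σ : Equiv.Perm (Fin m) => X₀ ∘ σ = X).card : ℂ)
        = (if (∑ j, Finsupp.single (X j) 1 : (Fin d → Fin n) →₀ ℕ)
          = ∑ j, Finsupp.single (X₀ j) 1 then (1 : ℂ) else 0) * stabCard X₀ := by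
      intro X
      split_ifs with h
      · obtain ⟨τ, rfl⟩ := (h2 X).1 h
        rw [one_mul, stabCard]
        congr 1
        refine Finset.card_bij (fun σ _ => σ * τ⁻¹) ?_ ?_ ?_
        · intro σ hσ
          simp only [Finset.mem_filter, Finset.mem_univ, true_and] at hσ ⊢
          rw [Equiv.Perm.coe_mul, ← Function.comp_assoc, hσ]
          funext j
          simp
        · intro σ _ σ' _ h
          exact mul_right_cancel h
        · intro σ hσ
          simp only [Finset.mem_filter, Finset.mem_univ, true_and] at hσ
          refine ⟨σ * τ, ?_, by simp⟩
          simp only [Finset.mem_filter, Finset.mem_univ, true_and]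
          rw [Equiv.Perm.coe_mul, ← Function.comp_assoc, hσ]
      · rw [zero_mul, Finset.filter_false_of_mem]
        · simp
        · intro σ _ hσ
          exact h ((h2 X).2 ⟨σ, hσ⟩)
    simp only [pow_zero, one_mul]
    have h4 : ∑ σ : Equiv.Perm (Fin m), c (X₀ ∘ σ)
        = ∑ X, ((Finset.univ.filter fun σ : Equiv.Perm (Fin m) => X₀ ∘ σ = X).card : ℂ) * c X := by
      rw [← Finset.sum_fiberwise (s := Finset.univ) (g := fun σ : Equiv.Perm (Fin m) => X₀ ∘ σ)]
      refine Finset.sum_congr rfl fun X _ => ?_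
      rw [Finset.sum_congr rfl fun σ hσ => congrArg c (Finset.mem_filter.1 hσ).2, Finset.sum_const,
        nsmul_eq_mul]
    rw [h4]
    simp only [h3]
    calc _ = (∑ X : Table d m n, c X * if (∑ j, Finsupp.single (X j) 1 : (Fin d → Fin n) →₀ ℕ)
          = ∑ j, Finsupp.single (X₀ j) 1 then (1 : ℂ) else 0) * stabCard X₀ := by
          rw [Finset.sum_mul]
          exact Finset.sum_congr rfl fun X _ => by ring
      _ = 0 := by rw [h1, zero_mul]

/-- For `indep`, test with the alternating form given by the determinant of the coordinates at the
columns of `X₀`: on the columns of `X` it is the signed count of `σ` with `X ∘ σ = X₀`. -/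
theorem isModel_alt (d n : ℕ) : IsModel (ExteriorAlgebra.ι ℂ (M := V d n)) altAct 1 where
  act_eq g := ⟨_, rfl, fun v => ExteriorAlgebra.map_apply_ι _ _⟩
  adjoin_eq := by
    rw [eq_top_iff]
    rintro x -
    induction x using ExteriorAlgebra.induction with
    | algebraMap r => exact Subalgebra.algebraMap_mem _ r
    | ι x => exact Algebra.subset_adjoin ⟨x, rfl⟩
    | mul a b ha hb => exact Subalgebra.mul_mem _ ha hb
    | add a b ha hb => exact Subalgebra.add_mem _ ha hb
  mon_perm X σ := by
    rw [mon_alt, mon_alt, pow_one, wedge, wedge, signC]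
    rw [Int.cast_smul_eq_zsmul]
    exact AlternatingMap.map_perm (ExteriorAlgebra.ιMulti ℂ _) (fun j => basisTensor (X j)) σ
  indep := by
    intro m c hc X₀
    classical
    simp only [mon_alt] at hc
    let D : V d n [⋀^Fin m]→ₗ[ℂ] ℂ := Matrix.detRowAlternating.compLinearMap
      (LinearMap.pi fun c => (tensorBasis d n).coord (X₀ c))
    have hD : ∀ X : Table d m n, D (fun j => basisTensor (X j))
        = ∑ σ : Equiv.Perm (Fin m), signC σ * if X ∘ σ = X₀ then 1 else 0 := by
      intro X
      have : D (fun j => basisTensor (X j))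
          = Matrix.det (Matrix.of fun j c => if X j = X₀ c then (1 : ℂ) else 0) := by
        change Matrix.det _ = _
        congr 1
        ext j c
        simp only [LinearMap.pi_apply, Module.Basis.coord_apply, Matrix.of_apply]
        change (tensorBasis d n).repr (basisTensor (X j)) (X₀ c) = _
        rw [← tensorBasis_apply, Module.Basis.repr_self, Finsupp.single_apply]
      rw [this, Matrix.det_apply']
      refine Finset.sum_congr rfl fun σ _ => ?_
      rw [signC]
      congr 1
      simp only [Matrix.of_apply]
      rw [Finset.prod_ite_zero]
      simp [funext_iff]
    -- The family of forms is zero except in degree `m`.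
    have h1 := congrArg (ExteriorAlgebra.liftAlternating
      (Function.update (0 : ∀ i, V d n [⋀^Fin i]→ₗ[ℂ] ℂ) m D)) hc
    simp only [map_sum, map_smul, wedge, ExteriorAlgebra.liftAlternating_apply_ιMulti,
      Function.update_self, hD, map_zero, smul_eq_mul, Finset.mul_sum] at h1
    rw [Finset.sum_comm, ← Equiv.sum_comp (Equiv.inv _)] at h1
    rw [← h1]
    refine Finset.sum_congr rfl fun σ _ => ?_
    rw [Finset.sum_eq_single (X₀ ∘ σ)]
    · rw [if_pos (by funext j; simp), Equiv.inv_apply, signC_inv, pow_one, mul_one, mul_comm]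
    · intro X _ hX
      rw [if_neg, mul_zero, mul_zero]
      intro h
      apply hX
      rw [← h, Function.comp_assoc]
      funext j
      simp
    · simp

end

section

/-! ### Products of lists of sums -/

theorem prod_ofFn_sum {R : Type*} [Semiring R] (q : ℕ) : ∀ {κ : Fin q → Type}
    [∀ i, Fintype (κ i)] (a : ∀ i, κ i → R),
    (List.ofFn fun i => ∑ x, a i x).prod = ∑ X : ∀ i, κ i, (List.ofFn fun i => a i (X i)).prod := by
  induction q with
  | zero => intro κ _ a; simp
  | succ q ih =>
    intro κ _ a
    rw [List.ofFn_succ, List.prod_cons, ih fun i => a i.succ, Finset.sum_mul_sum,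
      ← (Fin.consEquiv κ).sum_comp, Fintype.sum_prod_type]
    refine Finset.sum_congr rfl fun x _ => Finset.sum_congr rfl fun X _ => ?_
    rw [List.ofFn_succ, List.prod_cons]
    rfl

theorem prod_ofFn_smul {A : Type*} [Ring A] [Algebra ℂ A] (q : ℕ) : ∀ (r : Fin q → ℂ)
    (a : Fin q → A), (List.ofFn fun i => r i • a i).prod = (∏ i, r i) • (List.ofFn a).prod := by
  induction q with
  | zero => intro r a; simp
  | succ q ih =>
    intro r a
    rw [List.ofFn_succ, List.prod_cons, ih fun i => r i.succ, Fin.prod_univ_succ, List.ofFn_succ,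
      List.prod_cons, smul_mul_smul_comm]

/-! ### The action on products of basis tensors -/

theorem tensorAct_basisTensor {d n : ℕ} (u : Fin d → Matrix (Fin n) (Fin n) ℂ)
    (i : Fin d → Fin n) :
    tensorAct u (basisTensor i) = ∑ z : Fin d → Fin n, (∏ l, u l (z l) (i l)) • basisTensor z := by
  unfold tensorAct basisTensor
  rw [PiTensorProduct.map_tprod]
  have : ∀ l, Matrix.toLin' (u l) (Pi.single (i l) 1)
      = ∑ a, u l a (i l) • (Pi.single a 1 : Fin n → ℂ) := by
    intro l
    funext b
    simp [Pi.single_apply]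
  simp only [this]
  rw [MultilinearMap.map_sum]
  exact Finset.sum_congr rfl fun z _ => MultilinearMap.map_smul_univ _ _ _

/-! ### Independence of weight spaces -/

section Weights

variable {d n : ℕ} {W : Type} [AddCommGroup W] [Module ℂ W]
  {act : (Fin d → Matrix (Fin n) (Fin n) ℂ) → W →ₗ[ℂ] W}

theorem exists_torusChar_ne {α β : Weight d n} (h : α ≠ β) :
    ∃ t, torusChar α t ≠ torusChar β t := by
  obtain ⟨l, hl⟩ := Function.ne_iff.1 h
  obtain ⟨a, ha⟩ := Function.ne_iff.1 hl
  -- The number `2` has infinite multiplicative order, so its powers tell the integers `α l a` and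
  -- `β l a` apart.
  let two : ℂˣ := Units.mk0 2 two_ne_zero
  let t : Fin d → Fin n → ℂˣ := fun l' a' => if l' = l ∧ a' = a then two else 1
  have key : ∀ γ : Weight d n, torusChar γ t = (2 : ℂ) ^ γ l a := by
    intro γ
    unfold torusChar
    rw [Finset.prod_eq_single l, Finset.prod_eq_single a]
    · simp [t, two]
    · intro b _ hb; simp [t, hb]
    · simp
    · intro b _ hb; simp [t, hb]
    · simp
  refine ⟨t, fun h' => ha ?_⟩
  rw [key, key] at h'
  have h2 := congrArg norm h'
  rw [norm_zpow, norm_zpow, Complex.norm_ofNat] at h2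
  exact zpow_right_injective₀ (by norm_num) (by norm_num) h2

/-- Weight spaces of different weights are independent. -/
theorem eq_zero_of_sum_eq_zero (s : Finset (Weight d n)) : ∀ (v : Weight d n → W)
    (_ : ∀ α ∈ s, v α ∈ weightSpace act α) (_ : ∑ α ∈ s, v α = 0), ∀ α ∈ s, v α = 0 := by
  classical
  induction s using Finset.induction_on with
  | empty => simp
  | insert β s hβ ih =>
    intro v hv h0
    -- Acting by `t` and subtracting `torusChar β t` times the relation removes the summand of
    -- weight `β`.
    have h1 : ∀ t, ∑ α ∈ s, (torusChar α t - torusChar β t) • v α = 0 := by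
      intro t
      have h2 := congrArg (act fun l => Matrix.diagonal fun a => (t l a : ℂ)) h0
      rw [map_sum, map_zero, Finset.sum_congr rfl fun α hα => hv α hα t] at h2
      have h3 : ∑ α ∈ insert β s, (torusChar α t - torusChar β t) • v α = 0 := by
        simp only [sub_smul, Finset.sum_sub_distrib, h2, ← Finset.smul_sum, h0, smul_zero, sub_zero]
      rw [Finset.sum_insert hβ, sub_self, zero_smul, zero_add] at h3
      exact h3
    have h4 : ∀ α ∈ s, v α = 0 := by
      intro α hα
      obtain ⟨t, ht⟩ := exists_torusChar_ne (α := α) (β := β) (by rintro rfl; exact hβ hα)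
      have := ih (fun α => (torusChar α t - torusChar β t) • v α)
        (fun α hα => Submodule.smul_mem _ _ (hv α (Finset.mem_insert_of_mem hα))) (h1 t) α hα
      exact (smul_eq_zero.1 this).resolve_left (sub_ne_zero.2 ht)
    intro α hα
    rcases Finset.mem_insert.1 hα with rfl | hα
    · rw [Finset.sum_insert hβ, Finset.sum_eq_zero h4, add_zero] at h0
      exact h0
    · exact h4 α hα

end Weights

/-! ### Monomials span the algebra and its weight spaces -/

section Model

variable {d n : ℕ} {A : Type} [Ring A] [Algebra ℂ A] {ι : V d n →ₗ[ℂ] A}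
  {act : (Fin d → Matrix (Fin n) (Fin n) ℂ) → A →ₗ[ℂ] A} {ε : ℕ}

theorem IsModel.act_mon' (hM : IsModel ι act ε) (g : Fin d → Matrix (Fin n) (Fin n) ℂ) {m : ℕ}
    (X : Table d m n) :
    act g (mon ι X) = (List.ofFn fun j => ι (tensorAct g (basisTensor (X j)))).prod := by
  obtain ⟨φ, hφ, h⟩ := hM.act_eq g
  rw [hφ, AlgHom.toLinearMap_apply, mon, map_list_prod, List.map_ofFn]
  congr 2
  funext j
  exact h _

theorem IsModel.act_mon (hM : IsModel ι act ε) (g : Fin d → Matrix (Fin n) (Fin n) ℂ) {m : ℕ}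
    (X : Table d m n) :
    act g (mon ι X) = ∑ Z : Table d m n, (∏ j, ∏ l, g l (Z j l) (X j l)) • mon ι Z := by
  rw [hM.act_mon']
  simp only [tensorAct_basisTensor, map_sum, map_smul]
  rw [prod_ofFn_sum]
  exact Finset.sum_congr rfl fun Z _ => prod_ofFn_smul _ _ _

theorem IsModel.mon_mem (hM : IsModel ι act ε) {m : ℕ} {α : Weight d n} {X : Table d m n}
    (hX : X ∈ tables m α) : mon ι X ∈ weightSpace act α := by
  intro t
  rw [hM.act_mon', ← prod_eq_torusChar hX t]
  simp only [tensorAct_diagonal (fun l a => (t l a : ℂ)), map_smul]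
  exact prod_ofFn_smul _ _ _

/-- The span contains `1` and is stable under left multiplication by `ι v`: expand `v` in basis
tensors and prepend a column. Hence it is stable under the generated algebra, which is everything.
-/
theorem IsModel.span_mon (hM : IsModel ι act ε) :
    Submodule.span ℂ (Set.range fun X : Σ m, Table d m n => mon ι X.2) = ⊤ := by
  set S := Submodule.span ℂ (Set.range fun X : Σ m, Table d m n => mon ι X.2) with hS
  have h1 : ∀ v, ∀ s ∈ S, ι v * s ∈ S := by
    intro v s hs
    induction hs using Submodule.span_induction with
    | mem s hs =>
      obtain ⟨⟨m, X⟩, rfl⟩ := hs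
      have hv := (tensorBasis d n).mem_span v
      induction hv using Submodule.span_induction with
      | mem v hv =>
        obtain ⟨i, rfl⟩ := hv
        refine Submodule.subset_span ⟨⟨m + 1, Fin.cons i X⟩, ?_⟩
        simp [mon, List.ofFn_succ, tensorBasis_apply]
      | zero => simp
      | add v w _ _ h1 h2 => rw [map_add, add_mul]; exact Submodule.add_mem _ h1 h2
      | smul c v _ h => rw [map_smul, smul_mul_assoc]; exact Submodule.smul_mem _ _ h
    | zero => simp
    | add v w _ _ h1 h2 => rw [mul_add]; exact Submodule.add_mem _ h1 h2
    | smul c v _ h => rw [mul_smul_comm]; exact Submodule.smul_mem _ _ h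
  have h2 : ∀ x ∈ Algebra.adjoin ℂ (Set.range ι), ∀ s ∈ S, x * s ∈ S := by
    intro x hx
    induction hx using Algebra.adjoin_induction with
    | mem x hx =>
      obtain ⟨v, rfl⟩ := hx
      exact h1 v
    | algebraMap r =>
      intro s hs
      rw [← Algebra.smul_def]
      exact Submodule.smul_mem _ _ hs
    | add x y _ _ hx hy =>
      intro s hs
      rw [add_mul]
      exact Submodule.add_mem _ (hx s hs) (hy s hs)
    | mul x y _ _ hx hy =>
      intro s hs
      rw [mul_assoc]
      exact hx _ (hy s hs)
  rw [eq_top_iff]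
  intro x _
  have h3 : (1 : A) ∈ S := Submodule.subset_span ⟨⟨0, Fin.elim0⟩, by simp [mon]⟩
  have := h2 x (by rw [hM.adjoin_eq]; trivial) 1 h3
  rwa [mul_one] at this

/-- Monomials are weight vectors and span everything, so `v` is a sum of weight components in the
spans; by independence the component of weight `α` is `v` itself. -/
theorem IsModel.weightSpace_le_span (hM : IsModel ι act ε) (α : Weight d n) :
    weightSpace act α ≤ Submodule.span ℂ {v | ∃ m, ∃ X ∈ tables m α, v = mon ι X} := by
  classical
  let p : Weight d n → Submodule ℂ A := fun β =>
    Submodule.span ℂ {v | ∃ m, ∃ X ∈ tables m β, v = mon ι X}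
  have hp : ∀ β, p β ≤ weightSpace act β := by
    intro β
    rw [Submodule.span_le]
    rintro _ ⟨m, X, hX, rfl⟩
    exact hM.mon_mem hX
  intro v hv
  have htop : v ∈ ⨆ β, p β := by
    have : (⊤ : Submodule ℂ A) ≤ ⨆ β, p β := by
      rw [← hM.span_mon, Submodule.span_le]
      rintro _ ⟨⟨m, X⟩, rfl⟩
      refine Submodule.mem_iSup_of_mem
        (fun l a => ((Finset.univ.filter fun j => X j l = a).card : ℤ)) ?_
      exact Submodule.subset_span ⟨m, X, mem_tables.2 fun _ _ => rfl, rfl⟩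
    exact this trivial
  obtain ⟨f, hf, hsum⟩ := (Submodule.mem_iSup_iff_exists_finsupp p v).1 htop
  have h0 : ∑ β ∈ insert α f.support, (f β - if β = α then v else 0) = 0 := by
    rw [Finset.sum_sub_distrib, Finset.sum_ite_eq' _ α fun _ => v,
      if_pos (Finset.mem_insert_self _ _), sub_eq_zero, ← hsum, Finsupp.sum]
    refine (Finset.sum_subset (Finset.subset_insert _ _) fun β _ hβ => ?_).symm
    simpa using hβ
  have h1 := eq_zero_of_sum_eq_zero (act := act) _ _ (fun β _ => Submodule.sub_mem _ (hp β (hf β)) (by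
    split_ifs with h
    · rw [h]; exact hv
    · exact Submodule.zero_mem _)) h0 α (Finset.mem_insert_self _ _)
  rw [if_pos rfl, sub_eq_zero] at h1
  rw [← h1]
  exact hf α

end Model

/-! ### Shapes -/

section Shape

variable {d m n k : ℕ} {lam : Fin d → YoungDiagram}

/-- The column lengths of a tuple of diagrams. -/
def colWeight (k : ℕ) (lam : Fin d → YoungDiagram) (l : Fin d) (a : Fin k) : ℕ := (lam l).colLen a

theorem conjWeight_eq (k : ℕ) (lam : Fin d → YoungDiagram) :
    conjWeight k lam = fun l a => (colWeight k lam l a : ℤ) := by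
  funext l a
  simp [conjWeight, shapeWeight, colWeight]

theorem colWeight_antitone (l : Fin d) : Antitone (colWeight k lam l) :=
  fun _ _ h => (lam l).colLen_anti _ _ h

theorem IsShape.colWeight_le (h : IsShape m n k lam) (l : Fin d) (a : Fin k) :
    colWeight k lam l a ≤ n :=
  ((lam l).colLen_anti _ _ (Nat.zero_le _)).trans (h.length_le l)

theorem sum_colLen_eq_card {μ : YoungDiagram} (h : μ.rowLen 0 ≤ k) :
    ∑ a : Fin k, μ.colLen a = μ.card := by
  rw [YoungDiagram.card, Finset.card_eq_sum_card_fiberwise (f := Prod.snd) (t := Finset.range k),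
    Finset.sum_range]
  · exact Finset.sum_congr rfl fun a _ => μ.colLen_eq_card
  · rintro ⟨i, j⟩ hc
    have h1 : (0, j) ∈ μ := μ.up_left_mem (Nat.zero_le _) le_rfl hc
    rw [YoungDiagram.mem_iff_lt_rowLen] at h1
    simp only [Finset.coe_range, Set.mem_Iio]
    omega

theorem IsShape.sum_colWeight (h : IsShape m n k lam) (l : Fin d) :
    ∑ a, colWeight k lam l a = m := by
  rw [← h.card_eq l]
  exact sum_colLen_eq_card (h.width_le l)

theorem IsShape.rowLen_eq (h : IsShape m n k lam) (l : Fin d) (b : ℕ) :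
    (Finset.univ.filter fun a : Fin k => b < colWeight k lam l a).card = (lam l).rowLen b := by
  have : ∀ a : Fin k, b < colWeight k lam l a ↔ (a : ℕ) < (lam l).rowLen b := by
    intro a
    rw [colWeight, ← YoungDiagram.mem_iff_lt_colLen, YoungDiagram.mem_iff_lt_rowLen]
  simp only [this]
  rw [Fin.card_filter_val_lt, min_eq_right]
  exact ((lam l).rowLen_anti _ _ (Nat.zero_le _)).trans (h.width_le l)

theorem IsShape.exists_isEnum (h : IsShape m n k lam) : ∃ e : Fin d → Fin m → Fin k × Fin n,
    (∀ l, IsEnum (e l) (colWeight k lam l)) ∧ ∀ l, IsLexIncreasing (e l) := by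
  choose e he using fun l => HWV.exists_isEnum _ (h.colWeight_le l) (h.sum_colWeight l)
  exact ⟨e, fun l => (he l).1, fun l => (he l).2⟩

theorem tableDet_eq {e : Fin d → Fin m → Fin k × Fin n}
    (he : ∀ l, IsEnum (e l) (colWeight k lam l)) (hlex : ∀ l, IsLexIncreasing (e l))
    {T : Table d m k} (hT : T ∈ tables m (conjWeight k lam)) (X : Table d m n) :
    (tableSign T : ℂ) * tableSgn T X = tableDet e T X := by
  rw [tableSign, tableSgn, tableDet, ← Int.cast_mul, ← Finset.prod_mul_distrib, Int.cast_prod]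
  refine Finset.prod_congr rfl fun l _ => ?_
  rw [← invSign_mul_wordSgn (he l) (hlex l)]
  · rfl
  · intro a
    have := mem_tables.1 hT l a
    rw [conjWeight_eq] at this
    beta_reduce at this
    exact_mod_cast this

theorem tableSign_mul_self (T : Table d m k) : tableSign T * tableSign T = 1 := by
  rw [tableSign, ← Finset.prod_mul_distrib]
  refine Finset.prod_eq_one fun l _ => ?_
  rw [invSign, ← mul_pow]
  simp

theorem tableSign_ne_zero (T : Table d m k) : tableSign T ≠ 0 := fun h => by
  have := tableSign_mul_self T
  simp [h] at this

theorem mem_tables_of_tableDet_ne_zero (h : IsShape m n k lam) {e : Fin d → Fin m → Fin k × Fin n}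
    (he : ∀ l, IsEnum (e l) (colWeight k lam l)) {T : Table d m k} {X : Table d m n}
    (hne : tableDet e T X ≠ 0) : X ∈ tables m (shapeWeight n lam) := by
  rw [mem_tables]
  intro l b
  rw [tableDet, Finset.prod_ne_zero_iff] at hne
  rw [card_right_of_cellDet_ne_zero (he l) (hne l (Finset.mem_univ l)) b, h.rowLen_eq l]
  rfl

/-- This permits summing over all tables in place of `A(λ)`, as `idx` does. -/
theorem tableSgn_eq_zero (h : IsShape m n k lam) {T : Table d m k}
    (hT : T ∈ tables m (conjWeight k lam)) {X : Table d m n}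
    (hX : X ∉ tables m (shapeWeight n lam)) : tableSgn T X = 0 := by
  obtain ⟨e, he, hlex⟩ := h.exists_isEnum
  by_contra hne
  refine hX (mem_tables_of_tableDet_ne_zero h he (T := T) ?_)
  rw [← tableDet_eq he hlex hT]
  exact mul_ne_zero (Int.cast_ne_zero.2 (tableSign_ne_zero T)) (Int.cast_ne_zero.2 hne)

theorem stabCard_pos (T : Table d m k) : 0 < stabCard T :=
  Finset.card_pos.2 ⟨1, by simp⟩

end Shape

end

section

/-! ### Equivariance under column permutations -/

section Equivariance

variable {d m n k : ℕ}

theorem comp_perm_mem_tables {α : Weight d k} {T : Table d m k} (σ : Equiv.Perm (Fin m)) :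
    T ∘ σ ∈ tables m α ↔ T ∈ tables m α := by
  rw [mem_tables, mem_tables]
  refine forall_congr' fun l => forall_congr' fun a => ?_
  rw [← card_filter_comp_perm (fun j => T j l) σ a]
  rfl

theorem stabCard_comp_perm (T : Table d m k) (σ : Equiv.Perm (Fin m)) :
    stabCard (T ∘ σ) = stabCard T := by
  unfold stabCard
  refine Finset.card_bij (fun τ _ => σ * τ * σ⁻¹) ?_ ?_ ?_
  · intro τ hτ
    simp only [Finset.mem_filter, Finset.mem_univ, true_and] at hτ ⊢
    funext j
    have := congrFun hτ (σ⁻¹ j)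
    simpa using this
  · intro τ _ τ' _ h
    simpa using h
  · intro τ hτ
    simp only [Finset.mem_filter, Finset.mem_univ, true_and] at hτ
    refine ⟨σ⁻¹ * τ * σ, ?_, by group⟩
    simp only [Finset.mem_filter, Finset.mem_univ, true_and]
    funext j
    have := congrFun hτ (σ j)
    simpa using this

theorem tableDet_comp_perm (e : Fin d → Fin m → Fin k × Fin n) (T : Table d m k)
    (X : Table d m n) (σ : Equiv.Perm (Fin m)) :
    tableDet e (T ∘ σ) (X ∘ σ) = signC σ ^ d * tableDet e T X := by
  have : ∀ l, cellDet (e l) (fun j => (T ∘ σ) j l) (fun j => (X ∘ σ) j l)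
      = signC σ * cellDet (e l) (fun j => T j l) (fun j => X j l) :=
    fun l => cellDet_comp_perm (e l) (fun j => T j l) (fun j => X j l) σ
  simp only [tableDet, this, Finset.prod_mul_distrib, Finset.prod_const, Finset.card_univ,
    Fintype.card_fin]

theorem sum_comp_perm {M : Type*} [AddCommMonoid M] (σ : Equiv.Perm (Fin m))
    (f : Table d m k → M) : ∑ T : Table d m k, f (T ∘ σ) = ∑ T, f T :=
  Equiv.sum_comp (Equiv.arrowCongr σ.symm (Equiv.refl (Fin d → Fin k))) f

theorem signC_pow_mul_self (σ : Equiv.Perm (Fin m)) (a : ℕ) : signC σ ^ a * signC σ ^ a = 1 := by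
  rw [← mul_pow, signC_mul_self, one_pow]

theorem signC_pow_eq (σ : Equiv.Perm (Fin m)) {a b : ℕ} (h : Even (a + b)) :
    signC σ ^ a = signC σ ^ b := by
  obtain ⟨r, hr⟩ := h
  calc signC σ ^ a = signC σ ^ a * (signC σ ^ b * signC σ ^ b) := by
        rw [signC_pow_mul_self, mul_one]
    _ = signC σ ^ (a + b) * signC σ ^ b := by rw [pow_add, mul_assoc]
    _ = signC σ ^ b := by rw [hr, pow_add, signC_pow_mul_self, one_mul]

/-- Averaging coefficients against an equivariant family. -/
theorem sum_average_smul {W : Type*} [AddCommGroup W] [Module ℂ W] {ε : ℕ}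
    {w : Table d m k → W} (hw : ∀ T (σ : Equiv.Perm (Fin m)), w (T ∘ σ) = signC σ ^ ε • w T)
    (c : Table d m k → ℂ) :
    ∑ T, (∑ σ : Equiv.Perm (Fin m), signC σ ^ ε * c (T ∘ σ)) • w T
      = (m.factorial : ℂ) • ∑ T, c T • w T := by
  simp only [Finset.sum_smul]
  rw [Finset.sum_comm]
  have : ∀ σ : Equiv.Perm (Fin m), ∑ T, (signC σ ^ ε * c (T ∘ σ)) • w T = ∑ T, c T • w T := by
    intro σ
    rw [← sum_comp_perm σ fun T => c T • w T]
    refine Finset.sum_congr rfl fun T _ => ?_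
    rw [hw, smul_smul, mul_comm]
  simp only [this, Finset.sum_const, Finset.card_univ, Fintype.card_perm, Fintype.card_fin]
  rw [Nat.cast_smul_eq_nsmul]

end Equivariance

/-! ### Index vectors -/

section Index

variable {d m n k : ℕ} {A : Type} [Ring A] [Algebra ℂ A] {ι : V d n →ₗ[ℂ] A}
  {act : (Fin d → Matrix (Fin n) (Fin n) ℂ) → A →ₗ[ℂ] A} {ε : ℕ} {lam : Fin d → YoungDiagram}

/-- The common form of `Δ_T` and `∇_T`. -/
def idx (ι : V d n →ₗ[ℂ] A) (T : Table d m k) : A :=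
  ((tableSign T : ℂ) / (stabCard T : ℂ)) • ∑ X : Table d m n, (tableSgn T X : ℂ) • mon ι X

/-- The sum of the `tableDet e T X • mon ι X`. -/
def detSum (ι : V d n →ₗ[ℂ] A) (e : Fin d → Fin m → Fin k × Fin n) (T : Table d m k) : A :=
  ∑ X : Table d m n, tableDet e T X • mon ι X

theorem idx_eq_detSum (ι : V d n →ₗ[ℂ] A)
    {e : Fin d → Fin m → Fin k × Fin n}
    (he : ∀ l, IsEnum (e l) (colWeight k lam l)) (hlex : ∀ l, IsLexIncreasing (e l))
    {T : Table d m k} (hT : T ∈ tables m (conjWeight k lam)) :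
    idx ι T = (stabCard T : ℂ)⁻¹ • detSum ι e T := by
  rw [idx, detSum, div_eq_inv_mul, mul_smul, Finset.smul_sum (r := (tableSign T : ℂ))]
  simp only [smul_smul, tableDet_eq he hlex hT]

theorem Delta_eq_idx (h : IsShape m n k lam) {T : Table d m k}
    (hT : T ∈ tables m (conjWeight k lam)) :
    Delta n lam T = idx (SymmetricAlgebra.ι ℂ (V d n)) T := by
  rw [Delta, idx]
  simp only [mon_sym]
  rw [Finset.sum_subset (Finset.subset_univ _)]
  intro X _ hX
  rw [tableSgn_eq_zero h hT hX, Int.cast_zero, zero_smul]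

theorem wedge_eq_zero {X : Table d m n} (hX : ¬ Function.Injective X) : wedge X = 0 := by
  unfold wedge
  refine ExteriorAlgebra.ιMulti_eq_zero_of_not_inj fun h => hX fun p q hpq => h ?_
  simp only [hpq]

theorem mem_tables01 {α : Weight d n} {X : Table d m n} :
    X ∈ tables01 m α ↔ X ∈ tables m α ∧ Function.Injective X := by
  unfold tables01
  exact Finset.mem_filter

/-- Tables with repeated columns may be added to the sum because their wedge product is zero. -/
theorem Nabla_eq_idx (h : IsShape m n k lam) {T : Table d m k}
    (hT : T ∈ tables m (conjWeight k lam)) :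
    Nabla n lam T = idx (ExteriorAlgebra.ι ℂ (M := V d n)) T := by
  rw [Nabla, idx]
  simp only [mon_alt]
  rw [Finset.sum_subset (Finset.subset_univ _)]
  intro X _ hX
  by_cases hinj : Function.Injective X
  · rw [tableSgn_eq_zero h hT fun h' => hX (mem_tables01.2 ⟨h', hinj⟩), Int.cast_zero, zero_smul]
  · rw [wedge_eq_zero hinj, smul_zero]

/-- The `d` determinants give `signC σ ^ d` and the monomial gives `signC σ ^ ε`; this exponent
decides which source algebra fits. -/
theorem IsModel.detSum_comp_perm (hM : IsModel ι act ε) (e : Fin d → Fin m → Fin k × Fin n)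
    (T : Table d m k) (σ : Equiv.Perm (Fin m)) :
    detSum ι e (T ∘ σ) = signC σ ^ (d + ε) • detSum ι e T := by
  rw [detSum, detSum, ← sum_comp_perm σ, Finset.smul_sum]
  refine Finset.sum_congr rfl fun X _ => ?_
  rw [tableDet_comp_perm, hM.mon_perm, smul_smul, smul_smul, pow_add]
  congr 1
  ring

/-- A nonzero determinant fixes the weight of `X`. For invariance, the coefficient of `mon ι Z`
after acting by `u` factors over the rows, and each factor is given by `sum_cellDet_mul_prod`. -/
theorem IsModel.detSum_mem (hM : IsModel ι act ε) (h : IsShape m n k lam)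
    {e : Fin d → Fin m → Fin k × Fin n}
    (he : ∀ l, IsEnum (e l) (colWeight k lam l)) (hlex : ∀ l, IsLexIncreasing (e l))
    (T : Table d m k) : detSum ι e T ∈ hwSpace act (shapeWeight n lam) := by
  refine ⟨Submodule.sum_mem _ fun X _ => ?_, fun u hu => ?_⟩
  · by_cases hne : tableDet e T X = 0
    · rw [hne, zero_smul]
      exact Submodule.zero_mem _
    · exact Submodule.smul_mem _ _ (hM.mon_mem (mem_tables_of_tableDet_ne_zero h he hne))
  · unfold detSum
    simp only [map_sum, map_smul, hM.act_mon, Finset.smul_sum, smul_smul]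
    rw [Finset.sum_comm]
    refine Finset.sum_congr rfl fun Z _ => ?_
    rw [← Finset.sum_smul]
    congr 1
    let E : (Fin d → Fin m → Fin n) ≃ Table d m n := Equiv.piComm _
    have hE : ∀ R p l, E R p l = R l p := fun _ _ _ => rfl
    rw [← E.sum_comp]
    simp only [tableDet, hE]
    have h1 : ∀ R : Fin d → Fin m → Fin n,
        (∏ l, cellDet (e l) (fun j => T j l) fun j => R l j) * ∏ j, ∏ l, u l (Z j l) (R l j)
          = ∏ l, (cellDet (e l) (fun j => T j l) (R l) * ∏ j, u l (Z j l) (R l j)) := by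
      intro R
      rw [Finset.prod_comm (s := Finset.univ (α := Fin m)), ← Finset.prod_mul_distrib]
    simp only [h1]
    rw [← Fintype.prod_sum fun l (x : Fin m → Fin n) =>
      cellDet (e l) (fun j => T j l) x * ∏ j, u l (Z j l) (x j)]
    exact Finset.prod_congr rfl fun l _ => sum_cellDet_mul_prod (he l) (hlex l) (hu l) _ _

theorem IsModel.idx_mem (hM : IsModel ι act ε) (h : IsShape m n k lam) {T : Table d m k}
    (hT : T ∈ tables m (conjWeight k lam)) : idx ι T ∈ hwSpace act (shapeWeight n lam) := by
  obtain ⟨e, he, hlex⟩ := h.exists_isEnum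
  rw [idx_eq_detSum ι he hlex hT]
  exact Submodule.smul_mem _ _ (hM.detSum_mem h he hlex T)

theorem stabCard_smul_inv_smul {W : Type*} [AddCommGroup W] [Module ℂ W] (T : Table d m k)
    (v : W) : (stabCard T : ℂ) • (stabCard T : ℂ)⁻¹ • v = v :=
  smul_inv_smul₀ (Nat.cast_ne_zero.2 (stabCard_pos T).ne') v

/-- The weights `‖S‖` cancel the denominators. Only row `l` varies over the boundary, so the other
determinants factor out and `replaceSum_cellDet` applies to row `l`. -/
theorem sum_boundary_idx (ι : V d n →ₗ[ℂ] A) (h : IsShape m n k lam) {l : Fin d} {i j : Fin k}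
    (hij : i < j) {Y : Table d m k} (hY : Y ∈ tables m (shiftWeight l i j (conjWeight k lam))) :
    ∑ S ∈ boundary l j i Y, (stabCard S : ℂ) • idx ι S = 0 := by
  obtain ⟨e, he, hlex⟩ := h.exists_isEnum
  rw [sum_boundary hij.ne]
  have h1 : ∀ p ∈ Finset.univ.filter fun p => Y p l = i,
      (stabCard (replaceLetter Y p l j) : ℂ) • idx ι (replaceLetter Y p l j)
        = ∑ X : Table d m n, tableDet e (replaceLetter Y p l j) X • mon ι X := by
    intro p hp
    simp only [Finset.mem_filter, Finset.mem_univ, true_and] at hp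
    rw [idx_eq_detSum ι he hlex ((replaceLetter_mem_tables hp).2 hY), stabCard_smul_inv_smul]
    rfl
  rw [Finset.sum_congr rfl h1, Finset.sum_comm]
  refine Finset.sum_eq_zero fun X _ => ?_
  rw [← Finset.sum_smul]
  have h2 : ∀ p, tableDet e (replaceLetter Y p l j) X
      = cellDet (e l) (Function.update (fun q => Y q l) p j) (fun q => X q l)
        * ∏ l' ∈ Finset.univ.erase l, cellDet (e l') (fun q => Y q l') (fun q => X q l') := by
    intro p
    rw [tableDet, ← Finset.mul_prod_erase _ _ (Finset.mem_univ l), replaceLetter_row]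
    congr 1
    refine Finset.prod_congr rfl fun l' hl' => ?_
    rw [replaceLetter_row_ne Y p (Finset.ne_of_mem_erase hl')]
  simp only [h2]
  rw [← Finset.sum_mul]
  have h3 := replaceSum_cellDet (he l) hij.ne (colWeight_antitone l hij.le) (fun q => X q l)
    (fun q => Y q l)
  rw [replaceSum] at h3
  rw [h3, zero_mul, zero_smul]

end Index

/-! ### The index map and its kernel -/

section IndexMap

variable {d m n k : ℕ} {A A' : Type} [Ring A] [Algebra ℂ A] [Ring A'] [Algebra ℂ A']
  {ι : V d n →ₗ[ℂ] A} {act : (Fin d → Matrix (Fin n) (Fin n) ℂ) → A →ₗ[ℂ] A} {ε : ℕ}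
  {ι' : V d k →ₗ[ℂ] A'} {act' : (Fin d → Matrix (Fin k) (Fin k) ℂ) → A' →ₗ[ℂ] A'} {ε' : ℕ}
  {lam : Fin d → YoungDiagram}

/-- The vectors `∑ ‖S‖ • mon ι' S`, summed over the boundary of a table. -/
def boundaryVectors (ι' : V d k →ₗ[ℂ] A') (m : ℕ) (lam : Fin d → YoungDiagram) : Set A' :=
  {w | ∃ (l : Fin d) (i j : Fin k), i < j ∧
    ∃ Y ∈ tables m (shiftWeight l i j (conjWeight k lam)),
      w = ∑ S ∈ boundary l j i Y, (stabCard S : ℂ) • mon ι' S}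

theorem sum_tables_smul {W : Type*} [AddCommGroup W] [Module ℂ W] (α : Weight d k)
    (c : Table d m k → ℂ) (w : Table d m k → W) :
    ∑ T ∈ tables m α, c T • w T = ∑ T, (if T ∈ tables m α then c T else 0) • w T := by
  simp only [ite_smul, zero_smul]
  rw [← Finset.sum_filter, Finset.filter_mem_eq_inter, Finset.univ_inter]

theorem factorial_smul_eq_zero {W : Type*} [AddCommGroup W] [Module ℂ W] {v : W}
    (h : (m.factorial : ℂ) • v = 0) : v = 0 :=
  (smul_eq_zero.1 h).resolve_left (Nat.cast_ne_zero.2 m.factorial_ne_zero)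

/-- Well-definedness of the index map. By parity, `idx ι T` transforms under column permutations as
`mon ι' T` does, so `c` may be replaced by its average, and that vanishes by `indep` in the source.
-/
theorem sum_idx_eq_zero (hM : IsModel ι act ε) (hM' : IsModel ι' act' ε')
    (hpar : Even (ε' + (d + ε))) (h : IsShape m n k lam) {c : Table d m k → ℂ}
    (hc : ∑ T ∈ tables m (conjWeight k lam), c T • mon ι' T = 0) :
    ∑ T ∈ tables m (conjWeight k lam), c T • idx ι T = 0 := by
  obtain ⟨e, he, hlex⟩ := h.exists_isEnum
  rw [sum_tables_smul] at hc
  have h1 := hM'.indep _ hc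
  have h2 : ∀ (T : Table d m k) (σ : Equiv.Perm (Fin m)),
      (stabCard (T ∘ σ) : ℂ)⁻¹ • detSum ι e (T ∘ σ)
        = signC σ ^ ε' • (stabCard T : ℂ)⁻¹ • detSum ι e T := by
    intro T σ
    rw [stabCard_comp_perm, hM.detSum_comp_perm, signC_pow_eq σ hpar, smul_comm]
  have h3 := sum_average_smul (w := fun T => (stabCard T : ℂ)⁻¹ • detSum ι e T) h2 fun T => if T ∈ tables m (conjWeight k lam) then c T else 0
  simp only [h1, zero_smul, Finset.sum_const_zero] at h3
  rw [Finset.sum_congr rfl fun T hT => by rw [idx_eq_detSum ι he hlex hT]]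
  rw [sum_tables_smul (w := fun T => (stabCard T : ℂ)⁻¹ • detSum ι e T)]
  exact factorial_smul_eq_zero h3.symm

/-- By `indep` in the target, the pairing of the coefficients with `tableDet e · X` vanishes after
averaging over permutations of `X`. Parity moves the averaging from `X` to the index table; the
averaged coefficients then satisfy the hypothesis of the duality lemma, and undoing the average
costs only `m!`. -/
theorem sum_mon_mem_span (hM : IsModel ι act ε) (hM' : IsModel ι' act' ε')
    (hpar : Even (ε' + (d + ε))) (h : IsShape m n k lam) {c : Table d m k → ℂ}
    (hc : ∑ T ∈ tables m (conjWeight k lam), c T • idx ι T = 0) :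
    ∑ T ∈ tables m (conjWeight k lam), c T • mon ι' T
      ∈ Submodule.span ℂ (boundaryVectors ι' m lam) := by
  obtain ⟨e, he, hlex⟩ := h.exists_isEnum
  -- Coefficients with respect to `detSum`, absorbing `1 / ‖T‖` and extended by zero.
  set b : Table d m k → ℂ := fun T =>
    if T ∈ tables m (conjWeight k lam) then c T * (stabCard T : ℂ)⁻¹ else 0 with hb
  have h1 : ∑ X : Table d m n, (∑ T, b T * tableDet e T X) • mon ι X = 0 := by
    have h0 : ∑ T ∈ tables m (conjWeight k lam), c T • idx ι T = ∑ T, b T • detSum ι e T := by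
      rw [← sum_tables_smul]
      refine Finset.sum_congr rfl fun T hT => ?_
      rw [idx_eq_detSum ι he hlex hT, smul_smul]
    rw [← hc, h0]
    simp only [Finset.sum_smul, detSum, Finset.smul_sum, smul_smul]
    rw [Finset.sum_comm]
  have h2 := hM.indep _ h1
  set avg : Table d m k → ℂ := fun S => ∑ σ : Equiv.Perm (Fin m), signC σ ^ ε' * b (S ∘ σ) with havg
  have h3 : ∀ X : Table d m n, ∑ S, avg S * tableDet e S X = 0 := by
    intro X
    rw [← h2 X]
    simp only [havg, Finset.sum_mul]
    rw [Finset.sum_comm]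
    refine Finset.sum_congr rfl fun σ _ => ?_
    rw [← sum_comp_perm σ fun S => b S * tableDet e S (X ∘ σ), Finset.mul_sum]
    refine Finset.sum_congr rfl fun S _ => ?_
    rw [tableDet_comp_perm, signC_pow_eq σ hpar, pow_add]
    ring
  have hB := sum_smul_mem_of_boundary he colWeight_antitone h.colWeight_le
    (fun S => (stabCard S : ℂ) • mon ι' S) (Submodule.span ℂ (boundaryVectors ι' m lam))
    (fun l i j hij Y hY => Submodule.subset_span ⟨l, i, j, hij, Y, by rwa [conjWeight_eq], rfl⟩) h3
  have hw : ∀ (T : Table d m k) (σ : Equiv.Perm (Fin m)),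
      (stabCard (T ∘ σ) : ℂ) • mon ι' (T ∘ σ) = signC σ ^ ε' • (stabCard T : ℂ) • mon ι' T := by
    intro T σ
    rw [stabCard_comp_perm, hM'.mon_perm, smul_comm]
  have h4 := sum_average_smul (w := fun T => (stabCard T : ℂ) • mon ι' T) hw b
  have h5 : ∑ T, b T • (stabCard T : ℂ) • mon ι' T
      = ∑ T ∈ tables m (conjWeight k lam), c T • mon ι' T := by
    rw [sum_tables_smul]
    refine Finset.sum_congr rfl fun T _ => ?_
    simp only [hb]
    split_ifs
    · rw [smul_smul, mul_assoc, inv_mul_cancel₀ (Nat.cast_ne_zero.2 (stabCard_pos T).ne'), mul_one]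
    · simp
  have h6 : ∑ S ∈ tables m (conjWeight k lam), avg S • (stabCard S : ℂ) • mon ι' S
      = ∑ S, avg S • (stabCard S : ℂ) • mon ι' S := by
    refine Finset.sum_subset (Finset.subset_univ _) fun S _ hS => ?_
    have : avg S = 0 := by
      refine Finset.sum_eq_zero fun σ _ => ?_
      simp only [hb]
      rw [if_neg fun h' => hS ((comp_perm_mem_tables σ).1 h'), mul_zero]
    rw [this, zero_smul]
  rw [← conjWeight_eq, h6, h4, h5] at hB
  have h7 := Submodule.smul_mem _ (m.factorial : ℂ)⁻¹ hB
  rwa [inv_smul_smul₀ (Nat.cast_ne_zero.2 m.factorial_ne_zero)] at h7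

/-- Counting the letters of one row determines the number of columns; a row exists because `d > 0`.
Hence weight `λ'` forces degree `m`. -/
theorem size_eq_of_mem_tables (hd : 0 < d) (h : IsShape m n k lam) {m' : ℕ} {T : Table d m' k}
    (hT : T ∈ tables m' (conjWeight k lam)) : m' = m := by
  have h1 := h.sum_colWeight ⟨0, hd⟩
  have h2 : ∀ a, (Finset.univ.filter fun j => T j ⟨0, hd⟩ = a).card = colWeight k lam ⟨0, hd⟩ a := by
    intro a
    have := mem_tables.1 hT ⟨0, hd⟩ a
    rw [conjWeight_eq] at this
    beta_reduce at this
    exact_mod_cast this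
  rw [← h1, ← Finset.sum_congr rfl fun a _ => h2 a,
    ← Finset.card_eq_sum_card_fiberwise fun _ _ => Finset.mem_coe.2 (Finset.mem_univ _)]
  simp

theorem IsModel.exists_eq_sum (hd : 0 < d) (hM' : IsModel ι' act' ε') (h : IsShape m n k lam)
    {v : A'} (hv : v ∈ weightSpace act' (conjWeight k lam)) :
    ∃ c : Table d m k → ℂ, v = ∑ T ∈ tables m (conjWeight k lam), c T • mon ι' T := by
  classical
  replace hv := hM'.weightSpace_le_span _ hv
  induction hv using Submodule.span_induction with
  | mem v hv =>
    obtain ⟨m', X, hX, rfl⟩ := hv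
    obtain rfl := size_eq_of_mem_tables hd h hX
    refine ⟨Pi.single X 1, ?_⟩
    rw [Finset.sum_eq_single X (fun T _ hT => by simp [hT]) fun h => absurd hX h]
    simp
  | zero => exact ⟨0, by simp⟩
  | add v w _ _ h1 h2 =>
    obtain ⟨c₁, rfl⟩ := h1
    obtain ⟨c₂, rfl⟩ := h2
    exact ⟨c₁ + c₂, by simp [add_smul, Finset.sum_add_distrib]⟩
  | smul r v _ h1 =>
    obtain ⟨c, rfl⟩ := h1
    exact ⟨r • c, by simp [smul_smul, Finset.smul_sum]⟩

/-- The linear map prescribed on the products of basis tensors of weight `λ'`. -/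
theorem exists_indexMap (hd : 0 < d) (hM : IsModel ι act ε) (hM' : IsModel ι' act' ε')
    (hpar : Even (ε' + (d + ε))) (h : IsShape m n k lam) :
    ∃ D : weightSpace act' (conjWeight k lam) →ₗ[ℂ] hwSpace act (shapeWeight n lam),
      ∀ (T : Table d m k) (hT : T ∈ tables m (conjWeight k lam)),
        (D ⟨mon ι' T, hM'.mon_mem hT⟩ : A) = idx ι T := by
  classical
  let P : ((tables m (conjWeight k lam)) → ℂ) →ₗ[ℂ] weightSpace act' (conjWeight k lam) :=
    Fintype.linearCombination ℂ fun T => ⟨mon ι' T.1, hM'.mon_mem T.2⟩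
  let Γ : ((tables m (conjWeight k lam)) → ℂ) →ₗ[ℂ] hwSpace act (shapeWeight n lam) :=
    Fintype.linearCombination ℂ fun T => ⟨idx ι T.1, hM.idx_mem h T.2⟩
  have hP : ∀ c : Table d m k → ℂ, ((P fun T => c T.1 : _) : A')
      = ∑ T ∈ tables m (conjWeight k lam), c T • mon ι' T := by
    intro c
    simp only [P, Fintype.linearCombination_apply, Submodule.coe_sum, Submodule.coe_smul]
    exact Finset.sum_coe_sort (tables m (conjWeight k lam)) fun T => c T • mon ι' T
  have hΓ : ∀ c : Table d m k → ℂ, ((Γ fun T => c T.1 : _) : A)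
      = ∑ T ∈ tables m (conjWeight k lam), c T • idx ι T := by
    intro c
    simp only [Γ, Fintype.linearCombination_apply, Submodule.coe_sum, Submodule.coe_smul]
    exact Finset.sum_coe_sort (tables m (conjWeight k lam)) fun T => c T • idx ι T
  have hsurj : LinearMap.range P = ⊤ := by
    rw [LinearMap.range_eq_top]
    rintro ⟨v, hv⟩
    obtain ⟨c, hc⟩ := hM'.exists_eq_sum hd h hv
    exact ⟨fun T => c T.1, Subtype.ext ((hP c).trans hc.symm)⟩
  have hker : ∀ f, P f = 0 → Γ f = 0 := by
    intro f hf
    let c : Table d m k → ℂ := fun T => if hT : T ∈ tables m (conjWeight k lam) then f ⟨T, hT⟩ else 0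
    have hcf : (fun T : (tables m (conjWeight k lam)) => c T.1) = f := by
      funext T
      simp [c]
    rw [← hcf] at hf ⊢
    apply Subtype.ext
    rw [hΓ]
    refine sum_idx_eq_zero hM hM' hpar h ?_
    rw [← hP, hf]
    rfl
  -- Since `Γ` kills the kernel of `P`, composing `Γ` with any section of `P` gives the required
  -- map.
  obtain ⟨g, hg⟩ := P.exists_rightInverse_of_surjective hsurj
  refine ⟨Γ ∘ₗ g, fun T hT => ?_⟩
  have hPT : P (Pi.single ⟨T, hT⟩ 1) = ⟨mon ι' T, hM'.mon_mem hT⟩ := by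
    simp [P, Fintype.linearCombination_apply_single]
  have h1 : Γ (g ⟨mon ι' T, hM'.mon_mem hT⟩ - Pi.single ⟨T, hT⟩ 1) = 0 := by
    apply hker
    rw [map_sub, hPT, sub_eq_zero]
    exact LinearMap.congr_fun hg _
  rw [map_sub, sub_eq_zero] at h1
  rw [LinearMap.comp_apply, h1]
  simp [Γ, Fintype.linearCombination_apply_single]

theorem indexMap_sum (hM' : IsModel ι' act' ε')
    {D : weightSpace act' (conjWeight k lam) →ₗ[ℂ] hwSpace act (shapeWeight n lam)}
    (hD : ∀ (T : Table d m k) (hT : T ∈ tables m (conjWeight k lam)),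
      (D ⟨mon ι' T, hM'.mon_mem hT⟩ : A) = idx ι T) (c : Table d m k → ℂ)
    (hv : ∑ T ∈ tables m (conjWeight k lam), c T • mon ι' T ∈ weightSpace act' (conjWeight k lam)) :
    (D ⟨_, hv⟩ : A) = ∑ T ∈ tables m (conjWeight k lam), c T • idx ι T := by
  have h1 : (⟨_, hv⟩ : weightSpace act' (conjWeight k lam))
      = ∑ T : (tables m (conjWeight k lam)), c T.1 • ⟨mon ι' T.1, hM'.mon_mem T.2⟩ := by
    apply Subtype.ext
    simp only [Submodule.coe_sum, Submodule.coe_smul]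
    exact (Finset.sum_coe_sort (tables m (conjWeight k lam)) fun T => c T • mon ι' T).symm
  rw [h1]
  simp only [map_sum, map_smul, Submodule.coe_sum, Submodule.coe_smul]
  refine (Finset.sum_congr rfl fun T _ => ?_).trans
    (Finset.sum_coe_sort (tables m (conjWeight k lam)) fun T => c T • idx ι T)
  rw [hD T.1 T.2]

theorem indexMap_unique (hd : 0 < d) (hM' : IsModel ι' act' ε') (h : IsShape m n k lam)
    {D D' : weightSpace act' (conjWeight k lam) →ₗ[ℂ] hwSpace act (shapeWeight n lam)}
    (hD : ∀ (T : Table d m k) (hT : T ∈ tables m (conjWeight k lam)),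
      (D ⟨mon ι' T, hM'.mon_mem hT⟩ : A) = idx ι T)
    (hD' : ∀ (T : Table d m k) (hT : T ∈ tables m (conjWeight k lam)),
      (D' ⟨mon ι' T, hM'.mon_mem hT⟩ : A) = idx ι T) : D = D' := by
  ext ⟨v, hv⟩
  obtain ⟨c, rfl⟩ := hM'.exists_eq_sum hd h hv
  rw [indexMap_sum hM' hD, indexMap_sum hM' hD']

theorem indexMap_ker (hd : 0 < d) (hM : IsModel ι act ε) (hM' : IsModel ι' act' ε')
    (hpar : Even (ε' + (d + ε))) (h : IsShape m n k lam)
    {D : weightSpace act' (conjWeight k lam) →ₗ[ℂ] hwSpace act (shapeWeight n lam)}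
    (hD : ∀ (T : Table d m k) (hT : T ∈ tables m (conjWeight k lam)),
      (D ⟨mon ι' T, hM'.mon_mem hT⟩ : A) = idx ι T) :
    (LinearMap.ker D).map (Submodule.subtype _) = Submodule.span ℂ (boundaryVectors ι' m lam) := by
  apply le_antisymm
  · rintro _ ⟨⟨v, hv⟩, hker, rfl⟩
    obtain ⟨c, rfl⟩ := hM'.exists_eq_sum hd h hv
    refine sum_mon_mem_span hM hM' hpar h ?_
    rw [← indexMap_sum hM' hD c hv, LinearMap.mem_ker.1 hker]
    rfl
  · rw [Submodule.span_le]
    rintro _ ⟨l, i, j, hij, Y, hY, rfl⟩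
    have hsub : boundary l j i Y ⊆ tables m (conjWeight k lam) := by
      intro S hS
      obtain ⟨p, hp, rfl⟩ := Finset.mem_image.1 hS
      exact (replaceLetter_mem_tables (Finset.mem_filter.1 hp).2).2 hY
    have hsum : ∀ {W : Type} [AddCommGroup W] [Module ℂ W] (w : Table d m k → W),
        ∑ S ∈ boundary l j i Y, (stabCard S : ℂ) • w S
          = ∑ T ∈ tables m (conjWeight k lam),
            (if T ∈ boundary l j i Y then (stabCard T : ℂ) else 0) • w T := by
      intro W _ _ w
      simp only [ite_smul, zero_smul]
      rw [← Finset.sum_filter, Finset.filter_mem_eq_inter, Finset.inter_eq_right.2 hsub]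
    have hmem : ∑ S ∈ boundary l j i Y, (stabCard S : ℂ) • mon ι' S
        ∈ weightSpace act' (conjWeight k lam) :=
      Submodule.sum_mem _ fun S hS => Submodule.smul_mem _ _ (hM'.mon_mem (hsub hS))
    refine ⟨⟨_, hmem⟩, ?_, rfl⟩
    rw [SetLike.mem_coe, LinearMap.mem_ker]
    apply Subtype.ext
    have h1 := hmem
    rw [hsum] at h1
    have h2 : (⟨_, hmem⟩ : weightSpace act' (conjWeight k lam)) = ⟨_, h1⟩ :=
      Subtype.ext (hsum _)
    rw [h2, indexMap_sum hM' hD, ← hsum, sum_boundary_idx ι h hij hY]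
    rfl

end IndexMap

end

/-! ### Specialization of sources to the symmetric and the exterior algebra -/

section

section Linear

variable {d m n k : ℕ} {A : Type} [Ring A] [Algebra ℂ A]
  {ι : V d n →ₗ[ℂ] A} {act : (Fin d → Matrix (Fin n) (Fin n) ℂ) → A →ₗ[ℂ] A} {ε : ℕ}
  {lam : Fin d → YoungDiagram}

/-- Either the columns are distinct and the stabilizer is trivial, or the wedge product is zero; so
no multiplicities appear on the exterior side. -/
theorem stabCard_smul_wedge (T : Table d m k) : (stabCard T : ℂ) • wedge T = wedge T := by
  by_cases h : Function.Injective T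
  · have : stabCard T = 1 := by
      rw [stabCard, Finset.card_eq_one]
      refine ⟨1, ?_⟩
      ext π
      simp only [Finset.mem_filter, Finset.mem_univ, true_and, Finset.mem_singleton]
      refine ⟨fun hπ => ?_, fun hπ => by simp [hπ]⟩
      ext j
      rw [h (congrFun hπ j)]
      rfl
    rw [this, Nat.cast_one, one_smul]
  · rw [wedge_eq_zero h, smul_zero]

/-- If columns `p` and `q` coincide, a replacement elsewhere keeps the repetition, and the
replacements at `p` and `q` differ by a swap and cancel. So restricting to tables without repeated
columns loses nothing. -/
theorem sum_boundary_wedge_eq_zero {l : Fin d} {i j : Fin k} (hij : i ≠ j) {Y : Table d m k}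
    (hY : ¬ Function.Injective Y) : ∑ S ∈ boundary l j i Y, wedge S = 0 := by
  rw [sum_boundary hij]
  obtain ⟨p, q, hYpq, hpq⟩ : ∃ p q, Y p = Y q ∧ p ≠ q := by
    simpa [Function.Injective] using hY
  have h0 : ∀ r, r ≠ p → r ≠ q → wedge (replaceLetter Y r l j) = 0 := by
    intro r hrp hrq
    refine wedge_eq_zero fun hinj => hpq (hinj ?_)
    simp only [replaceLetter, Function.update_of_ne hrp.symm, Function.update_of_ne hrq.symm, hYpq]
  by_cases hp : Y p l = i
  · rw [Finset.sum_eq_add_of_mem p q (by simpa using hp) (by simpa [← hYpq] using hp) hpq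
      fun r _ hr => h0 r hr.1 hr.2]
    have h1 : replaceLetter Y p l j ∘ Equiv.swap p q = replaceLetter Y q l j := by
      unfold replaceLetter
      rw [update_update_swap Y hpq (Y p) _ rfl hYpq.symm, hYpq]
    have h2 := (isModel_alt d k).mon_perm (replaceLetter Y p l j) (Equiv.swap p q)
    rw [h1, mon_alt, mon_alt, signC, Equiv.Perm.sign_swap hpq] at h2
    rw [h2]
    simp
  · refine Finset.sum_eq_zero fun r hr => h0 r ?_ ?_
    · rintro rfl
      exact hp (Finset.mem_filter.1 hr).2
    · rintro rfl
      rw [hYpq] at hp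
      exact hp (Finset.mem_filter.1 hr).2

theorem boundaryVectors_sym (m : ℕ) (lam : Fin d → YoungDiagram) :
    boundaryVectors (SymmetricAlgebra.ι ℂ (V d k)) m lam = symBoundaries m k lam := by
  simp only [boundaryVectors, symBoundaries, mon_sym]

theorem span_boundaryVectors_alt (m : ℕ) (lam : Fin d → YoungDiagram) :
    Submodule.span ℂ (boundaryVectors (ExteriorAlgebra.ι ℂ (M := V d k)) m lam)
      = Submodule.span ℂ (altBoundaries m k lam) := by
  simp only [boundaryVectors, altBoundaries, mon_alt, stabCard_smul_wedge]
  apply le_antisymm <;> rw [Submodule.span_le]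
  · rintro _ ⟨l, i, j, hij, Y, hY, rfl⟩
    by_cases hinj : Function.Injective Y
    · exact Submodule.subset_span ⟨l, i, j, hij, Y, mem_tables01.2 ⟨hY, hinj⟩, rfl⟩
    · rw [sum_boundary_wedge_eq_zero hij.ne hinj]
      exact Submodule.zero_mem _
  · rintro _ ⟨l, i, j, hij, X, hX, rfl⟩
    exact Submodule.subset_span ⟨l, i, j, hij, X, (mem_tables01.1 hX).1, rfl⟩

theorem boundary_subset_tables {l : Fin d} {i j : Fin k} {α : Weight d k} {Y : Table d m k}
    (hY : Y ∈ tables m (shiftWeight l i j α)) : boundary l j i Y ⊆ tables m α := by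
  intro S hS
  obtain ⟨p, hp, rfl⟩ := Finset.mem_image.1 hS
  exact (replaceLetter_mem_tables (Finset.mem_filter.1 hp).2).2 hY

/-- The linear relations and the index map with source in the symmetric algebra. -/
theorem symIndexMap_spec (hd : 0 < d) (hM : IsModel ι act ε) (hpar : Even (d + ε))
    (h : IsShape m n k lam) {x : Table d m k → A}
    (hx : ∀ T ∈ tables m (conjWeight k lam), x T = idx ι T) :
    (∀ (l : Fin d) (i j : Fin k), i < j →
      ∀ Y ∈ tables m (shiftWeight l i j (conjWeight k lam)),
        ∑ S ∈ boundary l j i Y, (stabCard S : ℂ) • x S = 0) ∧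
    (∃! D : weightSpace symAct (conjWeight k lam) →ₗ[ℂ] hwSpace act (shapeWeight n lam),
      IsSymIndexMap x D) ∧
    ∀ D : weightSpace symAct (conjWeight k lam) →ₗ[ℂ] hwSpace act (shapeWeight n lam),
      IsSymIndexMap x D →
        (LinearMap.ker D).map (Submodule.subtype _) = Submodule.span ℂ (symBoundaries m k lam) := by
  have hM' := isModel_sym d k
  have hiff : ∀ D : weightSpace symAct (conjWeight k lam) →ₗ[ℂ] hwSpace act (shapeWeight n lam),
      IsSymIndexMap x D ↔ ∀ (T : Table d m k) (hT : T ∈ tables m (conjWeight k lam)),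
        (D ⟨mon (SymmetricAlgebra.ι ℂ (V d k)) T, hM'.mon_mem hT⟩ : A) = idx ι T := by
    intro D
    refine forall_congr' fun T => forall_congr' fun hT => ?_
    rw [hx T hT]
    simp only [mon_sym]
  have hpar' : Even (0 + (d + ε)) := by rwa [zero_add]
  refine ⟨fun l i j hij Y hY => ?_, ?_, fun D hD => ?_⟩
  · rw [← sum_boundary_idx ι h hij hY]
    exact Finset.sum_congr rfl fun S hS => by rw [hx S (boundary_subset_tables hY hS)]
  · obtain ⟨D, hD⟩ := exists_indexMap hd hM hM' hpar' h
    exact ⟨D, (hiff D).2 hD, fun D' hD' => indexMap_unique hd hM' h ((hiff D').1 hD') hD⟩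
  · rw [indexMap_ker hd hM hM' hpar' h ((hiff D).1 hD), boundaryVectors_sym]

/-- The linear relations and the index map with source in the exterior algebra. -/
theorem altIndexMap_spec (hd : 0 < d) (hM : IsModel ι act ε) (hpar : Even (1 + (d + ε)))
    (h : IsShape m n k lam) {x : Table d m k → A}
    (hx : ∀ T ∈ tables m (conjWeight k lam), x T = idx ι T) :
    (∀ (l : Fin d) (i j : Fin k), i < j →
      ∀ X ∈ tables01 m (shiftWeight l i j (conjWeight k lam)),
        ∑ T ∈ boundary l j i X, x T = 0) ∧
    (∃! D : weightSpace altAct (conjWeight k lam) →ₗ[ℂ] hwSpace act (shapeWeight n lam),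
      IsAltIndexMap x D) ∧
    ∀ D : weightSpace altAct (conjWeight k lam) →ₗ[ℂ] hwSpace act (shapeWeight n lam),
      IsAltIndexMap x D →
        (LinearMap.ker D).map (Submodule.subtype _) = Submodule.span ℂ (altBoundaries m k lam) := by
  have hM' := isModel_alt d k
  have hiff : ∀ D : weightSpace altAct (conjWeight k lam) →ₗ[ℂ] hwSpace act (shapeWeight n lam),
      IsAltIndexMap x D ↔ ∀ (T : Table d m k) (hT : T ∈ tables m (conjWeight k lam)),
        (D ⟨mon (ExteriorAlgebra.ι ℂ (M := V d k)) T, hM'.mon_mem hT⟩ : A) = idx ι T := by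
    intro D
    refine forall_congr' fun T => forall_congr' fun hT => ?_
    rw [hx T hT]
    simp only [mon_alt]
  obtain ⟨D₀, hD₀⟩ := exists_indexMap hd hM hM' hpar h
  refine ⟨fun l i j hij Y hY => ?_, ?_, fun D hD => ?_⟩
  · have hY' := (mem_tables01.1 hY).1
    rw [← sum_boundary_idx ι h hij hY']
    refine Finset.sum_congr rfl fun S hS => ?_
    have hS' := boundary_subset_tables hY' hS
    -- The factor `‖S‖` is removed through the index map: it acts trivially on `wedge S`, hence on
    -- the image.
    rw [hx S hS', ← hD₀ S hS', ← Submodule.coe_smul, ← map_smul]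
    congr 2
    apply Subtype.ext
    rw [Submodule.coe_smul]
    simp only [mon_alt, stabCard_smul_wedge]
  · exact ⟨D₀, (hiff D₀).2 hD₀, fun D' hD' => indexMap_unique hd hM' h ((hiff D').1 hD') hD₀⟩
  · rw [indexMap_ker hd hM hM' hpar h ((hiff D).1 hD), span_boundaryVectors_alt]

end Linear

end

section

/-! ### Concatenation of words and tables -/

section Sigma

variable {q : ℕ} {m : Fin q → ℕ}

theorem finSigmaFinEquiv_lt_iff {i : Fin q} {p p' : Fin (m i)} :
    finSigmaFinEquiv (⟨i, p⟩ : Σ i, Fin (m i)) < finSigmaFinEquiv ⟨i, p'⟩ ↔ p < p' := by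
  rw [Fin.lt_def, Fin.lt_def, finSigmaFinEquiv_apply, finSigmaFinEquiv_apply]
  simp

theorem prod_finSigmaFin {M : Type*} [CommMonoid M] (f : Fin (∑ i, m i) → M) :
    ∏ j, f j = ∏ i, ∏ p, f (finSigmaFinEquiv ⟨i, p⟩) := by
  rw [← Equiv.prod_comp finSigmaFinEquiv, Fintype.prod_sigma]

theorem card_filter_concat {α : Type*} [DecidableEq α] {s : Fin (∑ i, m i) → α} {β : Type*}
    [DecidableEq β] {s' : ∀ i, Fin (m i) → β}
    (h : ∀ i i' p p', s (finSigmaFinEquiv ⟨i, p⟩) = s (finSigmaFinEquiv ⟨i', p'⟩) ↔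
      i = i' ∧ s' i p = s' i' p') (i : Fin q) (p : Fin (m i)) :
    (Finset.univ.filter fun j => s j = s (finSigmaFinEquiv ⟨i, p⟩)).card
      = (Finset.univ.filter fun p' => s' i p' = s' i p).card := by
  symm
  refine Finset.card_bij (fun p' _ => finSigmaFinEquiv ⟨i, p'⟩) ?_ ?_ ?_
  · intro p' hp'
    simpa [h] using hp'
  · intro p' _ p'' _ heq
    simpa using heq
  · intro j hj
    obtain ⟨⟨i', p'⟩, rfl⟩ := finSigmaFinEquiv.surjective j
    simp only [Finset.mem_filter, Finset.mem_univ, true_and, h] at hj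
    obtain ⟨rfl, hj⟩ := hj
    exact ⟨p', by simpa using hj, rfl⟩

/-- Each letter of `s` occurs in a single segment, so the blocks, and the inversions inside them,
are exactly those of the segments. -/
theorem wordSgn_concat {s : Fin (∑ i, m i) → ℕ} {s' : ∀ i, Fin (m i) → ℕ}
    (h : ∀ i i' p p', s (finSigmaFinEquiv ⟨i, p⟩) = s (finSigmaFinEquiv ⟨i', p'⟩) ↔
      i = i' ∧ s' i p = s' i' p') (w : Fin (∑ i, m i) → ℕ) :
    wordSgn s w = ∏ i, wordSgn (s' i) fun p => w (finSigmaFinEquiv ⟨i, p⟩) := by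
  classical
  have hblock : IsBlockPerm s w ↔
      ∀ i, IsBlockPerm (s' i) fun p => w (finSigmaFinEquiv ⟨i, p⟩) := by
    constructor
    · intro hb i
      refine ⟨fun p => ?_, fun p p' hs hw => ?_⟩
      · rw [← card_filter_concat h]
        exact hb.1 _
      · have := hb.2 _ _ ((h i i p p').2 ⟨rfl, hs⟩) hw
        simpa using this
    · intro hb
      refine ⟨fun j => ?_, fun j j' hs hw => ?_⟩
      · obtain ⟨⟨i, p⟩, rfl⟩ := finSigmaFinEquiv.surjective j
        rw [card_filter_concat h]
        exact (hb i).1 p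
      · obtain ⟨⟨i, p⟩, rfl⟩ := finSigmaFinEquiv.surjective j
        obtain ⟨⟨i', p'⟩, rfl⟩ := finSigmaFinEquiv.surjective j'
        obtain ⟨rfl, hs'⟩ := (h _ _ _ _).1 hs
        rw [(hb i).2 p p' hs' hw]
  simp only [wordSgn_eq]
  by_cases hb : IsBlockPerm s w
  · rw [if_pos hb, prod_finSigmaFin]
    refine Finset.prod_congr rfl fun i _ => ?_
    rw [if_pos (hblock.1 hb i)]
    refine Finset.prod_congr rfl fun p _ => ?_
    rw [prod_finSigmaFin, Finset.prod_eq_single i]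
    · refine Finset.prod_congr rfl fun p' _ => ?_
      simp only [finSigmaFinEquiv_lt_iff, h, true_and]
    · intro i' _ hne
      refine Finset.prod_eq_one fun p' _ => ?_
      exact if_neg fun hs => hne ((h _ _ _ _).1 hs.2.1).1.symm
    · simp
  · rw [if_neg hb]
    rw [hblock, not_forall] at hb
    obtain ⟨i, hi⟩ := hb
    exact (Finset.prod_eq_zero (Finset.mem_univ i) (if_neg hi)).symm

end Sigma

theorem prod_ofFn_finSigmaFin {R : Type*} [Monoid R] (q : ℕ) : ∀ {m : Fin q → ℕ}
    (f : Fin (∑ i, m i) → R),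
    (List.ofFn f).prod = (List.ofFn fun i => (List.ofFn fun p => f (finSigmaFinEquiv ⟨i, p⟩)).prod).prod := by
  induction q with
  | zero =>
    intro m f
    rw [List.ofFn_congr (show ∑ i, m i = 0 by simp)]
    simp
  | succ q ih =>
    intro m f
    rw [List.ofFn_congr (Fin.sum_univ_succ m), List.ofFn_add, List.prod_append, ih, List.ofFn_succ,
      List.prod_cons]
    congr 1
    · congr 2
      funext p
      congr 1
      ext
      simp [finSigmaFinEquiv_apply]
    · congr 2
      funext i
      congr 2
      funext p
      congr 1
      ext
      simp only [Fin.val_cast, Fin.val_natAdd, finSigmaFinEquiv_apply]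
      rw [← add_assoc]
      congr 1
      exact (Fin.sum_univ_succ fun j : Fin ((i : ℕ) + 1) => m (Fin.castLE i.succ.2.le j)).symm

section Concat

variable {d n k q : ℕ} {m : Fin q → ℕ}

/-- Tables of total size `∑ m i` as families of tables of sizes `m i`. -/
def concatEquiv (d n : ℕ) {q : ℕ} (m : Fin q → ℕ) :
    Table d (∑ i, m i) n ≃ ∀ i, Table d (m i) n where
  toFun Z i p := Z (finSigmaFinEquiv ⟨i, p⟩)
  invFun X j := X (finSigmaFinEquiv.symm j).1 (finSigmaFinEquiv.symm j).2
  left_inv Z := by funext j; simp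
  right_inv X := by
    funext i p
    exact congrArg (fun x : Σ i, Fin (m i) => X x.1 x.2) (Equiv.symm_apply_apply _ _)

/-- Columns from different segments are never equal, so a stabilizing permutation preserves every
segment and is a tuple of stabilizing permutations. -/
theorem stabCard_concat {T : Table d (∑ i, m i) k} {T' : ∀ i, Table d (m i) k}
    (h : ∀ i i' p p', T (finSigmaFinEquiv ⟨i, p⟩) = T (finSigmaFinEquiv ⟨i', p'⟩) ↔
      i = i' ∧ T' i p = T' i' p') :
    stabCard T = ∏ i, stabCard (T' i) := by
  have hcard : ∀ {r : ℕ} (S : Table d r k),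
      stabCard S = Fintype.card {π : Equiv.Perm (Fin r) // S ∘ π = S} := by
    intro r S
    rw [Fintype.card_subtype]
    rfl
  simp only [hcard]
  rw [← Fintype.card_pi]
  symm
  let Φ : (∀ i, {π : Equiv.Perm (Fin (m i)) // T' i ∘ π = T' i}) →
      {π : Equiv.Perm (Fin (∑ i, m i)) // T ∘ π = T} := fun π =>
    ⟨finSigmaFinEquiv.permCongr (Equiv.Perm.sigmaCongrRight fun i => (π i).1), by
      funext j
      obtain ⟨⟨i, p⟩, rfl⟩ := finSigmaFinEquiv.surjective j
      rw [Function.comp_apply, Equiv.permCongr_apply, Equiv.symm_apply_apply]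
      exact (h _ _ _ _).2 ⟨rfl, congrFun (π i).2 p⟩⟩
  refine Fintype.card_congr (Equiv.ofBijective Φ ⟨fun π π' hπ => ?_, fun ⟨σ, hσ⟩ => ?_⟩)
  · funext i
    apply Subtype.ext
    ext p
    have h1 := congrArg (fun σ => σ (finSigmaFinEquiv ⟨i, p⟩)) (congrArg Subtype.val hπ)
    exact congrArg Fin.val (by simpa [Φ] using h1)
  · have h1 : ∀ i (p : Fin (m i)), ∃ p', σ (finSigmaFinEquiv ⟨i, p⟩) = finSigmaFinEquiv ⟨i, p'⟩ ∧
        T' i p' = T' i p := by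
      intro i p
      obtain ⟨⟨i', p'⟩, hx⟩ := finSigmaFinEquiv.surjective (σ (finSigmaFinEquiv ⟨i, p⟩))
      have h2 := congrFun hσ (finSigmaFinEquiv ⟨i, p⟩)
      rw [Function.comp_apply, ← hx, h] at h2
      obtain ⟨rfl, h2⟩ := h2
      exact ⟨p', hx.symm, h2⟩
    choose f hf hT using h1
    have hinj : ∀ i, Function.Injective (f i) := by
      intro i p p' hpp
      have h2 := hf i p
      rw [hpp, ← hf i p'] at h2
      simpa using h2
    refine ⟨fun i => ⟨Equiv.ofBijective (f i) (Finite.injective_iff_bijective.1 (hinj i)),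
      funext (hT i)⟩, Subtype.ext (Equiv.ext fun j => ?_)⟩
    obtain ⟨⟨i, p⟩, rfl⟩ := finSigmaFinEquiv.surjective j
    rw [hf i p]
    simp [Φ]

theorem mon_concat {A : Type} [Ring A] [Algebra ℂ A] (ι : V d n →ₗ[ℂ] A)
    (Z : Table d (∑ i, m i) n) :
    mon ι Z = (List.ofFn fun i => mon ι (concatEquiv d n m Z i)).prod :=
  prod_ofFn_finSigmaFin q _

/-- The product formula for index vectors. -/
theorem prod_idx {A : Type} [Ring A] [Algebra ℂ A] (ι : V d n →ₗ[ℂ] A) (hd : 0 < d)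
    {T : Table d (∑ i, m i) k} {T' : ∀ i, Table d (m i) k}
    (h : ∀ i i' p p' l, T (finSigmaFinEquiv ⟨i, p⟩) l = T (finSigmaFinEquiv ⟨i', p'⟩) l ↔
      i = i' ∧ T' i p l = T' i' p' l) :
    (List.ofFn fun i => idx ι (T' i)).prod
      = ((tableSign T * ∏ i, tableSign (T' i) : ℤ) : ℂ) • idx ι T := by
  -- A single row already tells the segments apart; this needs `d > 0`.
  have hcol : ∀ i i' p p', T (finSigmaFinEquiv ⟨i, p⟩) = T (finSigmaFinEquiv ⟨i', p'⟩) ↔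
      i = i' ∧ T' i p = T' i' p' := by
    intro i i' p p'
    constructor
    · intro h1
      refine ⟨((h i i' p p' ⟨0, hd⟩).1 (congrFun h1 _)).1, funext fun l => ?_⟩
      exact ((h i i' p p' l).1 (congrFun h1 l)).2
    · rintro ⟨hi, hp⟩
      funext l
      exact (h i i' p p' l).2 ⟨hi, congrFun hp l⟩
  have hsgn : ∀ Z : Table d (∑ i, m i) n,
      tableSgn T Z = ∏ i, tableSgn (T' i) (concatEquiv d n m Z i) := by
    intro Z
    simp only [tableSgn]
    rw [Finset.prod_comm]
    refine Finset.prod_congr rfl fun l _ => ?_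
    refine wordSgn_concat (s' := fun i => (T' i).row l) (fun i i' p p' => ?_) _
    have := h i i' p p' l
    simp only [Table.row, Fin.val_inj]
    exact this
  simp only [idx]
  rw [prod_ofFn_smul, prod_ofFn_sum q fun i (X : Table d (m i) n) =>
    (tableSgn (T' i) X : ℂ) • mon ι X, ← (concatEquiv d n m).sum_comp, smul_smul]
  have h1 : ∀ Z : Table d (∑ i, m i) n,
      (List.ofFn fun i => (tableSgn (T' i) (concatEquiv d n m Z i) : ℂ) •
        mon ι (concatEquiv d n m Z i)).prod = (tableSgn T Z : ℂ) • mon ι Z := by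
    intro Z
    rw [prod_ofFn_smul, ← mon_concat, hsgn]
    push_cast
    rfl
  simp only [h1]
  congr 1
  rw [Finset.prod_div_distrib, stabCard_concat hcol]
  push_cast
  have h2 : (tableSign T : ℂ) * tableSign T = 1 := by exact_mod_cast tableSign_mul_self T
  rw [mul_div_assoc', mul_right_comm, h2, one_mul]

end Concat

/-! ### Sums of shapes -/

section SumShape

variable {d n k q : ℕ}

theorem sum_rowLen_eq_card {μ : YoungDiagram} (h : μ.colLen 0 ≤ n) :
    ∑ a ∈ Finset.range n, μ.rowLen a = μ.card := by
  rw [YoungDiagram.card, Finset.card_eq_sum_card_fiberwise (f := Prod.fst) (t := Finset.range n)]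
  · exact Finset.sum_congr rfl fun a _ => μ.rowLen_eq_card
  · rintro ⟨i, j⟩ hc
    have h1 : (i, 0) ∈ μ := μ.up_left_mem le_rfl (Nat.zero_le _) hc
    rw [YoungDiagram.mem_iff_lt_colLen] at h1
    simp only [Finset.coe_range, Set.mem_Iio]
    omega

/-- A first row longer than `k` would contain the cell `(0, k)`, which the first `k` columns miss.
-/
theorem rowLen_zero_le_of_card_le {μ : YoungDiagram} (h : μ.card ≤ ∑ a : Fin k, μ.colLen a) :
    μ.rowLen 0 ≤ k := by
  by_contra hk
  rw [not_le, ← YoungDiagram.mem_iff_lt_rowLen] at hk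
  have h1 : ∑ a : Fin k, μ.colLen a = (μ.cells.filter fun c => c.2 < k).card := by
    rw [Finset.card_eq_sum_card_fiberwise (f := Prod.snd) (t := Finset.range k), Finset.sum_range]
    · refine Finset.sum_congr rfl fun a _ => ?_
      rw [YoungDiagram.colLen_eq_card, YoungDiagram.col, Finset.filter_filter]
      congr 1
      refine Finset.filter_congr fun c _ => ⟨fun h => ⟨by omega, h⟩, fun h => h.2⟩
    · intro c hc
      simpa using (Finset.mem_filter.1 hc).2
  have h2 : (μ.cells.filter fun c => c.2 < k).card < μ.card := by
    refine Finset.card_lt_card (Finset.filter_ssubset.2 ⟨(0, k), hk, by simp⟩)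
  omega

theorem colLen_partSum_le {mu : Fin q → YoungDiagram} (h : ∀ i, (mu i).colLen 0 ≤ n) :
    (partSum mu).colLen 0 ≤ n := by
  by_contra hn
  rw [not_le, ← YoungDiagram.mem_iff_lt_colLen, YoungDiagram.mem_iff_lt_rowLen, rowLen_partSum] at hn
  obtain ⟨i, -, hi⟩ := Finset.exists_ne_zero_of_sum_ne_zero hn.ne'
  rw [← Nat.pos_iff_ne_zero, ← YoungDiagram.mem_iff_lt_rowLen, YoungDiagram.mem_iff_lt_colLen] at hi
  have := h i
  omega

theorem card_partSum {mu : Fin q → YoungDiagram} (h : ∀ i, (mu i).colLen 0 ≤ n) :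
    (partSum mu).card = ∑ i, (mu i).card := by
  rw [← sum_rowLen_eq_card (colLen_partSum_le h)]
  simp only [rowLen_partSum]
  rw [Finset.sum_comm]
  exact Finset.sum_congr rfl fun i _ => sum_rowLen_eq_card (h i)

/-- The width bound is forced by `T`: its rows have only `k` letters, so the first `k` columns
already account for all cells. -/
theorem isShape_sumShape {F : Fin q → Factor d n k} {T : Table d (∑ i, (F i).m) k}
    (hT : T ∈ tables (∑ i, (F i).m) (conjWeight k (sumShape F))) :
    IsShape (∑ i, (F i).m) n k (sumShape F) := by
  have hlen : ∀ l i, ((F i).shape l).colLen 0 ≤ n := fun l i => (F i).isShape.length_le l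
  have hcard : ∀ l, (sumShape F l).card = ∑ i, (F i).m := by
    intro l
    rw [sumShape, card_partSum (hlen l)]
    exact Finset.sum_congr rfl fun i _ => (F i).isShape.card_eq l
  refine ⟨hcard, fun l => colLen_partSum_le (hlen l), fun l => rowLen_zero_le_of_card_le ?_⟩
  have h2 : ∀ a, (Finset.univ.filter fun j => T j l = a).card = (sumShape F l).colLen a := by
    intro a
    have := mem_tables.1 hT l a
    rw [conjWeight_eq] at this
    beta_reduce at this
    exact_mod_cast this
  rw [hcard, ← Finset.sum_congr rfl fun a _ => h2 a,
    ← Finset.card_eq_sum_card_fiberwise fun _ _ => Finset.mem_coe.2 (Finset.mem_univ _)]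
  simp

theorem card_lt_colLen {μ : YoungDiagram} (h : μ.rowLen 0 ≤ k) (b : ℕ) :
    (Finset.univ.filter fun a : Fin k => b < μ.colLen a).card = μ.rowLen b := by
  simp only [← YoungDiagram.mem_iff_lt_colLen, YoungDiagram.mem_iff_lt_rowLen]
  rw [Fin.card_filter_val_lt, min_eq_right ((μ.rowLen_anti _ _ (Nat.zero_le _)).trans h)]

theorem card_eq_add_card_lt {α : Type*} [Fintype α] (f : α → ℕ) (y : ℕ) :
    (Finset.univ.filter fun x => f x = y).card + (Finset.univ.filter fun x => y < f x).card
      = (Finset.univ.filter fun x => y ≤ f x).card := by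
  classical
  rw [← Finset.card_union_of_disjoint]
  · congr 1
    ext x
    simp only [Finset.mem_union, Finset.mem_filter, Finset.mem_univ, true_and]
    omega
  · rw [Finset.disjoint_filter]
    intro x _ h1 h2
    omega

/-- Fibre sizes are differences of consecutive tail counts. The fibre over `0` is not determined
this way, hence `y + 1`. -/
theorem card_fiber_eq_of_card_lt {α β : Type*} [Fintype α] [Fintype β] {f : α → ℕ} {g : β → ℕ}
    (h : ∀ c, (Finset.univ.filter fun x => c < f x).card
      = (Finset.univ.filter fun x => c < g x).card) (y : ℕ) :
    (Finset.univ.filter fun x => f x = y + 1).card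
      = (Finset.univ.filter fun x => g x = y + 1).card := by
  have h1 := card_eq_add_card_lt f (y + 1)
  have h2 := card_eq_add_card_lt g (y + 1)
  simp only [Nat.succ_le_iff, h] at h1 h2
  omega

/-- A matching of the nonempty columns of a sum of diagrams with those of the summands. -/
theorem exists_column_matching {mu : Fin q → YoungDiagram} (hk : ∀ i, (mu i).rowLen 0 ≤ k)
    (hsum : (partSum mu).rowLen 0 ≤ k) :
    ∃ e : {x : Fin q × Fin k // 0 < (mu x.1).colLen x.2} ≃
      {a : Fin k // 0 < (partSum mu).colLen a},
      ∀ x, (partSum mu).colLen (e x).1 = (mu x.1.1).colLen x.1.2 := by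
  -- The number of columns longer than `c` is the length of row `c`, and row lengths add up in
  -- `partSum`.
  have h1 : ∀ c, (Finset.univ.filter fun x : Fin q × Fin k => c < (mu x.1).colLen x.2).card
      = (Finset.univ.filter fun a : Fin k => c < (partSum mu).colLen a).card := by
    intro c
    rw [card_lt_colLen hsum, rowLen_partSum, Finset.card_filter, Fintype.sum_prod_type]
    refine Finset.sum_congr rfl fun i _ => ?_
    rw [← card_lt_colLen (hk i) c, Finset.card_filter]
  refine exists_equiv_of_card_fiber_eq (fun x : {x : Fin q × Fin k // 0 < (mu x.1).colLen x.2} =>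
    (mu x.1.1).colLen x.1.2) (fun a : {a : Fin k // 0 < (partSum mu).colLen a} =>
    (partSum mu).colLen a.1) fun y => ?_
  have hsub : ∀ {γ : Type} [Fintype γ] (f : γ → ℕ) [Fintype {x // 0 < f x}],
      (Finset.univ.filter fun x : {x // 0 < f x} => f x.1 = y).card
        = (Finset.univ.filter fun x => 0 < f x ∧ f x = y).card := by
    intro γ _ f _
    refine Finset.card_bij (fun x _ => x.1) ?_ ?_ ?_
    · intro x hx
      simpa [x.2] using hx
    · intro x _ x' _ h
      exact Subtype.ext h
    · intro x hx
      simp only [Finset.mem_filter, Finset.mem_univ, true_and] at hx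
      exact ⟨⟨x, hx.1⟩, by simpa using hx.2, rfl⟩
  rw [hsub (fun x : Fin q × Fin k => (mu x.1).colLen x.2),
    hsub (fun a : Fin k => (partSum mu).colLen a)]
  rcases y with _ | y
  · rw [Finset.filter_false_of_mem (by intros; omega), Finset.filter_false_of_mem (by intros; omega)]
    rfl
  · have h2 := card_fiber_eq_of_card_lt h1 y
    have h3 : ∀ {γ : Type} [Fintype γ] (f : γ → ℕ),
        (Finset.univ.filter fun x => 0 < f x ∧ f x = y + 1)
          = Finset.univ.filter fun x => f x = y + 1 := by
      intro γ _ f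
      exact Finset.filter_congr fun x _ => by omega
    rw [h3, h3, h2]

/-- A letter occurs as often as its column is long, and the nonempty columns of the sum are those of
the summands taken together. Renaming letters along `exists_column_matching` gives the required
weight; only letters that occur need a new name. -/
theorem exists_isConcat (F : Fin q → Factor d n k) (hk : ∀ l, (sumShape F l).rowLen 0 ≤ k) :
    ∃ T, IsConcat F T := by
  have hcount : ∀ i l a, (Finset.univ.filter fun p => (F i).table p l = a).card
      = ((F i).shape l).colLen a := by
    intro i l a
    have := mem_tables.1 (F i).mem l a
    rw [conjWeight_eq] at this
    beta_reduce at this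
    exact_mod_cast this
  have hpos : ∀ i l p, 0 < ((F i).shape l).colLen ((F i).table p l) := by
    intro i l p
    rw [← hcount]
    exact Finset.card_pos.2 ⟨p, by simp⟩
  choose e he using fun l => exists_column_matching (mu := fun i => (F i).shape l)
    (fun i => (F i).isShape.width_le l) (hk l)
  let T : Table d (∑ i, (F i).m) k := (concatEquiv d k fun i => (F i).m).symm
    fun i p l => (e l ⟨(i, (F i).table p l), hpos i l p⟩).1
  have hT : ∀ i p l, T (finSigmaFinEquiv ⟨i, p⟩) l
      = (e l ⟨(i, (F i).table p l), hpos i l p⟩).1 := by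
    intro i p l
    have := (concatEquiv d k fun i => (F i).m).apply_symm_apply
      fun i p l => (e l ⟨(i, (F i).table p l), hpos i l p⟩).1
    exact congrFun (congrFun (congrFun this i) p) l
  have hiff : ∀ (i i' : Fin q) (p : Fin (F i).m) (p' : Fin (F i').m) (l : Fin d),
      T (finSigmaFinEquiv ⟨i, p⟩) l = T (finSigmaFinEquiv ⟨i', p'⟩) l ↔
        i = i' ∧ (F i).table p l = (F i').table p' l := by
    intro i i' p p' l
    rw [hT, hT, Subtype.val_inj, (e l).injective.eq_iff, Subtype.mk.injEq, Prod.mk.injEq]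
  refine ⟨T, mem_tables.2 fun l a => ?_, hiff⟩
  rw [conjWeight_eq]
  beta_reduce
  rw [colWeight, Nat.cast_inj]
  by_cases ha : 0 < (sumShape F l).colLen a
  · obtain ⟨⟨⟨i, b⟩, hb⟩, hx⟩ := (e l).surjective ⟨a, ha⟩
    have h1 := he l ⟨(i, b), hb⟩
    rw [hx] at h1
    have h2 := hcount i l b
    obtain ⟨p, hp⟩ : ∃ p, (F i).table p l = b := by
      have h3 : 0 < (Finset.univ.filter fun p => (F i).table p l = b).card := by
        rw [h2]
        exact hb
      obtain ⟨p, hp⟩ := Finset.card_pos.1 h3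
      exact ⟨p, by simpa using hp⟩
    subst hp
    have h4 : T (finSigmaFinEquiv ⟨i, p⟩) l = a := by
      rw [hT, hx]
    rw [sumShape, h1, ← h2, ← h4]
    exact card_filter_concat (s := fun j => T j l) (s' := fun i p => (F i).table p l)
      (fun i i' p p' => hiff i i' p p' l) i p
  · rw [Nat.eq_zero_of_not_pos ha, Finset.card_eq_zero, Finset.filter_eq_empty_iff]
    rintro j - rfl
    obtain ⟨⟨i, p⟩, rfl⟩ := finSigmaFinEquiv.surjective j
    rw [hT] at ha
    exact ha (e l _).2

theorem prodDelta_eq (F : Fin q → Factor d n k) :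
    prodDelta F = (List.ofFn fun i => idx (SymmetricAlgebra.ι ℂ (V d n)) (F i).table).prod := by
  unfold prodDelta
  congr 2
  funext i
  exact Delta_eq_idx (F i).isShape (F i).mem

theorem prodNabla_eq (F : Fin q → Factor d n k) :
    prodNabla F
      = (List.ofFn fun i => idx (ExteriorAlgebra.ι ℂ (M := V d n)) (F i).table).prod := by
  unfold prodNabla
  congr 2
  funext i
  exact Nabla_eq_idx (F i).isShape (F i).mem

theorem IsConcat.prod_idx {A : Type} [Ring A] [Algebra ℂ A] (ι : V d n →ₗ[ℂ] A) (hd : 0 < d)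
    {F : Fin q → Factor d n k} {T : Table d (∑ i, (F i).m) k} (hT : IsConcat F T) :
    (List.ofFn fun i => idx ι (F i).table).prod = (concatSign F T : ℂ) • idx ι T :=
  HWV.prod_idx ι hd hT.2

end SumShape

/-! ### Relations among products -/

section Relations

variable {d n k : ℕ} {A A' : Type} [Ring A] [Algebra ℂ A] [Ring A'] [Algebra ℂ A']
  {ι : V d n →ₗ[ℂ] A} {act : (Fin d → Matrix (Fin n) (Fin n) ℂ) → A →ₗ[ℂ] A} {ε : ℕ}
  {ι' : V d k →ₗ[ℂ] A'} {act' : (Fin d → Matrix (Fin k) (Fin k) ℂ) → A' →ₗ[ℂ] A'} {ε' : ℕ}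

/-- The weight records the rows below `n`, and the remaining rows are empty. -/
theorem eq_of_shapeWeight_eq {m m' : ℕ} {lam lam' : Fin d → YoungDiagram}
    (h : IsShape m n k lam) (h' : IsShape m' n k lam')
    (hw : shapeWeight n lam = shapeWeight n lam') : lam = lam' := by
  have hrow : ∀ l i, (lam l).rowLen i = (lam' l).rowLen i := by
    intro l i
    by_cases hi : i < n
    · have := congrFun (congrFun hw l) ⟨i, hi⟩
      simpa [shapeWeight] using this
    · have h0 : ∀ {μ : YoungDiagram}, μ.colLen 0 ≤ n → μ.rowLen i = 0 := by
        intro μ hμ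
        by_contra hne
        rw [← ne_eq, ← Nat.pos_iff_ne_zero, ← YoungDiagram.mem_iff_lt_rowLen,
          YoungDiagram.mem_iff_lt_colLen] at hne
        omega
      rw [h0 (h.length_le l), h0 (h'.length_le l)]
  funext l
  ext ⟨i, j⟩
  rw [YoungDiagram.mem_cells, YoungDiagram.mem_cells, YoungDiagram.mem_iff_lt_rowLen,
    YoungDiagram.mem_iff_lt_rowLen, hrow]

/-- A linear relation between index vectors of various shapes comes from boundaries. -/
theorem sum_mon_mem_span_of_shapes (hd : 0 < d) (hM : IsModel ι act ε) (hM' : IsModel ι' act' ε')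
    (hpar : Even (ε' + (d + ε))) {N : ℕ} {m : Fin N → ℕ} {lam : Fin N → Fin d → YoungDiagram}
    (h : ∀ r, IsShape (m r) n k (lam r)) {T : ∀ r, Table d (m r) k}
    (hT : ∀ r, T r ∈ tables (m r) (conjWeight k (lam r))) {c : Fin N → ℂ}
    (hc : ∑ r, c r • idx ι (T r) = 0) :
    ∑ r, c r • mon ι' (T r) ∈
      Submodule.span ℂ {w | ∃ m lam, IsShape m n k lam ∧ w ∈ boundaryVectors ι' m lam} := by
  classical
  let wt : Fin N → Weight d n := fun r => shapeWeight n (lam r)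
  have hmaps : ∀ r ∈ (Finset.univ : Finset (Fin N)), wt r ∈ Finset.univ.image wt :=
    fun r hr => Finset.mem_image_of_mem wt hr
  -- Index vectors of different shapes have different weights, so the relation splits by shape.
  have h0 : ∀ β ∈ Finset.univ.image wt, ∑ r with wt r = β, c r • idx ι (T r) = 0 := by
    refine eq_zero_of_sum_eq_zero (act := act) _ _ (fun β _ => Submodule.sum_mem _ fun r hr => ?_) ?_
    · rw [← (Finset.mem_filter.1 hr).2]
      exact Submodule.smul_mem _ _ (hM.idx_mem (h r) (hT r)).1
    · rw [Finset.sum_fiberwise_of_maps_to hmaps, hc]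
  rw [← Finset.sum_fiberwise_of_maps_to hmaps]
  refine Submodule.sum_mem _ fun β hβ => ?_
  obtain ⟨r₀, -, hr₀⟩ := Finset.mem_image.1 hβ
  have hlam : ∀ r, wt r = β → lam r = lam r₀ := fun r hr =>
    eq_of_shapeWeight_eq (h r) (h r₀) (hr.trans hr₀.symm)
  obtain ⟨D, hD⟩ := exists_indexMap hd hM hM' hpar (h r₀)
  have hD' : ∀ {m' : ℕ} (S : Table d m' k) (hS : S ∈ tables m' (conjWeight k (lam r₀))),
      (D ⟨mon ι' S, hM'.mon_mem hS⟩ : A) = idx ι S := by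
    intro m' S hS
    obtain rfl := size_eq_of_mem_tables hd (h r₀) hS
    exact hD S hS
  have hTr : ∀ r, wt r = β → T r ∈ tables (m r) (conjWeight k (lam r₀)) := by
    intro r hr
    rw [← hlam r hr]
    exact hT r
  have hmem : ∀ r : {r // wt r = β}, mon ι' (T r.1) ∈ weightSpace act' (conjWeight k (lam r₀)) :=
    fun r => hM'.mon_mem (hTr r.1 r.2)
  let v : weightSpace act' (conjWeight k (lam r₀)) :=
    ∑ r : {r // wt r = β}, c r.1 • ⟨mon ι' (T r.1), hmem r⟩
  have hv : (v : A') = ∑ r with wt r = β, c r • mon ι' (T r) := by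
    simp only [v, Submodule.coe_sum, Submodule.coe_smul]
    rw [Finset.sum_subtype (p := fun r => wt r = β) _ (by simp)]
  have hker : D v = 0 := by
    apply Subtype.ext
    simp only [v, map_sum, map_smul, Submodule.coe_sum, Submodule.coe_smul]
    rw [Submodule.coe_zero, ← h0 β hβ,
      Finset.sum_subtype (p := fun r => wt r = β) (Finset.univ.filter fun r => wt r = β) (by simp)]
    exact Finset.sum_congr rfl fun r _ => by rw [hD' (T r.1) (hTr r.1 r.2)]
  have h1 : (v : A') ∈ (LinearMap.ker D).map (Submodule.subtype _) := ⟨v, hker, rfl⟩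
  rw [indexMap_ker hd hM hM' hpar (h r₀) hD, hv] at h1
  refine Submodule.span_mono ?_ h1
  exact fun w hw => ⟨_, _, h r₀, hw⟩

theorem prod_relation_mem_span (hd : 0 < d) (hM : IsModel ι act ε) (hM' : IsModel ι' act' ε')
    (hpar : Even (ε' + (d + ε))) {N : ℕ} {q : Fin N → ℕ} {F : ∀ r, Fin (q r) → Factor d n k}
    {T : ∀ r, Table d (∑ i, (F r i).m) k} {c : Fin N → ℂ} (hT : ∀ r, IsConcat (F r) (T r))
    (hc : ∑ r, c r • (List.ofFn fun i => idx ι (F r i).table).prod = 0) :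
    ∑ r, (c r * (concatSign (F r) (T r) : ℂ)) • mon ι' (T r) ∈
      Submodule.span ℂ {w | ∃ m lam, IsShape m n k lam ∧ w ∈ boundaryVectors ι' m lam} := by
  refine sum_mon_mem_span_of_shapes hd hM hM' hpar (lam := fun r => sumShape (F r))
    (fun r => isShape_sumShape (hT r).1) (fun r => (hT r).1) ?_
  rw [← hc]
  exact Finset.sum_congr rfl fun r _ => by rw [(hT r).prod_idx ι hd, smul_smul]

theorem span_allBoundaries_sym (d n k : ℕ) :
    Submodule.span ℂ {w | ∃ m lam, IsShape m n k lam ∧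
      w ∈ boundaryVectors (SymmetricAlgebra.ι ℂ (V d k)) m lam}
      = Submodule.span ℂ (allSymBoundaries d n k) := by
  simp only [boundaryVectors_sym, allSymBoundaries]

theorem span_allBoundaries_alt_le (d n k : ℕ) :
    Submodule.span ℂ {w | ∃ m lam, IsShape m n k lam ∧
      w ∈ boundaryVectors (ExteriorAlgebra.ι ℂ (M := V d k)) m lam}
      ≤ Submodule.span ℂ (allAltBoundaries d n k) := by
  rw [Submodule.span_le]
  rintro w ⟨m, lam, h, hw⟩
  have h1 := Submodule.subset_span (R := ℂ) hw
  rw [span_boundaryVectors_alt] at h1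
  refine Submodule.span_mono ?_ h1
  exact fun v hv => ⟨m, lam, h, hv⟩

end Relations

end

end HWV

end

/-! ### Assembly -/

theorem mainTheorem1 (d : ℕ) (hd : 0 < d) (n k : ℕ) :
    -- linear relations and kernels, for all sizes `m` and all `d`-tuples of partitions of `m`
    (∀ (m : ℕ) (lam : Fin d → YoungDiagram), HWV.IsShape m n k lam →
      -- (i) odd `d`
      (Odd d →
        ((∀ (l : Fin d) (i j : Fin k), i < j →
            ∀ X ∈ HWV.tables01 m (HWV.shiftWeight l i j (HWV.conjWeight k lam)),
              ∑ T ∈ HWV.boundary l j i X, HWV.Delta n lam T = 0) ∧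
          (∀ (l : Fin d) (i j : Fin k), i < j →
            ∀ Y ∈ HWV.tables m (HWV.shiftWeight l i j (HWV.conjWeight k lam)),
              ∑ S ∈ HWV.boundary l j i Y, (HWV.stabCard S : ℂ) • HWV.Nabla n lam S = 0)) ∧
        ((∃! D : HWV.weightSpace HWV.altAct (HWV.conjWeight k lam) →ₗ[ℂ]
              HWV.hwSpace HWV.symAct (HWV.shapeWeight n lam),
            HWV.IsAltIndexMap (m := m) (HWV.Delta n lam) D) ∧
          (∀ D : HWV.weightSpace HWV.altAct (HWV.conjWeight k lam) →ₗ[ℂ]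
              HWV.hwSpace HWV.symAct (HWV.shapeWeight n lam),
            HWV.IsAltIndexMap (m := m) (HWV.Delta n lam) D →
              (LinearMap.ker D).map (Submodule.subtype _) =
                Submodule.span ℂ (HWV.altBoundaries m k lam))) ∧
        ((∃! D : HWV.weightSpace HWV.symAct (HWV.conjWeight k lam) →ₗ[ℂ]
              HWV.hwSpace HWV.altAct (HWV.shapeWeight n lam),
            HWV.IsSymIndexMap (m := m) (HWV.Nabla n lam) D) ∧
          (∀ D : HWV.weightSpace HWV.symAct (HWV.conjWeight k lam) →ₗ[ℂ]
              HWV.hwSpace HWV.altAct (HWV.shapeWeight n lam),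
            HWV.IsSymIndexMap (m := m) (HWV.Nabla n lam) D →
              (LinearMap.ker D).map (Submodule.subtype _) =
                Submodule.span ℂ (HWV.symBoundaries m k lam)))) ∧
      -- (ii) even `d`
      (Even d →
        ((∀ (l : Fin d) (i j : Fin k), i < j →
            ∀ Y ∈ HWV.tables m (HWV.shiftWeight l i j (HWV.conjWeight k lam)),
              ∑ S ∈ HWV.boundary l j i Y, (HWV.stabCard S : ℂ) • HWV.Delta n lam S = 0) ∧
          (∀ (l : Fin d) (i j : Fin k), i < j →
            ∀ X ∈ HWV.tables01 m (HWV.shiftWeight l i j (HWV.conjWeight k lam)),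
              ∑ T ∈ HWV.boundary l j i X, HWV.Nabla n lam T = 0)) ∧
        ((∃! D : HWV.weightSpace HWV.symAct (HWV.conjWeight k lam) →ₗ[ℂ]
              HWV.hwSpace HWV.symAct (HWV.shapeWeight n lam),
            HWV.IsSymIndexMap (m := m) (HWV.Delta n lam) D) ∧
          (∀ D : HWV.weightSpace HWV.symAct (HWV.conjWeight k lam) →ₗ[ℂ]
              HWV.hwSpace HWV.symAct (HWV.shapeWeight n lam),
            HWV.IsSymIndexMap (m := m) (HWV.Delta n lam) D →
              (LinearMap.ker D).map (Submodule.subtype _) =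
                Submodule.span ℂ (HWV.symBoundaries m k lam))) ∧
        ((∃! D : HWV.weightSpace HWV.altAct (HWV.conjWeight k lam) →ₗ[ℂ]
              HWV.hwSpace HWV.altAct (HWV.shapeWeight n lam),
            HWV.IsAltIndexMap (m := m) (HWV.Nabla n lam) D) ∧
          (∀ D : HWV.weightSpace HWV.altAct (HWV.conjWeight k lam) →ₗ[ℂ]
              HWV.hwSpace HWV.altAct (HWV.shapeWeight n lam),
            HWV.IsAltIndexMap (m := m) (HWV.Nabla n lam) D →
              (LinearMap.ker D).map (Submodule.subtype _) =
                Submodule.span ℂ (HWV.altBoundaries m k lam))))) ∧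
    -- (iii) every product of `Δ`s (of `∇`s) is, up to sign, a single `Δ` (`∇`) ...
    (∀ (q : ℕ) (F : Fin q → HWV.Factor d n k),
      ((∀ l, (HWV.sumShape F l).rowLen 0 ≤ k) → ∃ T, HWV.IsConcat F T) ∧
      ∀ T, HWV.IsConcat F T →
        HWV.prodDelta F = (HWV.concatSign F T : ℂ) • HWV.Delta n (HWV.sumShape F) T ∧
        HWV.prodNabla F = (HWV.concatSign F T : ℂ) • HWV.Nabla n (HWV.sumShape F) T) ∧
    -- ... and every algebraic relation, rewritten linearly, is a combination of the boundary sums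
    (∀ (N : ℕ) (q : Fin N → ℕ) (F : ∀ r, Fin (q r) → HWV.Factor d n k)
        (T : ∀ r, HWV.Table d (∑ i, (F r i).m) k) (c : Fin N → ℂ),
      (∀ r, HWV.IsConcat (F r) (T r)) →
      (∑ r, c r • HWV.prodDelta (F r) = 0 →
        (Odd d → ∑ r, (c r * (HWV.concatSign (F r) (T r) : ℂ)) • HWV.wedge (T r) ∈
          Submodule.span ℂ (HWV.allAltBoundaries d n k)) ∧
        (Even d → ∑ r, (c r * (HWV.concatSign (F r) (T r) : ℂ)) • HWV.vee (T r) ∈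
          Submodule.span ℂ (HWV.allSymBoundaries d n k))) ∧
      (∑ r, c r • HWV.prodNabla (F r) = 0 →
        (Odd d → ∑ r, (c r * (HWV.concatSign (F r) (T r) : ℂ)) • HWV.vee (T r) ∈
          Submodule.span ℂ (HWV.allSymBoundaries d n k)) ∧
        (Even d → ∑ r, (c r * (HWV.concatSign (F r) (T r) : ℂ)) • HWV.wedge (T r) ∈
          Submodule.span ℂ (HWV.allAltBoundaries d n k)))) := by
  have sym := HWV.isModel_sym d n
  have alt := HWV.isModel_alt d n
  have sym' := HWV.isModel_sym d k
  have alt' := HWV.isModel_alt d k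
  -- In each case the source is the algebra making `ε' + (d + ε)` even: the opposite kind for odd
  -- `d`, the same kind for even `d`.
  refine ⟨fun m lam h => ⟨fun hodd => ?_, fun heven => ?_⟩, fun q F => ⟨fun hk => ?_, fun T hT => ?_⟩,
    fun N q F T c hT => ⟨fun hc => ⟨fun hodd => ?_, fun heven => ?_⟩,
      fun hc => ⟨fun hodd => ?_, fun heven => ?_⟩⟩⟩
  · obtain ⟨r₁, u₁, k₁⟩ := HWV.altIndexMap_spec hd sym (by rw [add_zero, add_comm]; exact hodd.add_one)
      h (fun T hT => HWV.Delta_eq_idx h hT)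
    obtain ⟨r₂, u₂, k₂⟩ := HWV.symIndexMap_spec hd alt hodd.add_one
      h (fun T hT => HWV.Nabla_eq_idx h hT)
    exact ⟨⟨r₁, r₂⟩, ⟨u₁, k₁⟩, u₂, k₂⟩
  · obtain ⟨r₁, u₁, k₁⟩ := HWV.symIndexMap_spec hd sym (by rwa [add_zero])
      h (fun T hT => HWV.Delta_eq_idx h hT)
    obtain ⟨r₂, u₂, k₂⟩ := HWV.altIndexMap_spec hd alt
      (by rw [add_left_comm]; exact heven.add even_two)
      h (fun T hT => HWV.Nabla_eq_idx h hT)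
    exact ⟨⟨r₁, r₂⟩, ⟨u₁, k₁⟩, u₂, k₂⟩
  · exact HWV.exists_isConcat F hk
  · have h := HWV.isShape_sumShape hT.1
    rw [HWV.prodDelta_eq, HWV.prodNabla_eq, HWV.Delta_eq_idx h hT.1, HWV.Nabla_eq_idx h hT.1]
    exact ⟨hT.prod_idx _ hd, hT.prod_idx _ hd⟩
  · simp only [HWV.prodDelta_eq] at hc
    have := HWV.prod_relation_mem_span hd sym alt'
      (by rw [add_zero, add_comm]; exact hodd.add_one) hT hc
    simp only [HWV.mon_alt] at this
    exact HWV.span_allBoundaries_alt_le d n k this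
  · simp only [HWV.prodDelta_eq] at hc
    have := HWV.prod_relation_mem_span hd sym sym' (by rwa [add_zero, zero_add]) hT hc
    rw [HWV.span_allBoundaries_sym] at this
    simpa only [HWV.mon_sym] using this
  · simp only [HWV.prodNabla_eq] at hc
    have := HWV.prod_relation_mem_span hd alt sym' (by rw [zero_add]; exact hodd.add_one) hT hc
    rw [HWV.span_allBoundaries_sym] at this
    simpa only [HWV.mon_sym] using this
  · simp only [HWV.prodNabla_eq] at hc
    have := HWV.prod_relation_mem_span hd alt alt'
      (by rw [add_left_comm]; exact heven.add even_two) hT hc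
    simp only [HWV.mon_alt] at this
    exact HWV.span_allBoundaries_alt_le d n k this
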